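/- Consider on $\mathbb{R}^3$ the Cauchy problem for the linearized homogeneous Euler–Maxwell system for $U=[\rho,u,\Theta,E,B]$ ($\rho,\Theta$ scalar, $u,E,B$ three-component): $$\partial_t\rho+\nabla\cdot u=0,\qquad \partial_t u+\nabla\rho+\nabla\Theta+E+u=0,\qquad \partial_t\Theta+\tfrac23\nabla\cdot u+\Theta=0,$$ $$\partial_t E-\nabla\times B-u=0,\qquad \partial_t B+\nabla\times E=0,\qquad \nabla\cdot E=-\rho,\quad \nabla\cdot B=0\qquad (t>0),$$ with $U|_{t=0}=U_0=[\rho_0,u_0,\Theta_0,E_0,B_0]$ satisfying $\nabla\cdot E_0=-\rho_0$ and $\nabla\cdot B_0=0$. Write $U(t)=e^{tL}U_0$ for its solution; data and solution are taken in the space of tempered distributions (the system holds for $t>0$ with $\partial_t$ taken after pairing with each fixed Schwartz function, and $U(t)\to U_0$ as $t\downarrow0$ in the same sense). For a tempered distribution $f$, $\|f\|_{L^q}$ is $+\infty$ if $f$ is not given by a function in $L^q$; $\|\nabla^m f\|_{L^q}$ is the sum of the $L^q$ norms of all iterated partial derivatives of order $m$, and the norm of a list or vector such as $[u_0,E_0,B_0]$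 is the sum of the norms of its scalar components. For $a\ge 0$ and $1\le r\le 2\le q\le\infty$ put $$\Big[a+3\big(\tfrac1r-\tfrac1q\big)\Big]_+=\begin{cases} a & \text{if } r=q=2 \text{ and } a \text{ is an integer},\\ \big\lfloor a+3(\tfrac1r-\tfrac1q)\big\rfloor+1 & \text{otherwise.}\end{cases}$$ **Theorem.** Let $1\le p,r\le 2\le q\le\infty$, let $l\ge0$ be real and $m\ge0$ an integer, and write $N_a=m+[a+3(\frac1r-\frac1q)]_+$. There is a constant $C=C(p,q,r,l,m)>0$ such that for every such $U_0$, every such solution $U$ and every $t\ge0$: $$\|\nabla^m\rho(t)\|_{L^q}\le Ce^{-t/2}\big(\|[\rho_0,u_0,\Theta_0]\|_{L^p}+\|\nabla^{N_0}[\rho_0,u_0,\Theta_0]\|_{L^r}\big),$$ $$\begin{aligned}\|\nabla^m u(t)\|_{L^q}\le{}& Ce^{-t/2}\big(\|[\rho_0,\Theta_0]\|_{L^p}+\|\nabla^{N_0}[\rho_0,\Theta_0]\|_{L^r}\big)\\&+C(1+t)^{-\frac32(\frac1p-\frac1q)-\frac{m+1}2}\|[u_0,E_0,B_0]\|_{L^p}+C(1+t)^{-\frac{l+1}2}\|\nabla^{N_l}[u_0,E_0,B_0]\|_{L^r},\end{aligned}$$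 $$\|\nabla^m\Theta(t)\|_{L^q}\le Ce^{-t/2}\big(\|[\rho_0,u_0,\Theta_0]\|_{L^p}+\|\nabla^{N_0}[\rho_0,u_0,\Theta_0]\|_{L^r}\big),$$ $$\|\nabla^m E(t)\|_{L^q}\le C(1+t)^{-\frac32(\frac1p-\frac1q)-\frac{m+1}2}\|[u_0,\Theta_0,E_0,B_0]\|_{L^p}+C(1+t)^{-\frac l2}\|\nabla^{N_l}[u_0,\Theta_0,E_0,B_0]\|_{L^r},$$ $$\|\nabla^m B(t)\|_{L^q}\le C(1+t)^{-\frac32(\frac1p-\frac1q)-\frac m2}\|[u_0,E_0,B_0]\|_{L^p}+C(1+t)^{-\frac l2}\|\nabla^{N_l}[u_0,E_0,B_0]\|_{L^r}.$$ Here an estimate whose right-hand side is $+\infty$ asserts nothing; when it is finite, the estimate includes that the derivatives on the left are functions in $L^q$. -/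

import Mathlib

open MeasureTheory Filter Topology
open scoped ENNReal SchwartzMap LineDeriv

noncomputable section

namespace EulerMaxwell

/-- Physical space `ℝ³`. -/
abbrev R3 : Type := EuclideanSpace ℝ (Fin 3)

/-- Scalar tempered distributions on `ℝ³`. -/
abbrev Dist : Type := 𝓢'(R3, ℂ)

/-- The partial derivative `∂_j T` of a tempered distribution. -/
def partialD (j : Fin 3) (T : Dist) : Dist :=
  ∂_{(EuclideanSpace.single j (1 : ℝ) : R3)} T

/-- The iterated partial derivative `∂_{α 0} ∂_{α 1} ⋯ ∂_{α (m-1)} T`. -/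
def iterD {m : ℕ} (α : Fin m → Fin 3) (T : Dist) : Dist :=
  ∂^{fun i => (EuclideanSpace.single (α i) (1 : ℝ) : R3)} T

/-- The divergence of a vector field of tempered distributions. -/
def divD (v : Fin 3 → Dist) : Dist := ∑ j, partialD j (v j)

/-- The curl of a vector field of tempered distributions. -/
def curlD (v : Fin 3 → Dist) : Fin 3 → Dist :=
  ![partialD 1 (v 2) - partialD 2 (v 1),
    partialD 2 (v 0) - partialD 0 (v 2),
    partialD 0 (v 1) - partialD 1 (v 0)]

/-- The distribution `T` is given by integration against the function `f`. -/
def Represents (f : R3 → ℂ) (T : Dist) : Prop :=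
  ∀ φ : 𝓢(R3, ℂ), T φ = ∫ x, φ x * f x

/-- The `L^q` norm of a tempered distribution (used for `q ≥ 1`): the norm of the function in
`L^q` which represents it (unique up to null sets), and `∞` if there is no such function. -/
def lpNorm (q : ℝ≥0∞) (T : Dist) : ℝ≥0∞ :=
  ⨅ (f : R3 → ℂ) (_ : MemLp f q volume ∧ Represents f T), eLpNorm f q volume

/-- `‖∇^m T‖_{L^q}`: the sum of the `L^q` norms of all partial derivatives of order `m`.
For `m = 0` this is `‖T‖_{L^q}`. -/
def gradNorm (m : ℕ) (q : ℝ≥0∞) (T : Dist) : ℝ≥0∞ :=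
  ∑ α : Fin m → Fin 3, lpNorm q (iterD α T)

/-- `‖∇^m v‖_{L^q}` for a vector field `v`. -/
def gradNormVec (m : ℕ) (q : ℝ≥0∞) (v : Fin 3 → Dist) : ℝ≥0∞ :=
  ∑ j, gradNorm m q (v j)

/-- A state `[ρ, u, Θ, E, B]`: density, velocity and temperature perturbations, electric and
magnetic field. -/
structure State where
  ρ : Dist
  u : Fin 3 → Dist
  Θ : Dist
  E : Fin 3 → Dist
  B : Fin 3 → Dist

namespace State

/-- `‖∇^m [ρ, Θ]‖_{L^q}` -/
def normρΘ (m : ℕ) (q : ℝ≥0∞) (U : State) : ℝ≥0∞ :=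
  gradNorm m q U.ρ + gradNorm m q U.Θ

/-- `‖∇^m [ρ, u, Θ]‖_{L^q}` -/
def normρuΘ (m : ℕ) (q : ℝ≥0∞) (U : State) : ℝ≥0∞ :=
  gradNorm m q U.ρ + gradNormVec m q U.u + gradNorm m q U.Θ

/-- `‖∇^m [u, E, B]‖_{L^q}` -/
def normuEB (m : ℕ) (q : ℝ≥0∞) (U : State) : ℝ≥0∞ :=
  gradNormVec m q U.u + gradNormVec m q U.E + gradNormVec m q U.B

/-- `‖∇^m [u, Θ, E, B]‖_{L^q}` -/
def normuΘEB (m : ℕ) (q : ℝ≥0∞) (U : State) : ℝ≥0∞ :=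
  gradNormVec m q U.u + gradNorm m q U.Θ + gradNormVec m q U.E + gradNormVec m q U.B

end State

/-- The compatibility condition `∇·E = -ρ`, `∇·B = 0`. -/
def Compatible (U : State) : Prop :=
  divD U.E = -U.ρ ∧ divD U.B = 0

/-- `T' = ∂_t T` at time `t`, in the space of tempered distributions (pointwise on test
functions). -/
def HasTimeDerivAt (T : ℝ → Dist) (T' : Dist) (t : ℝ) : Prop :=
  ∀ φ : 𝓢(R3, ℂ), HasDerivAt (fun s => T s φ) (T' φ) t

/-- `T(t) → T(0)` as `t ↓ 0`, in the space of tempered distributions (pointwise on test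
functions). -/
def ContinuousAtZero (T : ℝ → Dist) : Prop :=
  ∀ φ : 𝓢(R3, ℂ), Tendsto (fun s => T s φ) (𝓝[>] 0) (𝓝 (T 0 φ))

/-- `U(t)`, `t ≥ 0`, is a solution of the Cauchy problem for the linearized homogeneous
Euler-Maxwell system
`∂_t ρ + ∇·u = 0`, `∂_t u + ∇ρ + ∇Θ + E + u = 0`, `∂_t Θ + (2/3) ∇·u + Θ = 0`,
`∂_t E - ∇×B - u = 0`, `∂_t B + ∇×E = 0`, `∇·E = -ρ`, `∇·B = 0` for `t > 0`,
with initial data `U₀`, in the sense of tempered distributions.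
Values at negative times play no role. -/
structure IsSolution (U₀ : State) (U : ℝ → State) : Prop where
  eq_ρ : ∀ t : ℝ, 0 < t → HasTimeDerivAt (fun s => (U s).ρ) (-divD (U t).u) t
  eq_u : ∀ t : ℝ, 0 < t → ∀ j, HasTimeDerivAt (fun s => (U s).u j)
    (-partialD j (U t).ρ - partialD j (U t).Θ - (U t).E j - (U t).u j) t
  eq_Θ : ∀ t : ℝ, 0 < t → HasTimeDerivAt (fun s => (U s).Θ)
    (-((2 / 3 : ℂ) • divD (U t).u) - (U t).Θ) t
  eq_E : ∀ t : ℝ, 0 < t → ∀ j, HasTimeDerivAt (fun s => (U s).E j)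
    (curlD (U t).B j + (U t).u j) t
  eq_B : ∀ t : ℝ, 0 < t → ∀ j, HasTimeDerivAt (fun s => (U s).B j)
    (-curlD (U t).E j) t
  constraint : ∀ t : ℝ, 0 < t → Compatible (U t)
  init : U 0 = U₀
  cont_ρ : ContinuousAtZero (fun s => (U s).ρ)
  cont_u : ∀ j, ContinuousAtZero (fun s => (U s).u j)
  cont_Θ : ContinuousAtZero (fun s => (U s).Θ)
  cont_E : ∀ j, ContinuousAtZero (fun s => (U s).E j)
  cont_B : ∀ j, ContinuousAtZero (fun s => (U s).B j)

/-- The real number `1/a - 1/b` for exponents `a, b ∈ [1, ∞]`, with `1/∞ = 0`. -/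
def gap (a b : ℝ≥0∞) : ℝ := (a⁻¹).toReal - (b⁻¹).toReal

open Classical in
/-- The number of derivatives `[l + 3(1/r - 1/q)]_+`: it is `l` if `r = q = 2` and `l` is an
integer, and the integer part of `l + 3(1/r - 1/q)` plus one otherwise
(for `l ≥ 0` and `r ≤ q`). -/
def bracketPlus (l : ℝ) (r q : ℝ≥0∞) : ℕ :=
  if r = 2 ∧ q = 2 ∧ ∃ n : ℤ, (n : ℝ) = l then ⌊l⌋₊ else ⌊l + 3 * gap r q⌋₊ + 1

end EulerMaxwell

end

/-! On the Fourier side the system is a linear ordinary differential equation at each frequency ξ.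
Put κ = 2π|ξ|. The divergence constraints decouple it into two blocks of size three. The density,
the divergence of the velocity and the temperature form the longitudinal block, with characteristic
polynomial λ³ + 2λ² + (2 + 5κ²/3)λ + 1 + κ². Its real root lies in [-1, -3/5] and its complex pair
has real part at most -1/2, which gives the rate e^{-t/2} at all frequencies
(`longitudinal_third_order_bound`). The transverse parts of velocity and electric field, with the
curl of the magnetic field, form the second block, with polynomial λ³ + λ² + (1 + κ²)λ + κ². Its
real root -s is comparable to -κ² at low frequencies (diffusion), while the complex pair has real
part -(1-s)/2, bounded away from 0 only by a multiple of κ^{-2} at high frequencies (regularity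
loss). The outcome is the profile `decayProfile a b`: a counts the powers of κ gained at low
frequencies, b the powers of 1/κ gained at high frequencies. `ComponentSystem.norm_le` and
`MagneticSystem.norm_le` collect these bounds.

The passage to L^q is Hausdorff-Young from p to p' on the data, Hölder against the profile, and
Hausdorff-Young from q' to q on the solution (`hausdorff_young`, `exists_eLpNorm_decayProfile_le`,
`exists_gradNorm_le`). At low frequencies, κ^{m+a} e^{-κ²t/8} in L^s with 1/s = 1/p - 1/q gives the
power of 1 + t by scaling. At high frequencies, e^{-t/(8κ²)} is bounded by a power of κ²/(1+t), so
decay of order (l+b)/2 costs l derivatives beyond the gain κ^{-b}; the remaining negative power of κ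
must lie in L^s with 1/s = 1/r - 1/q, and this is what the bracket `[·]_+` ensures.

A solution is only a family of tempered distributions, so it must be shown that its Fourier
transform really is exp(tA(ξ)) applied to that of the data. `IsSymbolSolution.eq_integral_exp` does
this against compactly supported test functions. There the iterates of the symbol grow geometrically
in every Schwartz seminorm, the uniform boundedness principle bounds the solution on [0, T] by one
such seminorm, and hence the Taylor series in time converges. -/

/-! ### Schwartz space: completeness, uniform boundedness, density of compact supports -/

section SchwartzComplete

open scoped Uniformity ContDiff

variable {E F : Type*} [NormedAddCommGroup E] [NormedSpace ℝ E]
  [NormedAddCommGroup F] [NormedSpace ℝ F]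

namespace SchwartzMap

/-- A series of Schwartz functions which converges absolutely in every Schwartz seminorm has a sum
in the Schwartz space. -/
theorem exists_tendsto_sum [CompleteSpace F] (v : ℕ → 𝓢(E, F))
    (hv : ∀ k n, Summable fun j => SchwartzMap.seminorm ℝ k n (v j)) :
    ∃ g : 𝓢(E, F), Tendsto (fun N => ∑ j ∈ Finset.range N, v j) atTop (𝓝 g) := by
  have hbd : ∀ (k : ℕ) (i : ℕ) (x : E), ‖iteratedFDeriv ℝ k (v i) x‖ ≤
      SchwartzMap.seminorm ℝ 0 k (v i) := fun k i x =>
    norm_iteratedFDeriv_le_seminorm ℝ (v i) k x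
  have hD : ∀ (n : ℕ) (x : E), iteratedFDeriv ℝ n (fun y => ∑' j, v j y) x =
      ∑' j, iteratedFDeriv ℝ n (v j) x := fun n x =>
    iteratedFDeriv_tsum_apply (N := ⊤) (fun i => (v i).smooth ⊤) (fun k _ => hv 0 k)
      (fun k i x _ => hbd k i x) (by simp) x
  have hS : ∀ (n : ℕ) (x : E), Summable fun j => iteratedFDeriv ℝ n (v j) x := fun n x =>
    Summable.of_norm_bounded (hv 0 n) (fun i => hbd n i x)
  -- This tail bound serves twice: `N = 0` gives the decay of the sum itself, and large `N` the
  -- convergence of the partial sums in each seminorm.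
  have htail : ∀ (k n N : ℕ) (x : E),
      ‖x‖ ^ k * ‖iteratedFDeriv ℝ n (fun y => ∑' j, v j y) x -
        ∑ j ∈ Finset.range N, iteratedFDeriv ℝ n (v j) x‖ ≤
      ∑' j, SchwartzMap.seminorm ℝ k n (v (j + N)) := by
    intro k n N x
    rw [hD, ← (hS n x).sum_add_tsum_nat_add N, add_sub_cancel_left]
    have h1 : Summable fun j => ‖iteratedFDeriv ℝ n (v (j + N)) x‖ :=
      (summable_nat_add_iff (f := fun j => ‖iteratedFDeriv ℝ n (v j) x‖) N).2
        (Summable.of_nonneg_of_le (fun _ => norm_nonneg _) (fun i => hbd n i x) (hv 0 n))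
    calc _ ≤ ‖x‖ ^ k * ∑' j, ‖iteratedFDeriv ℝ n (v (j + N)) x‖ := by
            gcongr; exact norm_tsum_le_tsum_norm h1
      _ = ∑' j, ‖x‖ ^ k * ‖iteratedFDeriv ℝ n (v (j + N)) x‖ := by rw [tsum_mul_left]
      _ ≤ _ := (h1.mul_left _).tsum_le_tsum (fun j => le_seminorm ℝ k n _ x)
            ((summable_nat_add_iff (f := fun j => SchwartzMap.seminorm ℝ k n (v j)) N).2 (hv k n))
  let g : 𝓢(E, F) :=
    { toFun := fun y => ∑' j, v j y
      smooth' := contDiff_tsum (N := ⊤) (fun i => (v i).smooth ⊤) (fun k _ => hv 0 k)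
        (fun k i x _ => hbd k i x)
      decay' := fun k n => ⟨∑' j, SchwartzMap.seminorm ℝ k n (v j), fun x => by
        simpa using htail k n 0 x⟩ }
  refine ⟨g, ?_⟩
  rw [(schwartz_withSeminorms ℝ E F).tendsto_nhds_atTop]
  rintro ⟨k, n⟩ ε hε
  have h0 := tendsto_sum_nat_add (fun j => SchwartzMap.seminorm ℝ k n (v j))
  obtain ⟨N₀, hN₀⟩ := ((tendsto_order.1 h0).2 ε hε).exists_forall_of_atTop
  refine ⟨N₀, fun N hN => lt_of_le_of_lt ?_ (hN₀ N hN)⟩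
  refine seminorm_le_bound ℝ k n _ (tsum_nonneg fun _ => apply_nonneg _ _) fun x => ?_
  refine le_trans (le_of_eq ?_) (htail k n N x)
  congr 1
  rw [← norm_neg]
  congr 1
  have h3 : ⇑(∑ j ∈ Finset.range N, v j - g) =
      (fun y => ∑ j ∈ Finset.range N, v j y) - fun y => ∑' j, v j y := by
    ext y; simp [g]; rfl
  have h4 : iteratedFDeriv ℝ n (fun y => ∑ j ∈ Finset.range N, v j y) x =
      ∑ j ∈ Finset.range N, iteratedFDeriv ℝ n (v j) x := by
    rw [iteratedFDeriv_sum fun j _ => (v j).smooth n, Finset.sum_apply]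
  rw [h3, iteratedFDeriv_sub_apply, neg_sub, h4]
  · exact (ContDiff.sum fun j _ => (v j).smooth n).contDiffAt
  · exact (g.smooth n).contDiffAt

/-- The uniformity is countably generated, so it is enough to treat sequences whose `N`-th increment
is below 2^{-N} in all seminorms of index at most (N, N). Such a sequence telescopes into an
absolutely convergent series. -/
instance [CompleteSpace F] : CompleteSpace 𝓢(E, F) := by
  have : (𝓤 𝓢(E, F)).IsCountablyGenerated := IsUniformAddGroup.uniformity_countably_generated
  let p := schwartzSeminormFamily ℝ E F
  let U : ℕ → SetRel 𝓢(E, F) 𝓢(E, F) := fun N =>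
    {fg | (fg.2 - fg.1) ∈ ((Finset.Iic (N, N)).sup p).ball 0 ((1 / 2 : ℝ) ^ N)}
  refine UniformSpace.complete_of_convergent_controlled_sequences U (fun N => ?_) fun u hu => ?_
  · rw [uniformity_eq_comap_nhds_zero]
    refine ⟨((Finset.Iic (N, N)).sup p).ball 0 ((1 / 2 : ℝ) ^ N), ?_, fun _ h => h⟩
    exact (schwartz_withSeminorms ℝ E F).hasBasis_zero_ball.mem_of_mem
      (i := (Finset.Iic (N, N), (1 / 2 : ℝ) ^ N)) (by positivity)
  · have hv : ∀ k n, Summable fun j => SchwartzMap.seminorm ℝ k n (u (j + 1) - u j) := by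
      intro k n
      refine Summable.of_norm_bounded_eventually (summable_geometric_two) ?_
      rw [Nat.cofinite_eq_atTop]
      filter_upwards [eventually_ge_atTop (max k n)] with N hN
      have h := hu N N (N + 1) le_rfl (Nat.le_succ N)
      simp only [U, Set.mem_ofPred_eq, Seminorm.mem_ball_zero] at h
      rw [Real.norm_of_nonneg (apply_nonneg _ _)]
      refine le_trans ?_ h.le
      have h2 : p (k, n) ≤ (Finset.Iic (N, N)).sup p :=
        Finset.le_sup (f := p) (Finset.mem_Iic.2 ⟨(le_max_left _ _).trans hN,
          (le_max_right _ _).trans hN⟩)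
      exact h2 _
    obtain ⟨g, hg⟩ := exists_tendsto_sum _ hv
    refine ⟨g + u 0, ?_⟩
    simp_rw [Finset.sum_range_sub] at hg
    simpa using hg.add_const (u 0)

/-- Completeness and a countably generated uniformity give the Baire property, hence barrelledness,
which is the input of the uniform boundedness principle. -/
instance [CompleteSpace F] : BarrelledSpace ℝ 𝓢(E, F) := by
  have : (𝓤 𝓢(E, F)).IsCountablyGenerated := IsUniformAddGroup.uniformity_countably_generated
  infer_instance

instance [NormedSpace ℂ F] [CompleteSpace F] [SMulCommClass ℝ ℂ F] :
    BarrelledSpace ℂ 𝓢(E, F) := by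
  have : (𝓤 𝓢(E, F)).IsCountablyGenerated := IsUniformAddGroup.uniformity_countably_generated
  infer_instance

/-- The sum of all Schwartz seminorms of order at most `N` in both indices. -/
noncomputable def orderSeminorm (N : ℕ) (φ : 𝓢(E, ℂ)) : ℝ :=
  ((Finset.Iic (N, N)).sup (schwartzSeminormFamily ℂ E ℂ)) φ

theorem seminorm_le_orderSeminorm {N k n : ℕ} (hk : k ≤ N) (hn : n ≤ N) (φ : 𝓢(E, ℂ)) :
    SchwartzMap.seminorm ℂ k n φ ≤ orderSeminorm N φ := by
  have h2 : schwartzSeminormFamily ℂ E ℂ (k, n) ≤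
      (Finset.Iic (N, N)).sup (schwartzSeminormFamily ℂ E ℂ) :=
    Finset.le_sup (f := schwartzSeminormFamily ℂ E ℂ) (Finset.mem_Iic.2 ⟨hk, hn⟩)
  exact h2 φ

theorem orderSeminorm_le {N : ℕ} (φ : 𝓢(E, ℂ)) {M : ℝ} (hM : 0 ≤ M)
    (h : ∀ k n, k ≤ N → n ≤ N → SchwartzMap.seminorm ℂ k n φ ≤ M) : orderSeminorm N φ ≤ M := by
  refine Seminorm.finset_sup_apply_le hM ?_
  rintro ⟨k, n⟩ hi
  rw [Finset.mem_Iic] at hi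
  exact h k n hi.1 hi.2

theorem orderSeminorm_nonneg (N : ℕ) (φ : 𝓢(E, ℂ)) : 0 ≤ orderSeminorm N φ := apply_nonneg _ _

theorem orderSeminorm_sum_le {ι : Type*} (N : ℕ) (s : Finset ι) (φ : ι → 𝓢(E, ℂ)) :
    orderSeminorm N (∑ i ∈ s, φ i) ≤ ∑ i ∈ s, orderSeminorm N (φ i) :=
  Finset.le_sum_of_subadditive _ (map_zero _).le (map_add_le_add _) _ _

/-- The uniform boundedness principle for families of tempered functionals. -/
theorem uniform_bound_of_pointwise {ι : Type*} (T : ι → 𝓢(E, ℂ) →L[ℂ] ℂ)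
    (h : ∀ φ, ∃ M, ∀ i, ‖T i φ‖ ≤ M) :
    ∃ (N : ℕ) (C : ℝ), 0 ≤ C ∧ ∀ i φ, ‖T i φ‖ ≤ C * orderSeminorm N φ := by
  let p : ι → Seminorm ℂ 𝓢(E, ℂ) := fun i => (normSeminorm ℂ ℂ).comp (T i).toLinearMap
  have hb : BddAbove (Set.range p) := by
    rw [Seminorm.bddAbove_range_iff]
    intro φ
    obtain ⟨M, hM⟩ := h φ
    exact ⟨M, by rintro _ ⟨i, rfl⟩; exact hM i⟩
  -- Barrelledness enters here: a pointwise bounded supremum of continuous seminorms is continuous,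
  -- and so is controlled by finitely many Schwartz seminorms.
  have hc := Seminorm.continuous_iSup p
    (fun i => (continuous_norm.comp (T i).continuous : Continuous fun φ => ‖T i φ‖)) hb
  rw [← Seminorm.coe_iSup_eq hb] at hc
  obtain ⟨s, C, -, hC⟩ := Seminorm.bound_of_continuous (schwartz_withSeminorms ℂ E ℂ) _ hc
  let N := s.sup fun i => max i.1 i.2
  refine ⟨N, C, C.2, fun i φ => ?_⟩
  have h1 : ‖T i φ‖ ≤ (⨆ i, p i) φ := by
    rw [Seminorm.coe_iSup_eq hb, iSup_apply]
    exact le_ciSup (f := fun i => p i φ) ((Seminorm.bddAbove_range_iff.1 hb) φ) i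
  refine h1.trans ((hC φ).trans ?_)
  have h2 : s.sup (schwartzSeminormFamily ℂ E ℂ) ≤
      (Finset.Iic (N, N)).sup (schwartzSeminormFamily ℂ E ℂ) := by
    refine Finset.sup_mono fun i hi => Finset.mem_Iic.2 ?_
    have := Finset.le_sup (f := fun i : ℕ × ℕ => max i.1 i.2) hi
    exact ⟨(le_max_left _ _).trans this, (le_max_right _ _).trans this⟩
  have := h2 φ
  change (C : ℝ) * _ ≤ _
  exact mul_le_mul_of_nonneg_left this C.2

/-- Multiplication by a smooth function with bounded derivatives does not increase the order of
Schwartz seminorms. -/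
theorem exists_orderSeminorm_smulLeft_le {g : E → ℂ} (hg : ContDiff ℝ ∞ g)
    (hb : ∀ n, ∃ B, ∀ x, ‖iteratedFDeriv ℝ n g x‖ ≤ B) (N : ℕ) :
    ∃ D, 0 ≤ D ∧ ∀ φ ψ : 𝓢(E, ℂ), (∀ x, ψ x = g x * φ x) →
      orderSeminorm N ψ ≤ D * orderSeminorm N φ := by
  choose B hB using hb
  have hB0 : ∀ n, 0 ≤ B n := fun n => (norm_nonneg _).trans (hB n 0)
  let D := ∑ n ∈ Finset.range (N + 1), ∑ i ∈ Finset.range (n + 1), (n.choose i : ℝ) * B i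
  have hin : ∀ n, 0 ≤ ∑ i ∈ Finset.range (n + 1), (n.choose i : ℝ) * B i := fun n =>
    Finset.sum_nonneg fun i _ => mul_nonneg (by positivity) (hB0 i)
  refine ⟨D, Finset.sum_nonneg fun n _ => hin n, fun φ ψ hψ => ?_⟩
  have hD0 : 0 ≤ D := Finset.sum_nonneg fun n _ => hin n
  refine orderSeminorm_le ψ (mul_nonneg hD0 (orderSeminorm_nonneg _ _)) fun k n hk hn => ?_
  refine seminorm_le_bound ℂ k n ψ (mul_nonneg hD0 (orderSeminorm_nonneg _ _)) fun x => ?_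
  have h1 : (ψ : E → ℂ) = fun y => g y * φ y := funext hψ
  rw [h1]
  calc _ ≤ ‖x‖ ^ k * ∑ i ∈ Finset.range (n + 1), (n.choose i : ℝ) * ‖iteratedFDeriv ℝ i g x‖ *
        ‖iteratedFDeriv ℝ (n - i) φ x‖ := by
          gcongr
          exact norm_iteratedFDeriv_mul_le hg (φ.smooth ⊤) x (mod_cast le_top)
    _ = ∑ i ∈ Finset.range (n + 1), (n.choose i : ℝ) * ‖iteratedFDeriv ℝ i g x‖ *
        (‖x‖ ^ k * ‖iteratedFDeriv ℝ (n - i) φ x‖) := by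
          rw [Finset.mul_sum]; exact Finset.sum_congr rfl fun i _ => by ring
    _ ≤ ∑ i ∈ Finset.range (n + 1), (n.choose i : ℝ) * B i * orderSeminorm N φ := by
          gcongr with i hi
          · exact mul_nonneg (by positivity) (hB0 i)
          · exact hB i x
          · exact (le_seminorm ℂ k (n - i) φ x).trans
              (seminorm_le_orderSeminorm hk ((Nat.sub_le _ _).trans hn) φ)
    _ ≤ D * orderSeminorm N φ := by
          rw [← Finset.sum_mul]
          refine mul_le_mul_of_nonneg_right ?_ (orderSeminorm_nonneg _ _)
          exact Finset.single_le_sum (f := fun n => ∑ i ∈ Finset.range (n + 1),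
            (n.choose i : ℝ) * B i) (fun n _ => hin n) (Finset.mem_range.2 (by omega))

theorem _root_.HasCompactSupport.exists_bound_iteratedFDeriv {g : E → ℂ} (hc : HasCompactSupport g)
    (hg : ContDiff ℝ ∞ g) (n : ℕ) : ∃ B, ∀ x, ‖iteratedFDeriv ℝ n g x‖ ≤ B :=
  (hc.iteratedFDeriv n).exists_bound_of_continuous (hg.continuous_iteratedFDeriv (mod_cast le_top))

/-- Compactly supported functions are dense in the Schwartz space. -/
theorem exists_tendsto_hasCompactSupport [FiniteDimensional ℝ E] (φ : 𝓢(E, ℂ)) :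
    ∃ ψ : ℕ → 𝓢(E, ℂ), (∀ j, HasCompactSupport (ψ j)) ∧ Tendsto ψ atTop (𝓝 φ) := by
  let b : ContDiffBump (0 : E) := ⟨1, 2, one_pos, one_lt_two⟩
  let χ : E → ℂ := fun x => (b x : ℂ)
  have hχs : ContDiff ℝ ∞ χ := Complex.ofRealCLM.contDiff.comp b.contDiff
  have hχc : HasCompactSupport χ := b.hasCompactSupport.comp_left (g := ((↑) : ℝ → ℂ)) rfl
  choose B hB using fun n => hχc.exists_bound_iteratedFDeriv hχs n
  have hB0 : ∀ n, 0 ≤ B n := fun n => (norm_nonneg _).trans (hB n 0)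
  let a : ℕ → ℝ := fun j => 1 / (j + 1)
  have ha0 : ∀ j, 0 < a j := fun j => by positivity
  have ha1 : ∀ j, a j ≤ 1 := fun j => by
    simp only [a]; rw [div_le_one (by positivity)]; linarith [(Nat.cast_nonneg j : (0:ℝ) ≤ j)]
  let χs : ℕ → E → ℂ := fun j x => χ (a j • x)
  have hss : ∀ j, ContDiff ℝ ∞ (χs j) := fun j => hχs.comp (contDiff_const_smul _)
  have hsc : ∀ j, HasCompactSupport (χs j) := fun j =>
    hχc.comp_homeomorph (Homeomorph.smulOfNeZero (a j) (ha0 j).ne')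
  let ψ : ℕ → 𝓢(E, ℂ) := fun j =>
    HasCompactSupport.toSchwartzMap (f := fun x => χs j x * φ x) ((hsc j).mul_right)
      ((hss j).mul (φ.smooth ⊤))
  refine ⟨ψ, fun j => (hsc j).mul_right, ?_⟩
  rw [(schwartz_withSeminorms ℂ E ℂ).tendsto_nhds _ _]
  rintro ⟨k, n⟩ ε hε
  let A : ℝ := ∑ i ∈ Finset.range (n + 1), (n.choose i : ℝ) * (1 + B i) *
    SchwartzMap.seminorm ℂ (k + 1) (n - i) φ
  have hA : 0 ≤ A := Finset.sum_nonneg fun i _ =>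
    mul_nonneg (mul_nonneg (by positivity) (by linarith [hB0 i])) (apply_nonneg _ _)
  -- The error vanishes near any `x` with `a j * ‖x‖ < 1`. Elsewhere `1 ≤ a j * ‖x‖`, so the small
  -- factor `a j` is bought with one more power of the weight.
  have key : ∀ j, SchwartzMap.seminorm ℂ k n (ψ j - φ) ≤ a j * A := by
    intro j
    refine seminorm_le_bound ℂ k n _ (mul_nonneg (ha0 j).le hA) fun x => ?_
    let η : E → ℂ := fun y => χs j y - 1
    have hη : ContDiff ℝ ∞ η := (hss j).sub contDiff_const
    have h1 : ⇑(ψ j - φ) = fun y => η y * φ y := by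
      ext y; simp only [η, sub_mul, one_mul]; rfl
    by_cases hx : a j * ‖x‖ < 1
    · have hz : η =ᶠ[𝓝 x] fun _ => 0 := by
        have : ∀ᶠ y in 𝓝 x, a j * ‖y‖ < 1 :=
          (continuous_const.mul continuous_norm).continuousAt.eventually_lt_const hx
        filter_upwards [this] with y hy
        have : b (a j • y) = 1 := b.one_of_mem_closedBall (by
          rw [mem_closedBall_zero_iff, norm_smul, Real.norm_of_nonneg (ha0 j).le]; exact hy.le)
        simp [η, χs, χ, this]
      have hz2 : ⇑(ψ j - φ) =ᶠ[𝓝 x] fun _ => 0 := by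
        rw [h1]; filter_upwards [hz] with y hy; simp [hy]
      rw [(hz2.iteratedFDeriv ℝ n).eq_of_nhds]
      have : iteratedFDeriv ℝ n (fun _ : E => (0 : ℂ)) x = 0 := by
        simp
      rw [this]; simpa using mul_nonneg (ha0 j).le hA
    · push Not at hx
      have hηb : ∀ i, ‖iteratedFDeriv ℝ i η x‖ ≤ 1 + B i := by
        intro i
        have e1 : η = χs j - fun _ => (1 : ℂ) := rfl
        rw [e1, iteratedFDeriv_sub_apply ((hss j).of_le (mod_cast le_top)).contDiffAt
          contDiff_const.contDiffAt, iteratedFDeriv_comp_const_smul _ (hχs.of_le (mod_cast le_top))]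
        refine (norm_sub_le _ _).trans ?_
        rw [add_comm]
        refine add_le_add ?_ ?_
        · rcases i with _ | i
          · simp
          · simp [iteratedFDeriv_succ_const]
        · rw [norm_smul, norm_pow, Real.norm_of_nonneg (ha0 j).le]
          calc _ ≤ 1 * ‖iteratedFDeriv ℝ i χ (a j • x)‖ := by
                gcongr; exact pow_le_one₀ (ha0 j).le (ha1 j)
            _ ≤ B i := by rw [one_mul]; exact hB i _
      rw [h1]
      calc _ ≤ ‖x‖ ^ k * ∑ i ∈ Finset.range (n + 1), (n.choose i : ℝ) *
            ‖iteratedFDeriv ℝ i η x‖ * ‖iteratedFDeriv ℝ (n - i) φ x‖ := by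
              gcongr
              exact norm_iteratedFDeriv_mul_le hη (φ.smooth ⊤) x (mod_cast le_top)
        _ ≤ (a j * ‖x‖) * (‖x‖ ^ k * ∑ i ∈ Finset.range (n + 1), (n.choose i : ℝ) *
            ‖iteratedFDeriv ℝ i η x‖ * ‖iteratedFDeriv ℝ (n - i) φ x‖) :=
              le_mul_of_one_le_left (by positivity) hx
        _ = a j * ∑ i ∈ Finset.range (n + 1), (n.choose i : ℝ) *
            ‖iteratedFDeriv ℝ i η x‖ * (‖x‖ ^ (k + 1) * ‖iteratedFDeriv ℝ (n - i) φ x‖) := by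
              rw [Finset.mul_sum, Finset.mul_sum, Finset.mul_sum]
              exact Finset.sum_congr rfl fun i _ => by ring
        _ ≤ a j * A := by
              refine mul_le_mul_of_nonneg_left (Finset.sum_le_sum fun i _ => ?_) (ha0 j).le
              gcongr
              · exact mul_nonneg (by positivity) (by linarith [hB0 i])
              · exact hηb i
              · exact le_seminorm ℂ (k + 1) (n - i) φ x
  have hlim : Tendsto (fun j => a j * A) atTop (𝓝 0) := by
    simpa only [zero_mul] using (tendsto_one_div_add_atTop_nhds_zero_nat (𝕜 := ℝ)).mul_const A
  filter_upwards [(tendsto_order.1 hlim).2 ε hε] with j hj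
  exact (key j).trans_lt hj

end SchwartzMap

end SchwartzComplete

/-! ### Distributional linear systems with a matrix symbol: representation by the exponential -/

section LinearSystem

open scoped ContDiff
open SchwartzMap

variable {E ι : Type*} [NormedAddCommGroup E] [NormedSpace ℝ E] [Fintype ι]

/-- The action of the transpose of a matrix of multipliers, iterated `n` times, on a vector of
Schwartz functions. -/
noncomputable def symbolIter (A : E → Matrix ι ι ℂ) (φ : ι → 𝓢(E, ℂ)) : ℕ → ι → 𝓢(E, ℂ)
  | 0 => φ
  | n + 1 => fun j => ∑ i, smulLeftCLM ℂ (fun x => A x i j) (symbolIter A φ n i)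

theorem symbolIter_apply [DecidableEq ι] {A : E → Matrix ι ι ℂ}
    (hA : ∀ i j, (fun x => A x i j).HasTemperateGrowth) (φ : ι → 𝓢(E, ℂ)) (n : ℕ) (j : ι) (x : E) :
    symbolIter A φ n j x = Matrix.vecMul (fun i => φ i x) (A x ^ n) j := by
  induction n generalizing j with
  | zero => simp [symbolIter]
  | succ n ih =>
    rw [pow_succ, ← Matrix.vecMul_vecMul]
    simp only [symbolIter, Matrix.vecMul, dotProduct] at ih ⊢
    rw [sum_apply]
    refine Finset.sum_congr rfl fun i _ => ?_
    rw [smulLeftCLM_apply_apply (hA i j), smul_eq_mul, ih, mul_comm]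

/-- The norms of the iterates of a matrix multiplier on compactly supported functions grow at most
geometrically. -/
theorem exists_orderSeminorm_symbolIter_le [DecidableEq ι] [FiniteDimensional ℝ E] {A : E → Matrix ι ι ℂ}
    (hA : ∀ i j, (fun x => A x i j).HasTemperateGrowth) (φ : ι → 𝓢(E, ℂ))
    (hφ : ∀ i, HasCompactSupport (φ i)) (N : ℕ) :
    ∃ D S, 0 ≤ D ∧ 0 ≤ S ∧ ∀ n, ∑ j, orderSeminorm N (symbolIter A φ n j) ≤ D ^ n * S := by
  obtain ⟨R, hR⟩ : ∃ R : ℝ, ∀ i x, φ i x ≠ 0 → ‖x‖ ≤ R := by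
    have : IsCompact (⋃ i, tsupport (φ i)) := isCompact_iUnion fun i => hφ i
    obtain ⟨R, hR⟩ := this.isBounded.exists_norm_le
    exact ⟨R, fun i x hx => hR x (Set.mem_iUnion.2 ⟨i, subset_tsupport _ hx⟩)⟩
  -- The bump is 1 on a ball containing all the supports. Multiplication never enlarges supports, so
  -- every iterate may use the compactly supported multiplier `χ * A`, whose derivatives are
  -- bounded, in place of `A`.
  let b : ContDiffBump (0 : E) := ⟨max R 0 + 1, max R 0 + 2, by positivity, by linarith⟩
  let χ : E → ℂ := fun x => (b x : ℂ)
  have hχs : ContDiff ℝ ∞ χ := Complex.ofRealCLM.contDiff.comp b.contDiff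
  have hχc : HasCompactSupport χ := b.hasCompactSupport.comp_left (g := ((↑) : ℝ → ℂ)) rfl
  have hχ1 : ∀ i x, φ i x ≠ 0 → χ x = 1 := by
    intro i x hx
    have : b x = 1 := b.one_of_mem_closedBall (by
      rw [mem_closedBall_zero_iff]
      have := hR i x hx
      change ‖x‖ ≤ max R 0 + 1
      linarith [le_max_left R 0])
    simp [χ, this]
  have hsm : ∀ i j, ContDiff ℝ ∞ (fun x => χ x * A x i j) := fun i j => hχs.mul (hA i j).1
  choose D hD0 hD using fun i j => exists_orderSeminorm_smulLeft_le (hsm i j)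
    (fun n => HasCompactSupport.exists_bound_iteratedFDeriv hχc.mul_right (hsm i j) n) N
  have hz : ∀ x, (∀ i, φ i x = 0) → ∀ n j, symbolIter A φ n j x = 0 := by
    intro x hx n j
    rw [symbolIter_apply hA]
    have : (fun i => φ i x) = 0 := funext hx
    rw [this, Matrix.zero_vecMul]; rfl
  have hmul : ∀ n i j x, smulLeftCLM ℂ (fun x => A x i j) (symbolIter A φ n i) x =
      (χ x * A x i j) * symbolIter A φ n i x := by
    intro n i j x
    rw [smulLeftCLM_apply_apply (hA i j), smul_eq_mul]
    by_cases h : ∀ i, φ i x = 0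
    · simp [hz x h]
    · push Not at h
      obtain ⟨i', hi'⟩ := h
      rw [hχ1 i' x hi', one_mul]
  refine ⟨∑ i, ∑ j, D i j, ∑ j, orderSeminorm N (φ j), Finset.sum_nonneg fun i _ =>
    Finset.sum_nonneg fun j _ => hD0 i j, Finset.sum_nonneg fun j _ => orderSeminorm_nonneg _ _,
    fun n => ?_⟩
  induction n with
  | zero => simp [symbolIter]
  | succ n ih =>
    have hDn : ∀ i, 0 ≤ ∑ j, D i j := fun i => Finset.sum_nonneg fun j _ => hD0 i j
    calc ∑ j, orderSeminorm N (symbolIter A φ (n + 1) j)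
        ≤ ∑ j, ∑ i, D i j * orderSeminorm N (symbolIter A φ n i) := by
          refine Finset.sum_le_sum fun j _ => (orderSeminorm_sum_le _ _ _).trans ?_
          exact Finset.sum_le_sum fun i _ => hD i j _ _ (hmul n i j)
      _ = ∑ i, (∑ j, D i j) * orderSeminorm N (symbolIter A φ n i) := by
          rw [Finset.sum_comm]; simp_rw [Finset.sum_mul]
      _ ≤ ∑ i, (∑ i, ∑ j, D i j) * orderSeminorm N (symbolIter A φ n i) := by
          refine Finset.sum_le_sum fun i hi => ?_
          refine mul_le_mul_of_nonneg_right ?_ (orderSeminorm_nonneg _ _)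
          exact Finset.single_le_sum (f := fun i => ∑ j, D i j) (fun i _ => hDn i) hi
      _ ≤ _ := by
          rw [← Finset.mul_sum, pow_succ', mul_assoc]
          exact mul_le_mul_of_nonneg_left ih (Finset.sum_nonneg fun i _ => hDn i)

variable {F : ℝ → ι → 𝓢(E, ℂ) →L[ℂ] ℂ} {A : E → Matrix ι ι ℂ}

/-- `F` solves `F' = A F` for positive times, with `F (0+) = F 0`, pointwise on test functions. -/
structure IsSymbolSolution (A : E → Matrix ι ι ℂ) (F : ℝ → ι → 𝓢(E, ℂ) →L[ℂ] ℂ) : Prop where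
  growth : ∀ i j, (fun x => A x i j).HasTemperateGrowth
  deriv : ∀ t, 0 < t → ∀ i φ, HasDerivAt (fun s => F s i φ)
    (∑ j, F t j (smulLeftCLM ℂ (fun x => A x i j) φ)) t
  tendsto : ∀ i φ, Tendsto (fun s => F s i φ) (𝓝[>] 0) (𝓝 (F 0 i φ))

namespace IsSymbolSolution

/-- By duality the symbol acts on the test functions through its transpose, so a time derivative of
the pairing only raises the iteration index. -/
theorem hasDerivAt_pairing (h : IsSymbolSolution A F) (φ : ι → 𝓢(E, ℂ)) (n : ℕ) {t : ℝ}
    (ht : 0 < t) :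
    HasDerivAt (fun s => ∑ i, F s i (symbolIter A φ n i))
      (∑ i, F t i (symbolIter A φ (n + 1) i)) t := by
  have := HasDerivAt.fun_sum (u := Finset.univ) fun i _ => h.deriv t ht i (symbolIter A φ n i)
  refine this.congr_deriv ?_
  rw [Finset.sum_comm]
  exact Finset.sum_congr rfl fun j _ => by simp [symbolIter]

/-- The sum is the Taylor polynomial of order `N` of the formal expression e^{(T-s)A} F(s), which
does not depend on `s`. Its derivative telescopes and only the last term survives. -/
theorem hasDerivAt_taylor (h : IsSymbolSolution A F) (φ : ι → 𝓢(E, ℂ)) (T : ℝ) (N : ℕ) {t : ℝ}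
    (ht : 0 < t) :
    HasDerivAt (fun s : ℝ => ∑ n ∈ Finset.range (N + 1),
        (((T - s) ^ n / n.factorial : ℝ) : ℂ) * ∑ i, F s i (symbolIter A φ n i))
      ((((T - t) ^ N / N.factorial : ℝ) : ℂ) * ∑ i, F t i (symbolIter A φ (N + 1) i)) t := by
  induction N with
  | zero => simpa using h.hasDerivAt_pairing φ 0 ht
  | succ N ih =>
    simp_rw [Finset.sum_range_succ _ (N + 1)]
    have h1 : HasDerivAt (fun s : ℝ => (T - s) ^ (N + 1) / (N + 1).factorial)
        (-((T - t) ^ N / N.factorial)) t := by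
      have := (((hasDerivAt_id t).const_sub T).pow (N + 1)).div_const ((N + 1).factorial : ℝ)
      refine this.congr_deriv ?_
      simp only [Nat.factorial_succ, id, Nat.add_sub_cancel]
      push_cast
      have : ((N : ℝ) + 1) ≠ 0 := by positivity
      have : (N.factorial : ℝ) ≠ 0 := by positivity
      field_simp
    have h2 := (h1.ofReal_comp).mul (h.hasDerivAt_pairing φ (N + 1) ht)
    have h3 := ih.add h2
    refine h3.congr_deriv ?_
    push_cast
    ring

theorem continuousOn (h : IsSymbolSolution A F) (i : ι) (φ : 𝓢(E, ℂ)) :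
    ContinuousOn (fun s => F s i φ) (Set.Ici 0) := by
  intro s hs
  rcases eq_or_lt_of_le (Set.mem_Ici.1 hs) with rfl | hs
  · exact continuousWithinAt_Ioi_iff_Ici.1 (h.tendsto i φ)
  · exact (h.deriv s hs i φ).continuousAt.continuousWithinAt

/-- This contains uniqueness: the value at time `T` is recovered from the initial value alone. The
Taylor remainder is at most a constant times (TD)^N/N!, because the iterates of the symbol grow like
D^n in a seminorm that bounds the solution uniformly on [0, T]. -/
theorem tendsto_taylor [DecidableEq ι] [FiniteDimensional ℝ E] (h : IsSymbolSolution A F) (φ : ι → 𝓢(E, ℂ))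
    (hφ : ∀ i, HasCompactSupport (φ i)) {T : ℝ} (hT : 0 ≤ T) :
    Tendsto (fun N => ∑ n ∈ Finset.range (N + 1),
        ((T ^ n / n.factorial : ℝ) : ℂ) * ∑ i, F 0 i (symbolIter A φ n i)) atTop
      (𝓝 (∑ i, F T i (φ i))) := by
  -- For a fixed test function the solution is continuous on the compact interval, hence bounded;
  -- uniform boundedness turns this into a bound by a single seminorm for all times.
  obtain ⟨M, C, hC0, hC⟩ := uniform_bound_of_pointwise
    (fun si : Set.Icc 0 T × ι => F si.1 si.2) (by
      intro ψ
      choose B hB using fun i => (isCompact_Icc (a := (0 : ℝ)) (b := T)).exists_bound_of_continuousOn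
        ((h.continuousOn i ψ).mono fun _ hx => hx.1)
      refine ⟨∑ i, |B i|, fun si => (hB si.2 si.1 si.1.2).trans ((le_abs_self _).trans ?_)⟩
      exact Finset.single_le_sum (f := fun i => |B i|) (fun i _ => abs_nonneg _)
        (Finset.mem_univ si.2))
  obtain ⟨D, S, hD0, hS0, hDS⟩ := exists_orderSeminorm_symbolIter_le h.growth φ hφ M
  have hpair : ∀ s ∈ Set.Icc 0 T, ∀ n, ‖∑ i, F s i (symbolIter A φ n i)‖ ≤ C * (D ^ n * S) := by
    intro s hs n
    calc _ ≤ ∑ i, C * orderSeminorm M (symbolIter A φ n i) :=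
          norm_sum_le_of_le _ fun i _ => hC (⟨s, hs⟩, i) _
      _ ≤ _ := by rw [← Finset.mul_sum]; exact mul_le_mul_of_nonneg_left (hDS n) hC0
  have hmain : ∀ N, ‖(∑ i, F T i (φ i)) - ∑ n ∈ Finset.range (N + 1),
      ((T ^ n / n.factorial : ℝ) : ℂ) * ∑ i, F 0 i (symbolIter A φ n i)‖ ≤
      (T * D) ^ N / N.factorial * (C * D * S * T) := by
    intro N
    rcases eq_or_lt_of_le hT with rfl | hT'
    · rw [Finset.sum_eq_single_of_mem (s := Finset.range (N + 1)) 0 (by simp)]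
      · simp [symbolIter]
      · intro n _ hn; simp [hn]
    let H : ℝ → ℂ := fun s => ∑ n ∈ Finset.range (N + 1),
        (((T - s) ^ n / n.factorial : ℝ) : ℂ) * ∑ i, F s i (symbolIter A φ n i)
    have hHT : H T = ∑ i, F T i (φ i) := by
      simp only [H]
      rw [Finset.sum_eq_single 0]
      · simp [symbolIter]
      · intro n _ hn; simp [hn]
      · simp
    have hH0 : Tendsto H (𝓝[>] 0) (𝓝 (H 0)) := by
      refine tendsto_finsetSum _ fun n _ => Tendsto.mul ?_ ?_
      · refine Tendsto.mono_left (Continuous.tendsto ?_ _) nhdsWithin_le_nhds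
        fun_prop
      · exact tendsto_finsetSum _ fun i _ => h.tendsto i _
    -- The equation holds only for positive times, so the mean value inequality is used on [e, T]
    -- and `e` then tends to 0.
    have hle : ∀ᶠ e in 𝓝[>] (0 : ℝ), ‖H T - H e‖ ≤
        (T * D) ^ N / N.factorial * (C * D * S * T) := by
      filter_upwards [Ioo_mem_nhdsGT hT'] with e he
      have := norm_image_sub_le_of_norm_deriv_le_segment' (f := H) (a := e) (b := T)
        (C := T ^ N / N.factorial * (C * (D ^ (N + 1) * S)))
        (f' := fun t => (((T - t) ^ N / N.factorial : ℝ) : ℂ) *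
          ∑ i, F t i (symbolIter A φ (N + 1) i))
        (fun t ht => (h.hasDerivAt_taylor φ T N (he.1.trans_le ht.1)).hasDerivWithinAt)
        (fun t ht => by
          rw [norm_mul, Complex.norm_real]
          have h0 : 0 ≤ T - t := by linarith [ht.2]
          rw [Real.norm_of_nonneg (by positivity)]
          refine mul_le_mul ?_ (hpair t ⟨he.1.le.trans ht.1, ht.2.le⟩ _) (norm_nonneg _)
            (by positivity)
          gcongr
          linarith [he.1, ht.1]) T ⟨he.2.le, le_rfl⟩
      refine this.trans ?_
      calc _ ≤ T ^ N / N.factorial * (C * (D ^ (N + 1) * S)) * T := by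
            gcongr; linarith [he.1]
        _ = _ := by rw [mul_pow, pow_succ]; ring
    have := le_of_tendsto ((tendsto_const_nhds.sub hH0).norm) hle
    rw [hHT] at this
    simpa [H] using this
  rw [tendsto_iff_norm_sub_tendsto_zero]
  have h0 : Tendsto (fun N : ℕ => (T * D) ^ N / N.factorial * (C * D * S * T)) atTop (𝓝 0) := by
    simpa only [zero_mul] using
      (FloorSemiring.tendsto_pow_div_factorial_atTop (T * D)).mul_const (C * D * S * T)
  refine squeeze_zero (fun _ => norm_nonneg _) (fun N => ?_) h0
  rw [norm_sub_rev]; exact hmain N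

attribute [local instance] Matrix.linftyOpNormedRing Matrix.linftyOpNormedAlgebra

/-- A solution whose initial value is given by locally integrable functions is given, at every
time, by the solution of the ordinary differential equation at each frequency. -/
theorem eq_integral_exp [DecidableEq ι] [FiniteDimensional ℝ E] [MeasurableSpace E] [BorelSpace E]
    {μ : Measure E} (h : IsSymbolSolution A F) (f : ι → E → ℂ)
    (hf : ∀ i, LocallyIntegrable (f i) μ) (h0 : ∀ i φ, F 0 i φ = ∫ x, φ x * f i x ∂μ)
    {T : ℝ} (hT : 0 ≤ T) (i : ι) (φ : 𝓢(E, ℂ)) (hφ : HasCompactSupport φ) :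
    F T i φ = ∫ x, φ x *
      (NormedSpace.exp (T • A x)).mulVec (fun j => f j x) i ∂μ := by
  let Φ : ι → 𝓢(E, ℂ) := Pi.single i φ
  have hΦ : ∀ j, HasCompactSupport (Φ j) := by
    intro j
    by_cases hj : j = i
    · subst hj; simpa [Φ] using hφ
    · simp only [Φ, Pi.single_eq_of_ne hj]; exact HasCompactSupport.zero
  have hΦx : ∀ x, (fun j => Φ j x) = Pi.single i (φ x) := by
    intro x; ext j
    by_cases hj : j = i
    · subst hj; simp [Φ]
    · simp [Φ, hj]
  have hit : ∀ n j x, symbolIter A Φ n j x = φ x * (A x ^ n) i j := by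
    intro n j x
    rw [symbolIter_apply h.growth, hΦx, Matrix.single_vecMul]; simp [Matrix.row]
  have hlim := h.tendsto_taylor Φ hΦ hT
  have hleft : ∑ j, F T j (Φ j) = F T i φ := by
    rw [Finset.sum_eq_single i]
    · simp [Φ]
    · intro j _ hj; simp [Φ, hj]
    · simp
  rw [hleft] at hlim
  have hAc : Continuous A := by
    refine continuous_matrix fun i j => ((h.growth i j).1.continuous)
  have hint : ∀ n, Integrable (fun x => φ x * ((A x ^ n).mulVec (fun j => f j x) i)) μ := by
    intro n
    have : (fun x => φ x * ((A x ^ n).mulVec (fun j => f j x) i)) =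
        fun x => ∑ j, (φ x * (A x ^ n) i j) • f j x := by
      ext x; simp [Matrix.mulVec, dotProduct, Finset.mul_sum, mul_assoc]
    rw [this]
    refine integrable_finsetSum _ fun j _ => ?_
    refine (hf j).integrable_smul_left_of_hasCompactSupport ?_ hφ.mul_right
    exact φ.continuous.mul ((hAc.pow n).matrix_elem i j)
  have hsum : ∀ n, ∑ j, F 0 j (symbolIter A Φ n j) =
      ∫ x, φ x * ((A x ^ n).mulVec (fun j => f j x) i) ∂μ := by
    intro n
    simp_rw [h0, hit]
    rw [← integral_finsetSum]
    · refine integral_congr_ae (ae_of_all _ fun x => ?_)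
      simp [Matrix.mulVec, dotProduct, Finset.mul_sum, mul_assoc]
    · intro j _
      refine (hf j).integrable_smul_left_of_hasCompactSupport
        (g := fun x => φ x * (A x ^ n) i j) ?_ hφ.mul_right
      exact φ.continuous.mul ((hAc.pow n).matrix_elem i j)
  have hpart : ∀ N, ∑ n ∈ Finset.range (N + 1),
      ((T ^ n / n.factorial : ℝ) : ℂ) * ∑ j, F 0 j (symbolIter A Φ n j) =
      ∫ x, ∑ n ∈ Finset.range (N + 1), ((T ^ n / n.factorial : ℝ) : ℂ) *
        (φ x * ((A x ^ n).mulVec (fun j => f j x) i)) ∂μ := by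
    intro N
    rw [integral_finsetSum _ fun n _ => (hint n).const_mul _]
    exact Finset.sum_congr rfl fun n _ => by rw [hsum, integral_const_mul]
  simp_rw [hpart] at hlim
  refine tendsto_nhds_unique hlim ?_
  -- The exponential series at each frequency is dominated by e^{T‖A(x)‖}, which is locally bounded;
  -- the compact support of `φ` and local integrability of the data make the majorant integrable.
  refine tendsto_integral_of_dominated_convergence
    (fun x => ∑ j, ‖(φ x * (Real.exp (T * ‖A x‖) : ℂ)) • f j x‖) (fun N => ?_) ?_ (fun N => ?_) ?_
  · exact (integrable_finsetSum _ fun n _ => (hint n).const_mul _).aestronglyMeasurable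
  · refine integrable_finsetSum _ fun j _ => Integrable.norm ?_
    refine (hf j).integrable_smul_left_of_hasCompactSupport ?_ hφ.mul_right
    exact φ.continuous.mul (Complex.continuous_ofReal.comp
      (Real.continuous_exp.comp (continuous_const.mul hAc.norm)))
  · refine ae_of_all _ fun x => ?_
    have hv : ‖fun j => f j x‖ ≤ ∑ j, ‖f j x‖ :=
      (pi_norm_le_iff_of_nonneg (Finset.sum_nonneg fun _ _ => norm_nonneg _)).2 fun j =>
        Finset.single_le_sum (f := fun j => ‖f j x‖) (fun _ _ => norm_nonneg _) (Finset.mem_univ j)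
    have hpw : ∀ n, ‖(A x ^ n).mulVec (fun j => f j x) i‖ ≤ ‖A x‖ ^ n * ∑ j, ‖f j x‖ := by
      intro n
      refine (norm_le_pi_norm _ i).trans ((Matrix.linfty_opNorm_mulVec _ _).trans ?_)
      gcongr
      rcases n with _ | n
      · rw [pow_zero, pow_zero, Matrix.linfty_opNorm_def]
        norm_cast
        refine Finset.sup_le fun a _ => ?_
        rw [Finset.sum_eq_single a]
        · simp
        · intro b _ hb; simp [Matrix.one_apply_ne hb.symm]
        · simp
      · exact norm_pow_le' _ n.succ_pos
    calc _ ≤ ∑ n ∈ Finset.range (N + 1), T ^ n / n.factorial *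
          (‖φ x‖ * (‖A x‖ ^ n * ∑ j, ‖f j x‖)) := by
          refine norm_sum_le_of_le _ fun n _ => ?_
          rw [norm_mul, norm_mul, Complex.norm_real, Real.norm_of_nonneg (by positivity)]
          gcongr
          exact hpw n
      _ = (∑ n ∈ Finset.range (N + 1), (T * ‖A x‖) ^ n / n.factorial) *
          (‖φ x‖ * ∑ j, ‖f j x‖) := by
          rw [Finset.sum_mul]; exact Finset.sum_congr rfl fun n _ => by rw [mul_pow]; ring
      _ ≤ Real.exp (T * ‖A x‖) * (‖φ x‖ * ∑ j, ‖f j x‖) := by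
          gcongr
          exact Real.sum_le_exp_of_nonneg (by positivity) _
      _ = _ := by
          simp_rw [norm_smul, norm_mul, Complex.norm_real, Real.norm_eq_abs, Real.abs_exp]
          rw [← Finset.mul_sum]; ring
  · refine ae_of_all _ fun x => ?_
    have h1 := (NormedSpace.exp_series_hasSum_exp' (𝕂 := ℝ) (T • A x)).tendsto_sum_nat
    have h2 := h1.comp (tendsto_add_atTop_nat 1)
    have hc : Continuous fun M : Matrix ι ι ℂ => φ x * M.mulVec (fun j => f j x) i := by
      have : Continuous fun M : Matrix ι ι ℂ => M.mulVec (fun j => f j x) :=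
        continuous_id.matrix_mulVec continuous_const
      exact continuous_const.mul ((continuous_apply i).comp this)
    have h3 := (hc.tendsto _).comp h2
    refine h3.congr fun N => ?_
    simp only [Function.comp, Matrix.sum_mulVec, Finset.sum_apply, Finset.mul_sum]
    refine Finset.sum_congr rfl fun n _ => ?_
    rw [smul_pow, smul_smul, Matrix.smul_mulVec, Pi.smul_apply, Complex.real_smul]
    push_cast
    ring

theorem continuous_exp_smul [DecidableEq ι] {A : E → Matrix ι ι ℂ}
    (hA : ∀ i j, (fun x => A x i j).HasTemperateGrowth) (T : ℝ) :
    Continuous fun x => NormedSpace.exp (T • A x) :=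
  (NormedSpace.exp_continuous (𝔸 := Matrix ι ι ℂ)).comp
    ((continuous_matrix fun i j => (hA i j).1.continuous).const_smul T)

end IsSymbolSolution

attribute [local instance] Matrix.linftyOpNormedRing Matrix.linftyOpNormedAlgebra in
theorem hasDerivAt_exp_smul_mulVec [DecidableEq ι] (A : Matrix ι ι ℂ) (v : ι → ℂ) (t : ℝ) (i : ι) :
    HasDerivAt (fun s : ℝ => (NormedSpace.exp (s • A)).mulVec v i)
      (A.mulVec ((NormedSpace.exp (t • A)).mulVec v) i) t := by
  have h := hasDerivAt_exp_smul_const' (𝕂 := ℝ) A t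
  let L : Matrix ι ι ℂ →ₗ[ℝ] ℂ :=
    { toFun := fun M => M.mulVec v i
      map_add' := fun M N => by simp [Matrix.add_mulVec]
      map_smul' := fun c M => by simp [Matrix.smul_mulVec] }
  have hL : HasFDerivAt (fun M : Matrix ι ι ℂ => M.mulVec v i)
      (LinearMap.toContinuousLinearMap L) (NormedSpace.exp (t • A)) :=
    (LinearMap.toContinuousLinearMap L).hasFDerivAt
  have := hL.comp_hasDerivAt t h
  refine this.congr_deriv ?_
  rw [Matrix.mulVec_mulVec]
  rfl

end LinearSystem

/-! ### Hausdorff-Young inequality by real interpolation -/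

section HausdorffYoung

open scoped FourierTransform ContDiff NNReal
open Set

/-- Marcinkiewicz interpolation between weak types `(1, ∞)` and `(2, 2)`, for the level
`λ(s) = (s / 2) ^ (-1 / (P - 1))`. -/
theorem lintegral_rpow_le_of_measure_lt_le {α β : Type*} [MeasurableSpace α] [MeasurableSpace β]
    {μ : Measure α} {ν : Measure β} [SFinite μ] {P Q : ℝ} (hPQ : P.HolderConjugate Q) (hP : P < 2)
    {F : α → ℝ} (hF : Measurable F) (hF0 : ∀ a, 0 ≤ F a) {G : β → ℝ} (hG : AEMeasurable G ν)
    (hG0 : ∀ b, 0 ≤ G b)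
    (h : ∀ s : ℝ, 0 < s → ν {b | s < G b} ≤ ENNReal.ofReal (4 / s ^ 2) *
      ∫⁻ a in {a | F a ≤ (s / 2) ^ (-(1 / (P - 1)))}, ENNReal.ofReal (F a ^ 2) ∂μ) :
    ∫⁻ b, ENNReal.ofReal (G b ^ Q) ∂ν ≤
      ENNReal.ofReal (Q * (4 * 2 ^ (Q - 2) / (Q - 2))) * ∫⁻ a, ENNReal.ofReal (F a ^ P) ∂μ := by
  have hP1 : 0 < P - 1 := hPQ.sub_one_pos
  have hQ0 : 0 < Q := hPQ.symm.pos
  have hmul : (P - 1) * Q = P := hPQ.sub_one_mul_conj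
  -- This strict inequality makes s^{Q-3} integrable at 0; the endpoint exponent 2 is handled
  -- separately by Plancherel.
  have hQ2 : 0 < Q - 2 := by nlinarith
  let lev : ℝ → ℝ := fun s => (s / 2) ^ (-(1 / (P - 1)))
  have hlev : Measurable lev := (measurable_id.div_const 2).pow_const _
  have hset : MeasurableSet {z : ℝ × α | F z.2 ≤ lev z.1} :=
    measurableSet_le (hF.comp measurable_snd) (hlev.comp measurable_fst)
  let K : ℝ → α → ℝ≥0∞ := fun s a =>
    {z : ℝ × α | F z.2 ≤ lev z.1}.indicator
      (fun z => ENNReal.ofReal (4 * z.1 ^ (Q - 3) * F z.2 ^ 2)) (s, a)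
  have hK : Measurable (Function.uncurry K) := by
    refine Measurable.indicator ?_ hset
    exact ((((measurable_fst.pow_const _).const_mul 4)).mul
      ((hF.comp measurable_snd).pow_const 2)).ennreal_ofReal
  rw [lintegral_rpow_eq_lintegral_meas_lt_mul ν (ae_of_all _ hG0) hG hQ0,
    ENNReal.ofReal_mul hQ0.le, mul_assoc]
  gcongr
  calc _ ≤ ∫⁻ s in Ioi (0 : ℝ), ∫⁻ a, K s a ∂μ := by
        refine setLIntegral_mono' measurableSet_Ioi fun s hs => ?_
        have hs : 0 < s := hs
        calc _ ≤ (ENNReal.ofReal (4 / s ^ 2) * ∫⁻ a in {a | F a ≤ lev s},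
                ENNReal.ofReal (F a ^ 2) ∂μ) * ENNReal.ofReal (s ^ (Q - 1)) := by
              gcongr; exact h s hs
          _ = ENNReal.ofReal (4 * s ^ (Q - 3)) * ∫⁻ a in {a | F a ≤ lev s},
                ENNReal.ofReal (F a ^ 2) ∂μ := by
              rw [mul_right_comm, ← ENNReal.ofReal_mul (by positivity)]
              congr 2
              rw [show Q - 1 = (Q - 3) + (2 : ℕ) by push_cast; ring, Real.rpow_add_natCast hs.ne']
              field_simp
          _ = ∫⁻ a, K s a ∂μ := by
              rw [← lintegral_const_mul' _ _ ENNReal.ofReal_ne_top,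
                ← lintegral_indicator (measurableSet_le hF measurable_const)]
              refine lintegral_congr fun a => ?_
              simp only [K, indicator, Set.mem_ofPred_eq]
              split_ifs
              · rw [← ENNReal.ofReal_mul (by positivity)]
              · rfl
    _ = ∫⁻ a, (∫⁻ s in Ioi (0 : ℝ), K s a) ∂μ := lintegral_lintegral_swap hK.aemeasurable
    _ ≤ ∫⁻ a, ENNReal.ofReal (4 * 2 ^ (Q - 2) / (Q - 2)) * ENNReal.ofReal (F a ^ P) ∂μ := by
        refine lintegral_mono fun a => ?_
        rcases (hF0 a).eq_or_lt with h0 | h0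
        · have : ∀ s, K s a = 0 := by
            intro s
            simp only [K, indicator, ← h0]
            split_ifs <;> simp
          simp [this]
        -- `F a ≤ lev s` forces `s ≤ b`, the level function being decreasing. The inner integral
        -- then gives a multiple of F² b^{Q-2}, which is a multiple of F^P because (P-1)Q = P.
        · let b : ℝ := 2 * F a ^ (-(P - 1))
          have hb : 0 < b := by positivity
          have hsub : ∀ s ∈ Ioi (0 : ℝ), K s a ≤ (Ioc 0 b).indicator
              (fun s => ENNReal.ofReal (4 * F a ^ 2 * s ^ (Q - 3))) s := by
            intro s hs
            have hs : 0 < s := hs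
            by_cases hc : F a ≤ lev s
            · have hsb : s ≤ b := by
                have h1 : F a ^ (P - 1) ≤ (lev s) ^ (P - 1) :=
                  Real.rpow_le_rpow h0.le hc hP1.le
                have h2 : (lev s) ^ (P - 1) = (s / 2)⁻¹ := by
                  simp only [lev]
                  rw [← Real.rpow_mul (by positivity), neg_mul, one_div_mul_cancel hP1.ne',
                    Real.rpow_neg_one]
                rw [h2] at h1
                have h3 : s / 2 ≤ (F a ^ (P - 1))⁻¹ := by
                  rw [le_inv_comm₀ (by positivity) (by positivity)]; exact h1
                simp only [b]
                rw [Real.rpow_neg h0.le]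
                linarith
              rw [indicator_of_mem (show s ∈ Ioc 0 b from ⟨hs, hsb⟩)]
              simp only [K, indicator, Set.mem_ofPred_eq, hc, if_true]
              apply le_of_eq; congr 1; ring
            · simp [K, indicator, hc]
          calc _ ≤ ∫⁻ s in Ioi (0 : ℝ), (Ioc 0 b).indicator
                (fun s => ENNReal.ofReal (4 * F a ^ 2 * s ^ (Q - 3))) s :=
                  setLIntegral_mono' measurableSet_Ioi hsub
            _ ≤ ∫⁻ s, (Ioc 0 b).indicator
                (fun s => ENNReal.ofReal (4 * F a ^ 2 * s ^ (Q - 3))) s :=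
                  setLIntegral_le_lintegral _ _
            _ = ∫⁻ s in Ioc 0 b, ENNReal.ofReal (4 * F a ^ 2 * s ^ (Q - 3)) :=
                  lintegral_indicator measurableSet_Ioc _
            _ = ENNReal.ofReal (∫ s in Ioc 0 b, 4 * F a ^ 2 * s ^ (Q - 3)) := by
                  rw [ofReal_integral_eq_lintegral_ofReal]
                  · exact ((intervalIntegrable_iff_integrableOn_Ioc_of_le hb.le).1
                      (intervalIntegral.intervalIntegrable_rpow' (by linarith))).const_mul _
                  · filter_upwards [ae_restrict_mem measurableSet_Ioc] with s hs
                    have := hs.1.le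
                    positivity
            _ = _ := by
                  rw [← intervalIntegral.integral_of_le hb.le, intervalIntegral.integral_const_mul,
                    integral_rpow (Or.inl (by linarith)), Real.zero_rpow (by linarith),
                    ← ENNReal.ofReal_mul (by positivity)]
                  congr 1
                  rw [show Q - 3 + 1 = Q - 2 by ring, Real.mul_rpow (by norm_num) (by positivity),
                    ← Real.rpow_mul h0.le, show P = (2 : ℕ) + -(P - 1) * (Q - 2) by
                      push_cast; linarith,
                    Real.rpow_add h0, Real.rpow_natCast]
                  rw [show -((2 : ℕ) + -(P - 1) * (Q - 2) - 1) * (Q - 2) = -(P - 1) * (Q - 2) by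
                    have : (2 : ℝ) + -(P - 1) * (Q - 2) = P := by linarith
                    push_cast; rw [this]]
                  ring
    _ = _ := lintegral_const_mul' _ _ ENNReal.ofReal_ne_top

variable {V : Type*} [NormedAddCommGroup V] [InnerProductSpace ℝ V] [FiniteDimensional ℝ V]
  [MeasurableSpace V] [BorelSpace V]

/-- `g` is the Fourier transform of `f` in the sense of tempered distributions. -/
def IsFourierOf (f g : V → ℂ) : Prop :=
  ∀ φ : 𝓢(V, ℂ), ∫ x, 𝓕 φ x * f x = ∫ x, φ x * g x

theorem ae_eq_of_integral_hasCompactSupport {f g : V → ℂ} (hf : LocallyIntegrable f)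
    (hg : LocallyIntegrable g)
    (h : ∀ φ : 𝓢(V, ℂ), HasCompactSupport φ → ∫ x, φ x * f x = ∫ x, φ x * g x) : f =ᵐ[volume] g := by
  refine ae_eq_of_integral_contDiff_smul_eq hf hg fun φ hφ hc => ?_
  have hc' : HasCompactSupport (Complex.ofRealCLM ∘ φ) := hc.comp_left rfl
  have hφ' : ContDiff ℝ ∞ (Complex.ofRealCLM ∘ φ) := by fun_prop
  simpa using h (hc'.toSchwartzMap hφ') hc'

theorem ae_eq_of_integral_schwartz {f g : V → ℂ} (hf : LocallyIntegrable f)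
    (hg : LocallyIntegrable g) (h : ∀ φ : 𝓢(V, ℂ), ∫ x, φ x * f x = ∫ x, φ x * g x) :
    f =ᵐ[volume] g :=
  ae_eq_of_integral_hasCompactSupport hf hg fun φ _ => h φ

theorem SchwartzMap.integrable_mul_of_memLp {f : V → ℂ} {p : ℝ≥0∞} (hp : 1 ≤ p) (hf : MemLp f p)
    (φ : 𝓢(V, ℂ)) : Integrable (fun x => φ x * f x) := by
  have := ENNReal.HolderConjugate.inv_one_sub_inv' hp
  exact (φ.memLp (1 - p⁻¹)⁻¹).integrable_mul (p := (1 - p⁻¹)⁻¹) (q := p) hf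

theorem exists_isFourierOf_one {f : V → ℂ} (hf : Integrable f) :
    ∃ g : V → ℂ, Continuous g ∧ (∀ x, ‖g x‖ ≤ ∫ y, ‖f y‖) ∧ IsFourierOf f g := by
  refine ⟨𝓕 f, ?_, fun x => ?_, fun φ => ?_⟩
  · exact VectorFourier.fourierIntegral_continuous Real.continuous_fourierChar
      (by exact continuous_inner) hf
  · exact VectorFourier.norm_fourierIntegral_le_integral_norm _ _ _ _ _
  · have := VectorFourier.integral_fourierIntegral_smul_eq_flip (L := innerₗ V) (μ := volume)
      (ν := volume) (f := (φ : V → ℂ)) (g := f) Real.continuous_fourierChar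
      (by exact continuous_inner) φ.integrable hf
    simp only [smul_eq_mul, flip_innerₗ] at this
    exact this

theorem exists_isFourierOf_two {f : V → ℂ} (hf : MemLp f 2) :
    ∃ g : V → ℂ, MemLp g 2 ∧ eLpNorm g 2 = eLpNorm f 2 ∧ IsFourierOf f g := by
  let F : Lp (α := V) ℂ 2 := hf.toLp f
  let G : Lp (α := V) ℂ 2 := 𝓕 F
  refine ⟨G, Lp.memLp G, ?_, fun φ => ?_⟩
  · have h1 : ‖G‖ = ‖F‖ := Lp.norm_fourier_eq F
    rw [Lp.norm_def, Lp.norm_def, ENNReal.toReal_eq_toReal_iff' (Lp.eLpNorm_ne_top _)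
      (Lp.eLpNorm_ne_top _)] at h1
    rw [h1]
    exact eLpNorm_congr_ae hf.coeFn_toLp
  · have h1 := DFunLike.congr_fun (Lp.fourier_toTemperedDistribution_eq F) φ
    rw [TemperedDistribution.fourier_apply, Lp.toTemperedDistribution_apply,
      Lp.toTemperedDistribution_apply] at h1
    rw [← (show ∫ x, φ x • G x = ∫ x, φ x * G x from rfl), ← h1]
    refine integral_congr_ae ?_
    filter_upwards [hf.coeFn_toLp] with x hx
    rw [smul_eq_mul, hx]

theorem lintegral_ofReal_norm_sq_eq {f : V → ℂ} :
    ∫⁻ x, ENNReal.ofReal (‖f x‖ ^ 2) = eLpNorm f 2 volume ^ (2 : ℝ) := by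
  have := eLpNorm_nnreal_pow_eq_lintegral (f := f) (μ := (volume : Measure V)) (p := 2) two_ne_zero
  simp only [NNReal.coe_ofNat, ENNReal.coe_ofNat] at this
  rw [this]
  refine lintegral_congr fun x => ?_
  rw [ENNReal.ofReal_pow (norm_nonneg _), ofReal_norm]
  norm_cast

/-- Truncating an `L^P` function at height `c` splits it into an integrable and a
square-integrable part, and hence gives a splitting of its Fourier transform. -/
theorem exists_isFourierOf_add {P : ℝ} (hP1 : 1 < P) (hP2 : P < 2) {f : V → ℂ}
    (hf : StronglyMeasurable f) (hfP : ∫⁻ x, ENNReal.ofReal (‖f x‖ ^ P) ≤ 1) {c : ℝ} (hc : 0 < c) :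
    ∃ g₁ g₂ : V → ℂ, Continuous g₁ ∧ (∀ x, ‖g₁ x‖ ≤ c ^ (1 - P)) ∧ MemLp g₂ 2 ∧
      eLpNorm g₂ 2 volume ^ (2 : ℝ) = ∫⁻ x in {x | ‖f x‖ ≤ c}, ENNReal.ofReal (‖f x‖ ^ 2) ∧
      IsFourierOf f (g₁ + g₂) := by
  have hm : MeasurableSet {x | ‖f x‖ ≤ c} := measurableSet_le hf.norm.measurable measurable_const
  let f₂ : V → ℂ := {x | ‖f x‖ ≤ c}.indicator f
  let f₁ : V → ℂ := {x | ‖f x‖ ≤ c}ᶜ.indicator f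
  have hsum : f₂ + f₁ = f := indicator_self_add_compl _ _
  have hm₁ : StronglyMeasurable f₁ := hf.indicator hm.compl
  have hm₂ : StronglyMeasurable f₂ := hf.indicator hm
  have h₁ : ∫⁻ x, ‖f₁ x‖ₑ ≤ ENNReal.ofReal (c ^ (1 - P)) := by
    calc _ ≤ ∫⁻ x, ENNReal.ofReal (c ^ (1 - P)) * ENNReal.ofReal (‖f x‖ ^ P) := by
          refine lintegral_mono fun x => ?_
          by_cases hx : ‖f x‖ ≤ c
          · simp [f₁, hx]
          · have hmem : x ∈ {x | ‖f x‖ ≤ c}ᶜ := hx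
            simp only [f₁, indicator_of_mem hmem]
            rw [← ofReal_norm, ← ENNReal.ofReal_mul (by positivity)]
            refine ENNReal.ofReal_le_ofReal ?_
            push Not at hx
            have hpos : 0 < ‖f x‖ := hc.trans hx
            calc ‖f x‖ = ‖f x‖ ^ (1 - P) * ‖f x‖ ^ P := by
                  rw [← Real.rpow_add hpos]; simp
              _ ≤ _ := by
                  gcongr ?_ * _
                  exact Real.rpow_le_rpow_of_nonpos hc hx.le (by linarith)
      _ = ENNReal.ofReal (c ^ (1 - P)) * ∫⁻ x, ENNReal.ofReal (‖f x‖ ^ P) :=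
          lintegral_const_mul' _ _ ENNReal.ofReal_ne_top
      _ ≤ _ := mul_le_of_le_one_right' hfP
  have hi₁ : Integrable f₁ := ⟨hm₁.aestronglyMeasurable, h₁.trans_lt ENNReal.ofReal_lt_top⟩
  have h₂eq : ∫⁻ x, ENNReal.ofReal (‖f₂ x‖ ^ 2) =
      ∫⁻ x in {x | ‖f x‖ ≤ c}, ENNReal.ofReal (‖f x‖ ^ 2) := by
    rw [← lintegral_indicator hm]
    refine lintegral_congr fun x => ?_
    by_cases hx : ‖f x‖ ≤ c <;> simp [f₂, indicator, hx]
  have h₂ : ∫⁻ x, ENNReal.ofReal (‖f₂ x‖ ^ 2) < ⊤ := by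
    calc _ ≤ ∫⁻ x, ENNReal.ofReal (c ^ (2 - P)) * ENNReal.ofReal (‖f x‖ ^ P) := by
          refine lintegral_mono fun x => ?_
          by_cases hx : ‖f x‖ ≤ c
          · have hmem : x ∈ {x | ‖f x‖ ≤ c} := hx
            simp only [f₂, indicator_of_mem hmem]
            rw [← ENNReal.ofReal_mul (by positivity)]
            refine ENNReal.ofReal_le_ofReal ?_
            rcases (norm_nonneg (f x)).eq_or_lt with h0 | h0
            · rw [← h0]; simp; positivity
            calc ‖f x‖ ^ 2 = ‖f x‖ ^ (2 - P) * ‖f x‖ ^ P := by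
                  rw [← Real.rpow_add h0]; simp
              _ ≤ _ := by
                  gcongr ?_ * _
                  exact Real.rpow_le_rpow h0.le hx (by linarith)
          · simp [f₂, hx]
      _ = ENNReal.ofReal (c ^ (2 - P)) * ∫⁻ x, ENNReal.ofReal (‖f x‖ ^ P) :=
          lintegral_const_mul' _ _ ENNReal.ofReal_ne_top
      _ < ⊤ := ENNReal.mul_lt_top ENNReal.ofReal_lt_top (hfP.trans_lt ENNReal.one_lt_top)
  have hi₂ : MemLp f₂ 2 := by
    refine ⟨hm₂.aestronglyMeasurable, ?_⟩
    rw [lintegral_ofReal_norm_sq_eq] at h₂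
    by_contra hcon
    rw [not_lt_top_iff] at hcon
    rw [hcon] at h₂
    simp at h₂
  obtain ⟨g₁, hg₁c, hg₁, hF₁⟩ := exists_isFourierOf_one hi₁
  obtain ⟨g₂, hg₂, hg₂e, hF₂⟩ := exists_isFourierOf_two hi₂
  refine ⟨g₁, g₂, hg₁c, fun x => (hg₁ x).trans ?_, hg₂, ?_, fun φ => ?_⟩
  · rw [integral_norm_eq_lintegral_enorm hm₁.aestronglyMeasurable]
    exact ENNReal.toReal_le_of_le_ofReal (by positivity) h₁
  · rw [hg₂e, ← lintegral_ofReal_norm_sq_eq, h₂eq]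
  · have hb₁ : MemLp g₁ ⊤ := memLp_top_of_bound hg₁c.aestronglyMeasurable _ (ae_of_all _ hg₁)
    have e₁ : ∫ x, 𝓕 φ x * f x = ∫ x, 𝓕 φ x * f₂ x + 𝓕 φ x * f₁ x := by
      refine integral_congr_ae (ae_of_all _ fun x => ?_)
      simp only [← mul_add]
      rw [← Pi.add_apply, hsum]
    rw [e₁, integral_add ((𝓕 φ).integrable_mul_of_memLp one_le_two hi₂)
      ((𝓕 φ).integrable_mul_of_memLp le_rfl (memLp_one_iff_integrable.2 hi₁)), hF₁ φ, hF₂ φ,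
      add_comm, ← integral_add (φ.integrable_mul_of_memLp le_top hb₁)
        (φ.integrable_mul_of_memLp one_le_two hg₂)]
    simp [mul_add]

/-- For each height `s` the function is truncated at a height depending on `s` such that the
transform of its large part is bounded by s/2. Where the transform exceeds `s`, the
square-integrable part then contributes at least s/2, and Chebyshev with Plancherel gives the
hypothesis of the interpolation lemma. -/
theorem exists_isFourierOf_of_lintegral_le_one {P Q : ℝ} (hPQ : P.HolderConjugate Q) (hP : P < 2)
    {f : V → ℂ} (hf : StronglyMeasurable f) (hfP : ∫⁻ x, ENNReal.ofReal (‖f x‖ ^ P) ≤ 1) :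
    ∃ g : V → ℂ, AEStronglyMeasurable g volume ∧ ∫⁻ x, ENNReal.ofReal (‖g x‖ ^ Q) ≤
      ENNReal.ofReal (Q * (4 * 2 ^ (Q - 2) / (Q - 2))) ∧ IsFourierOf f g := by
  have hP1 : 0 < P - 1 := hPQ.sub_one_pos
  have hsplit := fun c : ℝ => fun hc : 0 < c =>
    exists_isFourierOf_add (by linarith : 1 < P) hP hf hfP hc
  -- Truncation at height 1 only serves to name the transform; every other truncation yields the
  -- same function almost everywhere.
  obtain ⟨a, b, ha, hab, hb, -, hF⟩ := hsplit 1 one_pos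
  have hloc : ∀ (u v : V → ℂ) (M : ℝ), Continuous u → MemLp v 2 → LocallyIntegrable (u + v) :=
    fun u v M hu hv => hu.locallyIntegrable.add (hv.locallyIntegrable one_le_two)
  refine ⟨a + b, ha.aestronglyMeasurable.add hb.1, ?_, hF⟩
  have hmain := lintegral_rpow_le_of_measure_lt_le (μ := (volume : Measure V))
    (ν := (volume : Measure V)) hPQ hP (F := fun x => ‖f x‖) hf.norm.measurable
    (fun _ => norm_nonneg _) (G := fun x => ‖(a + b) x‖)
    (ha.aestronglyMeasurable.add hb.1).norm.aemeasurable (fun _ => norm_nonneg _) ?_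
  · exact hmain.trans (mul_le_of_le_one_right' hfP)
  intro s hs
  set c : ℝ := (s / 2) ^ (-(1 / (P - 1))) with hc
  have hc0 : 0 < c := by positivity
  obtain ⟨u, v, hu, huc, hv, hve, hFuv⟩ := hsplit c hc0
  have hcs : c ^ (1 - P) = s / 2 := by
    rw [hc, ← Real.rpow_mul (by positivity)]
    have : -(1 / (P - 1)) * (1 - P) = 1 := by field_simp; ring
    rw [this, Real.rpow_one]
  have hae : a + b =ᵐ[volume] u + v := ae_eq_of_integral_schwartz (hloc a b 0 ha hb)
    (hloc u v 0 hu hv) fun φ => by rw [← hF φ, hFuv φ]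
  calc volume {x | s < ‖(a + b) x‖} ≤ volume {x | ENNReal.ofReal (s / 2) ≤ ‖v x‖ₑ} := by
        refine measure_mono_ae ?_
        filter_upwards [hae] with x hx hxs
        have hxs : s < ‖(a + b) x‖ := hxs
        rw [hx] at hxs
        change ENNReal.ofReal (s / 2) ≤ ‖v x‖ₑ
        rw [← ofReal_norm]
        refine ENNReal.ofReal_le_ofReal ?_
        have h1 := norm_add_le (u x) (v x)
        have h2 := huc x
        rw [hcs] at h2
        rw [Pi.add_apply] at hxs
        linarith
    _ ≤ (ENNReal.ofReal (s / 2))⁻¹ ^ (2 : ℝ≥0∞).toReal * eLpNorm v 2 volume ^ (2 : ℝ≥0∞).toReal :=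
        meas_ge_le_mul_pow_eLpNorm_enorm _ two_ne_zero ENNReal.ofNat_ne_top hv.1
          (by simpa using hs) (fun h => absurd h ENNReal.ofReal_ne_top)
    _ = _ := by
        rw [ENNReal.toReal_ofNat, hve]
        congr 1
        rw [← ENNReal.ofReal_inv_of_pos (by positivity),
          ENNReal.ofReal_rpow_of_pos (by positivity)]
        congr 1
        norm_cast
        field_simp
        norm_num

/-- The Hausdorff-Young inequality, up to a constant. -/
theorem hausdorff_young {p p' : ℝ≥0∞} [hpp : ENNReal.HolderConjugate p p'] (hp : p ≤ 2) :
    ∃ C : ℝ≥0, ∀ f : V → ℂ, MemLp f p → ∃ g : V → ℂ, MemLp g p' ∧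
      eLpNorm g p' volume ≤ C * eLpNorm f p volume ∧ IsFourierOf f g := by
  have hp1 : 1 ≤ p := ENNReal.HolderConjugate.one_le p p'
  rcases hp1.eq_or_lt with rfl | hp1'
  · have hp' : p' = ⊤ := by
      have := hpp.inv_add_inv_eq_inv
      simpa using this
    subst hp'
    refine ⟨1, fun f hf => ?_⟩
    obtain ⟨g, hgc, hgb, hF⟩ := exists_isFourierOf_one (memLp_one_iff_integrable.1 hf)
    refine ⟨g, memLp_top_of_bound hgc.aestronglyMeasurable _ (ae_of_all _ hgb), ?_, hF⟩
    rw [ENNReal.coe_one, one_mul, eLpNorm_exponent_top, eLpNorm_one_eq_lintegral_enorm]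
    refine (eLpNormEssSup_le_of_ae_bound (ae_of_all _ hgb)).trans ?_
    rw [ofReal_integral_norm_eq_lintegral_enorm (memLp_one_iff_integrable.1 hf)]
  rcases hp.eq_or_lt with rfl | hp2
  · have hp' : p' = 2 := by
      have := hpp.inv_add_inv_eq_inv
      rw [inv_one, ENNReal.inv_two_add_inv_two.symm] at this
      have h2 := (ENNReal.add_right_inj (by simp)).1 this
      exact inv_injective h2
    subst hp'
    refine ⟨1, fun f hf => ?_⟩
    obtain ⟨g, hg, hge, hF⟩ := exists_isFourierOf_two hf
    exact ⟨g, hg, by rw [ENNReal.coe_one, one_mul, hge], hF⟩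
  have hpt : p ≠ ⊤ := hp2.ne_top
  have hP1 : 1 < p.toReal := by
    rw [← ENNReal.toReal_one]; exact (ENNReal.toReal_lt_toReal ENNReal.one_ne_top hpt).2 hp1'
  have hP2 : p.toReal < 2 := by
    rw [← ENNReal.toReal_ofNat 2]; exact (ENNReal.toReal_lt_toReal hpt ENNReal.ofNat_ne_top).2 hp2
  have hPQ : p.toReal.HolderConjugate p'.toReal := ENNReal.HolderConjugate.toReal hP1
  set P := p.toReal
  set Q := p'.toReal
  have hQ0 : 0 < Q := hPQ.symm.pos
  have hp0 : p ≠ 0 := (zero_lt_one.trans hp1').ne'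
  have hp'0 : p' ≠ 0 := fun h => by simp [Q, h] at hQ0
  have hp't : p' ≠ ⊤ := fun h => by simp [Q, h] at hQ0
  have hnorm : ∀ (r : ℝ≥0∞) (u : V → ℂ), r ≠ 0 → r ≠ ⊤ → eLpNorm u r volume =
      (∫⁻ x, ENNReal.ofReal (‖u x‖ ^ r.toReal)) ^ (1 / r.toReal) := by
    intro r u h0 ht
    rw [eLpNorm_eq_lintegral_rpow_enorm_toReal h0 ht]
    congr 1
    refine lintegral_congr fun x => ?_
    rw [← ofReal_norm, ENNReal.ofReal_rpow_of_nonneg (norm_nonneg _)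
      ENNReal.toReal_nonneg]
  let K : ℝ := Q * (4 * 2 ^ (Q - 2) / (Q - 2))
  refine ⟨(K.toNNReal) ^ (1 / Q), fun f hf => ?_⟩
  by_cases hzero : eLpNorm f p volume = 0
  · refine ⟨0, MemLp.zero, by simp, fun φ => ?_⟩
    have : f =ᵐ[volume] 0 := (eLpNorm_eq_zero_iff hf.1 hp0).1 hzero
    rw [integral_congr_ae (g := fun _ => 0)]
    · simp
    · filter_upwards [this] with x hx; simp [hx]
  let A : ℝ := (eLpNorm f p volume).toReal
  have hA : 0 < A := ENNReal.toReal_pos hzero hf.2.ne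
  have hAe : ENNReal.ofReal A = eLpNorm f p volume := ENNReal.ofReal_toReal hf.2.ne
  -- The truncation argument requires norm at most one, so a strongly measurable representative is
  -- normalised and the result scaled back.
  let f' : V → ℂ := (A⁻¹ : ℝ) • hf.1.mk f
  have hf'n : eLpNorm f' p volume = 1 := by
    rw [eLpNorm_const_smul, ← eLpNorm_congr_ae hf.1.ae_eq_mk, ← hAe, ← ofReal_norm,
      Real.norm_of_nonneg (by positivity), ← ENNReal.ofReal_mul (by positivity),
      inv_mul_cancel₀ hA.ne', ENNReal.ofReal_one]
  have hf'1 : ∫⁻ x, ENNReal.ofReal (‖f' x‖ ^ P) ≤ 1 := by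
    rw [hnorm p f' hp0 hpt] at hf'n
    have h1 := congrArg (fun z : ℝ≥0∞ => z ^ P) hf'n
    simp only [ENNReal.one_rpow] at h1
    rw [← ENNReal.rpow_mul, one_div_mul_cancel (by positivity), ENNReal.rpow_one] at h1
    exact h1.le
  obtain ⟨g, hgm, hgb, hF⟩ := exists_isFourierOf_of_lintegral_le_one hPQ hP2
    (hf.1.stronglyMeasurable_mk.const_smul (A⁻¹ : ℝ)) hf'1
  have hgn : eLpNorm g p' volume ≤ ((K.toNNReal ^ (1 / Q) : ℝ≥0) : ℝ≥0∞) := by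
    rw [hnorm p' g hp'0 hp't, ENNReal.coe_rpow_of_nonneg _ (by positivity)]
    exact ENNReal.rpow_le_rpow hgb (by positivity)
  have hAg : eLpNorm (A • g) p' volume ≤
      ((K.toNNReal ^ (1 / Q) : ℝ≥0) : ℝ≥0∞) * eLpNorm f p volume := by
    rw [eLpNorm_const_smul, ← ofReal_norm, Real.norm_of_nonneg hA.le, hAe, mul_comm]
    gcongr
  refine ⟨A • g, ⟨hgm.const_smul A, hAg.trans_lt (ENNReal.mul_lt_top ENNReal.coe_lt_top hf.2)⟩,
    hAg, fun φ => ?_⟩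
  have h1 := congrArg (fun z : ℂ => (A : ℂ) * z) (hF φ)
  simp only [← integral_const_mul] at h1
  calc _ = ∫ x, (A : ℂ) * (𝓕 φ x * f' x) := by
        refine integral_congr_ae ?_
        filter_upwards [hf.1.ae_eq_mk] with x hx
        have : (A : ℂ) ≠ 0 := by exact_mod_cast hA.ne'
        simp only [f', Pi.smul_apply, Complex.real_smul, ← hx]
        push_cast
        field_simp
    _ = _ := by
        rw [h1]
        refine integral_congr_ae (ae_of_all _ fun x => ?_)
        simp only [Pi.smul_apply, Complex.real_smul]; ring

end HausdorffYoung

/-! ### Third order equations at a fixed frequency and their roots -/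

section FrequencyODE

theorem eq_exp_mul_of_hasDerivAt {ζ : ℝ → ℂ} {c : ℂ} (h : ∀ t, HasDerivAt ζ (c * ζ t) t) (t : ℝ) :
    ζ t = Complex.exp (c * t) * ζ 0 := by
  have hd : ∀ s : ℝ, HasDerivAt (fun s : ℝ => Complex.exp (-(c * s)) * ζ s) 0 s := by
    intro s
    have h1 : HasDerivAt (fun s : ℝ => -(c * (s : ℂ))) (-(c * 1)) s :=
      ((Complex.ofRealCLM.hasDerivAt (x := s)).const_mul c).neg
    refine (h1.cexp.mul (h s)).congr_deriv ?_
    ring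
  have := is_const_of_deriv_eq_zero (fun s => (hd s).differentiableAt) (fun s => (hd s).deriv) t 0
  simp only [Complex.ofReal_zero, mul_zero, neg_zero, Complex.exp_zero, one_mul] at this
  rw [← this, ← mul_assoc, ← Complex.exp_add]
  simp

/-- The combinations z ± iωx diagonalise the system with eigenvalues -a ± iω, so their moduli decay
exactly like e^{-at}; `z` and `ωx` are recovered as half their sum and difference, up to a unit
factor. -/
theorem norm_le_of_damped_oscillator {x z : ℝ → ℂ} {a ω : ℝ} (hω : 0 < ω)
    (hx : ∀ t, HasDerivAt x (z t - a * x t) t)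
    (hz : ∀ t, HasDerivAt z (-(ω ^ 2 * x t) - a * z t) t) (t : ℝ) :
    ‖z t‖ ≤ Real.exp (-(a * t)) * (‖z 0‖ + ω * ‖x 0‖) ∧
      ω * ‖x t‖ ≤ Real.exp (-(a * t)) * (‖z 0‖ + ω * ‖x 0‖) := by
  have key : ∀ e : ℝ, e ^ 2 = 1 → ‖z t + e * Complex.I * ω * x t‖ ≤
      Real.exp (-(a * t)) * (‖z 0‖ + ω * ‖x 0‖) := by
    intro e he
    have heC : (e : ℂ) ^ 2 = 1 := by exact_mod_cast he
    have h1 : ∀ t, HasDerivAt (fun t => z t + e * Complex.I * ω * x t)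
        ((-a + e * Complex.I * ω) * (z t + e * Complex.I * ω * x t)) t := by
      intro t
      refine ((hz t).add ((hx t).const_mul (e * Complex.I * ω))).congr_deriv ?_
      linear_combination (Complex.I ^ 2 * (-1) * ω ^ 2 * x t) * heC -
        (ω ^ 2 * x t) * Complex.I_sq
    rw [eq_exp_mul_of_hasDerivAt h1 t, norm_mul, Complex.norm_exp]
    have he1 : |e| = 1 := by
      have := sq_abs e; rw [he] at this
      exact (pow_eq_one_iff_of_nonneg (abs_nonneg e) two_ne_zero).1 this
    refine mul_le_mul (le_of_eq ?_) ?_ (norm_nonneg _) (Real.exp_pos _).le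
    · congr 1; simp
    · refine (norm_add_le _ _).trans ?_
      rw [norm_mul, norm_mul, norm_mul, Complex.norm_I, Complex.norm_real, Complex.norm_real,
        Real.norm_eq_abs, he1, Real.norm_of_nonneg hω.le]
      simp
  have hp := key 1 (by norm_num)
  have hm := key (-1) (by norm_num)
  constructor
  · have e1 : z t = ((z t + (1 : ℝ) * Complex.I * ω * x t) +
        (z t + (-1 : ℝ) * Complex.I * ω * x t)) / 2 := by push_cast; ring
    rw [e1, norm_div, Complex.norm_two]
    have := norm_add_le (z t + (1 : ℝ) * Complex.I * ω * x t)
        (z t + (-1 : ℝ) * Complex.I * ω * x t)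
    linarith
  · have e1 : ‖2 * Complex.I * ω * x t‖ = 2 * (ω * ‖x t‖) := by
      rw [norm_mul, norm_mul, norm_mul, Complex.norm_I, Complex.norm_real,
        Real.norm_of_nonneg hω.le, Complex.norm_two]; ring
    have e2 : 2 * Complex.I * ω * x t = ((z t + (1 : ℝ) * Complex.I * ω * x t) -
        (z t + (-1 : ℝ) * Complex.I * ω * x t)) := by push_cast; ring
    rw [e2] at e1
    have := norm_sub_le (z t + (1 : ℝ) * Complex.I * ω * x t)
        (z t + (-1 : ℝ) * Complex.I * ω * x t)
    linarith

/-- Solutions of a third order equation whose characteristic polynomial has one real root `σ` and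
two complex roots. -/
theorem norm_le_of_third_order {f f₁ f₂ : ℝ → ℂ} {c₀ c₁ c₂ σ a β ω γ : ℝ}
    (hf : ∀ t, HasDerivAt f (f₁ t) t) (hf₁ : ∀ t, HasDerivAt f₁ (f₂ t) t)
    (hf₂ : ∀ t, HasDerivAt f₂ (-(c₂ * f₂ t + c₁ * f₁ t + c₀ * f t)) t)
    (hσ : σ ^ 3 + c₂ * σ ^ 2 + c₁ * σ + c₀ = 0) (ha : 2 * a = c₂ + σ)
    (hβ : β = c₁ + σ * (c₂ + σ)) (hω : 0 < ω) (hω2 : ω ^ 2 = β - a ^ 2)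
    (hγ : γ = β + 2 * a * σ + σ ^ 2) (hγ0 : 0 ≤ γ) (t : ℝ) :
    γ * ‖f t‖ ≤ Real.exp (σ * t) * ‖f₂ 0 + 2 * a * f₁ 0 + β * f 0‖ +
      (1 + |a + σ| / ω) * Real.exp (-(a * t)) *
        (‖f₂ 0 - σ * f₁ 0 + a * (f₁ 0 - σ * f 0)‖ + ω * ‖f₁ 0 - σ * f 0‖) := by
  have hσC : (σ : ℂ) ^ 3 + c₂ * σ ^ 2 + c₁ * σ + c₀ = 0 := by exact_mod_cast hσ
  have haC : (2 : ℂ) * a = c₂ + σ := by exact_mod_cast ha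
  have hβC : (β : ℂ) = c₁ + σ * (c₂ + σ) := by exact_mod_cast hβ
  have hω2C : (ω : ℂ) ^ 2 = β - a ^ 2 := by exact_mod_cast hω2
  have hγC : (γ : ℂ) = β + 2 * a * σ + σ ^ 2 := by exact_mod_cast hγ
  -- The polynomial factors as (λ - σ)(λ² + 2aλ + β). Applying the quadratic factor to `f` leaves
  -- the pure mode e^{σt}; applying the linear factor, in `hx` below, leaves a damped oscillator of
  -- frequency `ω`.
  have hy : ∀ t, HasDerivAt (fun t => f₂ t + 2 * a * f₁ t + β * f t)
      (σ * (f₂ t + 2 * a * f₁ t + β * f t)) t := by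
    intro t
    refine (((hf₂ t).add ((hf₁ t).const_mul (2 * (a : ℂ)))).add
      ((hf t).const_mul (β : ℂ))).congr_deriv ?_
    rw [hβC, haC]
    linear_combination (-f t) * hσC
  have hx : ∀ t, HasDerivAt (fun t => f₁ t - σ * f t)
      ((f₂ t - σ * f₁ t + a * (f₁ t - σ * f t)) - a * (f₁ t - σ * f t)) t := by
    intro t
    refine ((hf₁ t).sub ((hf t).const_mul (σ : ℂ))).congr_deriv ?_
    ring
  have hz : ∀ t, HasDerivAt (fun t => f₂ t - σ * f₁ t + a * (f₁ t - σ * f t))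
      (-(ω ^ 2 * (f₁ t - σ * f t)) - a * (f₂ t - σ * f₁ t + a * (f₁ t - σ * f t))) t := by
    intro t
    refine (((hf₂ t).sub ((hf₁ t).const_mul (σ : ℂ))).add
      (((hf₁ t).sub ((hf t).const_mul (σ : ℂ))).const_mul (a : ℂ))).congr_deriv ?_
    rw [hω2C, hβC]
    linear_combination (f₂ t - σ * f₁ t) * haC - f t * hσC
  have hyt := eq_exp_mul_of_hasDerivAt hy t
  obtain ⟨hzt, hxt⟩ := norm_le_of_damped_oscillator hω hx hz t
  set S := Real.exp (-(a * t)) * (‖f₂ 0 - σ * f₁ 0 + a * (f₁ 0 - σ * f 0)‖ +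
    ω * ‖f₁ 0 - σ * f 0‖) with hS
  -- Recovering `f` from the two modes costs division by `γ`, the value of the quadratic factor at
  -- `σ`, that is, the squared distance from `σ` to the complex roots.
  have e : (γ : ℂ) * f t = (f₂ t + 2 * a * f₁ t + β * f t) -
      (f₂ t - σ * f₁ t + a * (f₁ t - σ * f t)) - (a + σ : ℝ) * (f₁ t - σ * f t) := by
    push_cast
    rw [hγC]; ring
  have h1 : γ * ‖f t‖ = ‖(γ : ℂ) * f t‖ := by
    rw [norm_mul, Complex.norm_real, Real.norm_of_nonneg hγ0]
  rw [h1, e]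
  refine (norm_sub_le _ _).trans ?_
  refine (add_le_add_left (norm_sub_le _ _) _).trans ?_
  rw [hyt, norm_mul, Complex.norm_exp, norm_mul, Complex.norm_real, Real.norm_eq_abs]
  have h2 : |a + σ| * ‖f₁ t - σ * f t‖ ≤ |a + σ| / ω * S := by
    rw [div_mul_eq_mul_div, le_div_iff₀ hω, mul_assoc]
    refine mul_le_mul_of_nonneg_left ?_ (abs_nonneg _)
    rw [mul_comm]; exact hxt
  have h3 : ((σ : ℂ) * t).re = σ * t := by simp
  rw [h3]
  have h4 : (1 + |a + σ| / ω) * Real.exp (-(a * t)) *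
        (‖f₂ 0 - σ * f₁ 0 + a * (f₁ 0 - σ * f 0)‖ + ω * ‖f₁ 0 - σ * f 0‖) =
        S + |a + σ| / ω * S := by rw [hS]; ring
  rw [h4]
  linarith

theorem norm_linear_comb_le (a b c : ℝ) (u v w : ℂ) :
    ‖(a : ℂ) * u + b * v + c * w‖ ≤ |a| * ‖u‖ + |b| * ‖v‖ + |c| * ‖w‖ := by
  refine (norm_add₃_le).trans ?_
  simp

set_option maxHeartbeats 2000000 in
/-- The third order equation of the longitudinal part of the Euler-Maxwell system. -/
theorem longitudinal_third_order_bound {q w : ℝ} (hq : 0 ≤ q) (hw : 0 < w) (hwq : w ^ 2 = 1 + q)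
    {f f₁ f₂ : ℝ → ℂ} (hf : ∀ t, HasDerivAt f (f₁ t) t) (hf₁ : ∀ t, HasDerivAt f₁ (f₂ t) t)
    (hf₂ : ∀ t, HasDerivAt f₂ (-(2 * f₂ t + (2 + 5 / 3 * q) * f₁ t + (1 + q) * f t)) t)
    {t : ℝ} (ht : 0 ≤ t) :
    w ^ 2 * ‖f t‖ ≤ 21 * Real.exp (-t / 2) * (w ^ 2 * ‖f 0‖ + w * ‖f₁ 0‖ + ‖f₂ 0‖) := by
  -- At -3/5 the terms in `q` cancel and the polynomial is positive; at -1 it equals -2q/3. The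
  -- bracket is therefore uniform in the frequency, and σ ≥ -1 gives `a ≥ 1/2`.
  obtain ⟨σ, ⟨hσ1, hσ2⟩, hσ⟩ : ∃ σ ∈ Set.Icc (-1 : ℝ) (-3 / 5),
      σ ^ 3 + 2 * σ ^ 2 + (2 + 5 / 3 * q) * σ + (1 + q) = 0 := by
    have hc : ContinuousOn (fun σ : ℝ => σ ^ 3 + 2 * σ ^ 2 + (2 + 5 / 3 * q) * σ + (1 + q))
      (Set.Icc (-1 : ℝ) (-3 / 5)) := by fun_prop
    exact intermediate_value_Icc (by norm_num) hc ⟨by norm_num; linarith, by norm_num; linarith⟩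
  let a : ℝ := (2 + σ) / 2
  let β : ℝ := (2 + 5 / 3 * q) + σ * (2 + σ)
  have hw1 : 1 ≤ w := by nlinarith
  have hlow : w ^ 2 / 2 ≤ β - a ^ 2 := by simp only [β, a]; nlinarith
  have hup : β - a ^ 2 ≤ (2 * w) ^ 2 := by simp only [β, a]; nlinarith
  let ω : ℝ := Real.sqrt (β - a ^ 2)
  have hω2 : ω ^ 2 = β - a ^ 2 := Real.sq_sqrt (by nlinarith)
  have hω0 : 0 < ω := Real.sqrt_pos.2 (by nlinarith)
  have hωlow : 1 / 2 ≤ ω := by nlinarith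
  have hωup : ω ≤ 2 * w := by
    refine Real.sqrt_le_iff.2 ⟨by linarith, hup⟩
  -- Explicitly γ = 2 + 5q/3 + 4σ + 3σ², whose minimum over σ is 2/3 + 5q/3, attained at -2/3.
  let γ : ℝ := β + 2 * a * σ + σ ^ 2
  have hγ : 2 / 3 * w ^ 2 ≤ γ := by simp only [γ, β, a]; nlinarith [sq_nonneg (3 * σ + 2)]
  have main := norm_le_of_third_order (c₀ := 1 + q) (c₁ := 2 + 5 / 3 * q) (c₂ := 2) (σ := σ)
    (a := a) (β := β) (ω := ω) (γ := γ) hf hf₁ (fun t => by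
      have := hf₂ t; push_cast; exact this) hσ (by simp only [a]; ring) rfl hω0 hω2 rfl
    (by nlinarith) t
  set S := w ^ 2 * ‖f 0‖ + w * ‖f₁ 0‖ + ‖f₂ 0‖ with hS
  have n0 := norm_nonneg (f 0)
  have n1 := norm_nonneg (f₁ 0)
  have n2 := norm_nonneg (f₂ 0)
  have hww : w ≤ w ^ 2 := by nlinarith
  have m0 : ‖f 0‖ ≤ w ^ 2 * ‖f 0‖ := le_mul_of_one_le_left n0 (by nlinarith)
  have m0' : w * ‖f 0‖ ≤ w ^ 2 * ‖f 0‖ := mul_le_mul_of_nonneg_right hww n0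
  have m1 : ‖f₁ 0‖ ≤ w * ‖f₁ 0‖ := le_mul_of_one_le_left n1 hw1
  have ha1 : 1 / 2 ≤ a := by simp only [a]; linarith
  have ha2 : a ≤ 7 / 10 := by simp only [a]; linarith
  have hβ0 : 0 ≤ β := by nlinarith
  have hβ : β ≤ 2 * w ^ 2 := by simp only [β]; nlinarith
  have hy : ‖f₂ 0 + 2 * a * f₁ 0 + β * f 0‖ ≤ 2 * S := by
    have e : f₂ 0 + 2 * a * f₁ 0 + β * f 0 =
      ((1 : ℝ) : ℂ) * f₂ 0 + ((2 * a : ℝ) : ℂ) * f₁ 0 + (β : ℂ) * f 0 := by push_cast; ring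
    rw [e]
    refine (norm_linear_comb_le _ _ _ _ _ _).trans ?_
    rw [abs_one, abs_of_nonneg (by linarith : 0 ≤ 2 * a), abs_of_nonneg hβ0]
    have := mul_le_mul_of_nonneg_right hβ n0
    have := mul_le_mul_of_nonneg_right (by linarith : 2 * a ≤ 2) n1
    linarith
  have hx : ‖f₁ 0 - σ * f 0‖ ≤ ‖f₁ 0‖ + ‖f 0‖ := by
    refine (norm_sub_le _ _).trans ?_
    rw [norm_mul, Complex.norm_real, Real.norm_eq_abs, abs_of_nonpos (by linarith)]
    have := mul_le_mul_of_nonneg_right (by linarith : -σ ≤ 1) n0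
    linarith
  have hz : ‖f₂ 0 - σ * f₁ 0 + a * (f₁ 0 - σ * f 0)‖ ≤ ‖f₂ 0‖ + 17 / 10 * ‖f₁ 0‖ + ‖f 0‖ := by
    have e : f₂ 0 - σ * f₁ 0 + a * (f₁ 0 - σ * f 0) =
      ((1 : ℝ) : ℂ) * f₂ 0 + ((a - σ : ℝ) : ℂ) * f₁ 0 + ((-(a * σ) : ℝ) : ℂ) * f 0 := by
        push_cast; ring
    rw [e]
    refine (norm_linear_comb_le _ _ _ _ _ _).trans ?_
    have hp : a * σ ≤ 0 := mul_nonpos_of_nonneg_of_nonpos (by linarith) (by linarith)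
    have hp' : a * -σ ≤ 1 * 1 := mul_le_mul (by linarith) (by linarith) (by linarith) one_pos.le
    rw [abs_one, abs_of_nonneg (by linarith : 0 ≤ a - σ), abs_of_nonneg (by linarith)]
    have := mul_le_mul_of_nonneg_right (by linarith : a - σ ≤ 17 / 10) n1
    have := mul_le_mul_of_nonneg_right (by linarith : -(a * σ) ≤ 1) n0
    linarith
  have hzx : ‖f₂ 0 - σ * f₁ 0 + a * (f₁ 0 - σ * f 0)‖ + ω * ‖f₁ 0 - σ * f 0‖ ≤ 4 * S := by
    have h1 : ω * ‖f₁ 0 - σ * f 0‖ ≤ 2 * w * (‖f₁ 0‖ + ‖f 0‖) :=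
      mul_le_mul hωup hx (norm_nonneg _) (by linarith)
    linarith
  have hfac : 1 + |a + σ| / ω ≤ 3 := by
    have : |a + σ| ≤ 1 := abs_le.2 ⟨by simp only [a]; linarith, by simp only [a]; linarith⟩
    have : |a + σ| / ω ≤ 2 := by rw [div_le_iff₀ hω0]; linarith
    linarith
  have hS0 : 0 ≤ S := by positivity
  have he1 : Real.exp (σ * t) ≤ Real.exp (-t / 2) := Real.exp_le_exp.2 (by nlinarith)
  have he2 : Real.exp (-(a * t)) ≤ Real.exp (-t / 2) := Real.exp_le_exp.2 (by nlinarith)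
  -- The total is 14 S; division by the factor 2/3 in the lower bound of `γ` produces the constant
  -- 21.
  have hfin : γ * ‖f t‖ ≤ Real.exp (-t / 2) * (2 * S) + 3 * Real.exp (-t / 2) * (4 * S) := by
    refine main.trans (add_le_add ?_ ?_)
    · exact mul_le_mul he1 hy (norm_nonneg _) (Real.exp_pos _).le
    · refine mul_le_mul (mul_le_mul hfac he2 (Real.exp_pos _).le (by norm_num)) hzx
        (by positivity) (by positivity)
  have := mul_le_mul_of_nonneg_right hγ (norm_nonneg (f t))
  linarith

/-- The real root of the characteristic polynomial of the transverse part. -/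
theorem exists_transverse_root {q : ℝ} (hq : 0 < q) :
    ∃ s : ℝ, 0 < s ∧ s < 1 ∧ s * (1 - s + s ^ 2 + q) = q := by
  have hc : ContinuousOn (fun s : ℝ => s * (1 - s + s ^ 2 + q)) (Set.Icc 0 1) := by fun_prop
  obtain ⟨s, hs, h⟩ := intermediate_value_Icc (zero_le_one (α := ℝ)) hc
    (show q ∈ Set.Icc _ _ from ⟨by simpa using hq.le, by norm_num⟩)
  simp only at h
  refine ⟨s, lt_of_le_of_ne hs.1 ?_, lt_of_le_of_ne hs.2 ?_, h⟩
  · rintro rfl; simp at h; linarith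
  · rintro rfl; norm_num at h

/-- The characteristic polynomial is (λ + s)(λ² + (1-s)λ + 1 + q - s + s²), so the two decay rates
are s and (1-s)/2. The discriminant quantity β - a² and the separation γ of the roots are both
smallest at s = 1/3, where each equals 2/3 + q. -/
theorem transverse_third_order_bound {q s : ℝ} (hq : 0 < q) (hs0 : 0 < s) (hs1 : s < 1)
    (hs : s * (1 - s + s ^ 2 + q) = q)
    {f f₁ f₂ : ℝ → ℂ} (hf : ∀ t, HasDerivAt f (f₁ t) t) (hf₁ : ∀ t, HasDerivAt f₁ (f₂ t) t)
    (hf₂ : ∀ t, HasDerivAt f₂ (-(f₂ t + (1 + q) * f₁ t + q * f t)) t) (t : ℝ) :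
    (2 / 3 + q) * ‖f t‖ ≤
      Real.exp (-(s * t)) * ‖f₂ 0 + (1 - s) * f₁ 0 + (1 + q - s + s ^ 2) * f 0‖ +
      3 * Real.exp (-((1 - s) / 2 * t)) * (‖f₂ 0 + s * f₁ 0‖ +
        (1 + q) ^ (1 / 2 : ℝ) * (2 * ‖f₁ 0 + s * f 0‖)) := by
  let a : ℝ := (1 - s) / 2
  let β : ℝ := (1 + q) + (-s) * (1 + -s)
  have hlow : 2 / 3 + q ≤ β - a ^ 2 := by
    simp only [β, a]; nlinarith [sq_nonneg (3 * s - 1)]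
  have hup : β - a ^ 2 ≤ 1 + q := by simp only [β, a]; nlinarith [sq_nonneg ((1 - s) / 2)]
  let ω : ℝ := Real.sqrt (β - a ^ 2)
  have hω2 : ω ^ 2 = β - a ^ 2 := Real.sq_sqrt (by linarith)
  have hω0 : 0 < ω := Real.sqrt_pos.2 (by linarith)
  have hωlow : 1 / 2 ≤ ω := by nlinarith
  have hωup : ω ≤ (1 + q) ^ (1 / 2 : ℝ) := by
    rw [← Real.sqrt_eq_rpow]; exact Real.sqrt_le_sqrt hup
  let γ : ℝ := β + 2 * a * (-s) + (-s) ^ 2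
  have hγ : 2 / 3 + q ≤ γ := by simp only [γ, β, a]; nlinarith [sq_nonneg (3 * s - 1)]
  have main := norm_le_of_third_order (c₀ := q) (c₁ := 1 + q) (c₂ := 1) (σ := -s)
    (a := a) (β := β) (ω := ω) (γ := γ) hf hf₁ (fun t => by
      have := hf₂ t; push_cast; rw [one_mul]; exact this) (by linear_combination -hs)
      (by simp only [a]; ring) rfl hω0 hω2 rfl (by linarith) t
  have hfac : 1 + |a + -s| / ω ≤ 3 := by
    have : |a + -s| ≤ 1 := abs_le.2 ⟨by simp only [a]; linarith, by simp only [a]; linarith⟩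
    have : |a + -s| / ω ≤ 2 := by rw [div_le_iff₀ hω0]; linarith
    linarith
  refine (mul_le_mul_of_nonneg_right hγ (norm_nonneg _)).trans (main.trans ?_)
  have e1 : f₂ 0 + 2 * (a : ℂ) * f₁ 0 + (β : ℂ) * f 0 =
      f₂ 0 + (1 - s) * f₁ 0 + (1 + q - s + s ^ 2) * f 0 := by
    simp only [a, β]; push_cast; ring
  have e2 : f₁ 0 - ((-s : ℝ) : ℂ) * f 0 = f₁ 0 + s * f 0 := by push_cast; ring
  have e3 : f₂ 0 - ((-s : ℝ) : ℂ) * f₁ 0 = f₂ 0 + s * f₁ 0 := by push_cast; ring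
  rw [e1, e2, e3, neg_mul]
  refine add_le_add le_rfl ?_
  refine mul_le_mul (mul_le_mul_of_nonneg_right hfac (Real.exp_pos _).le) ?_ (by positivity)
    (by positivity)
  have ha : ‖(a : ℂ) * (f₁ 0 + s * f 0)‖ ≤ (1 + q) ^ (1 / 2 : ℝ) * ‖f₁ 0 + s * f 0‖ := by
    rw [norm_mul, Complex.norm_real, Real.norm_of_nonneg (by simp only [a]; linarith)]
    refine mul_le_mul_of_nonneg_right ?_ (norm_nonneg _)
    have : (1 : ℝ) ≤ (1 + q) ^ (1 / 2 : ℝ) := Real.one_le_rpow (by linarith) (by norm_num)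
    simp only [a]; linarith
  have hb : ω * ‖f₁ 0 + s * f 0‖ ≤ (1 + q) ^ (1 / 2 : ℝ) * ‖f₁ 0 + s * f 0‖ :=
    mul_le_mul_of_nonneg_right hωup (norm_nonneg _)
  have := norm_add_le (f₂ 0 + s * f₁ 0) ((a : ℂ) * (f₁ 0 + s * f 0))
  linarith

/-- `X' = -X - Y`, `Y' = X + Z`, `Z' = -κ² Y`: the transverse part of the Euler-Maxwell system at a
frequency of modulus `κ`. -/
structure TransverseSystem (κ : ℝ) (X Y Z : ℝ → ℂ) : Prop where
  hX : ∀ t, HasDerivAt X (-X t - Y t) t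
  hY : ∀ t, HasDerivAt Y (X t + Z t) t
  hZ : ∀ t, HasDerivAt Z (-((κ : ℂ) ^ 2 * Y t)) t

namespace TransverseSystem

variable {κ s : ℝ} {X Y Z : ℝ → ℂ}

/-- All three unknowns satisfy the same scalar third order equation and differ only in their initial
derivatives. In the amplitude of e^{-st} for `X`, the terms of order one in `X 0` and `Y 0` cancel,
which is the source of the extra factor κ at low frequencies. -/
theorem bound_X (h : TransverseSystem κ X Y Z) (hκ : 0 < κ) (hs0 : 0 < s) (hs1 : s < 1)
    (hs : s * (1 - s + s ^ 2 + κ ^ 2) = κ ^ 2) (t : ℝ) :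
    (2 / 3 + κ ^ 2) * ‖X t‖ ≤
      Real.exp (-(s * t)) * ‖-Z 0 + s * Y 0 + (κ ^ 2 + s ^ 2) * X 0‖ +
      3 * Real.exp (-((1 - s) / 2 * t)) * (‖Y 0 - Z 0 - s * (X 0 + Y 0)‖ +
        (1 + κ ^ 2) ^ (1 / 2 : ℝ) * (2 * ‖-X 0 - Y 0 + s * X 0‖)) := by
  have := transverse_third_order_bound (q := κ ^ 2) (f := X) (f₁ := fun t => -X t - Y t)
    (f₂ := fun t => Y t - Z t) (by positivity) hs0 hs1 hs h.hX
    (fun t => ((h.hX t).neg.sub (h.hY t)).congr_deriv (by ring))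
    (fun t => ((h.hY t).sub (h.hZ t)).congr_deriv (by push_cast; ring)) t
  convert this using 4
  · push_cast; ring_nf
  · ring_nf

theorem bound_Y (h : TransverseSystem κ X Y Z) (hκ : 0 < κ) (hs0 : 0 < s) (hs1 : s < 1)
    (hs : s * (1 - s + s ^ 2 + κ ^ 2) = κ ^ 2) (t : ℝ) :
    (2 / 3 + κ ^ 2) * ‖Y t‖ ≤
      Real.exp (-(s * t)) * ‖-(s * X 0) + (s ^ 2 - s) * Y 0 + (1 - s) * Z 0‖ +
      3 * Real.exp (-((1 - s) / 2 * t)) * (‖-X 0 - Y 0 - κ ^ 2 * Y 0 + s * (X 0 + Z 0)‖ +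
        (1 + κ ^ 2) ^ (1 / 2 : ℝ) * (2 * ‖X 0 + Z 0 + s * Y 0‖)) := by
  have := transverse_third_order_bound (q := κ ^ 2) (f := Y) (f₁ := fun t => X t + Z t)
    (f₂ := fun t => -X t - Y t - κ ^ 2 * Y t) (by positivity) hs0 hs1 hs h.hY
    (fun t => ((h.hX t).add (h.hZ t)).congr_deriv (by ring))
    (fun t => (((h.hX t).neg.sub (h.hY t)).sub ((h.hY t).const_mul ((κ : ℂ) ^ 2))).congr_deriv
      (by push_cast; ring)) t
  convert this using 4
  push_cast; ring_nf

theorem bound_Z (h : TransverseSystem κ X Y Z) (hκ : 0 < κ) (hs0 : 0 < s) (hs1 : s < 1)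
    (hs : s * (1 - s + s ^ 2 + κ ^ 2) = κ ^ 2) (t : ℝ) :
    (2 / 3 + κ ^ 2) * ‖Z t‖ ≤
      Real.exp (-(s * t)) * ‖-(κ ^ 2 * X 0) - (1 - s) * κ ^ 2 * Y 0 + (1 - s + s ^ 2) * Z 0‖ +
      3 * Real.exp (-((1 - s) / 2 * t)) * (‖-(κ ^ 2 * (X 0 + Z 0)) - s * κ ^ 2 * Y 0‖ +
        (1 + κ ^ 2) ^ (1 / 2 : ℝ) * (2 * ‖-(κ ^ 2 * Y 0) + s * Z 0‖)) := by
  have := transverse_third_order_bound (q := κ ^ 2) (f := Z) (f₁ := fun t => -(κ ^ 2 * Y t))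
    (f₂ := fun t => -(κ ^ 2 * (X t + Z t))) (by positivity) hs0 hs1 hs h.hZ
    (fun t => ((h.hY t).const_mul ((κ : ℂ) ^ 2)).neg.congr_deriv (by ring))
    (fun t => (((h.hX t).add (h.hZ t)).const_mul ((κ : ℂ) ^ 2)).neg.congr_deriv
      (by push_cast; ring)) t
  convert this using 4
  · push_cast; ring_nf
  · ring_nf

theorem combine_bound {γ u E₁ E₂ A B F₁ F₂ : ℝ}
    (h : γ * u ≤ E₁ * A + 3 * E₂ * B) (hE₁ : E₁ ≤ F₁) (hE₂ : E₂ ≤ F₂) (hA : 0 ≤ A) (hB : 0 ≤ B) :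
    γ * u ≤ F₁ * A + 3 * F₂ * B := by
  refine h.trans (add_le_add (mul_le_mul_of_nonneg_right hE₁ hA) ?_)
  exact mul_le_mul_of_nonneg_right (by linarith) hB

set_option maxHeartbeats 2000000 in
/-- Decay of the transverse part at low frequencies. -/
theorem low_frequency_bound (h : TransverseSystem κ X Y Z) (hκ : 0 < κ) (hκ1 : κ ≤ 1) {N : ℝ}
    (hXN : ‖X 0‖ ≤ N) (hYN : ‖Y 0‖ ≤ N) (hZN : ‖Z 0‖ ≤ κ * N) {t : ℝ} (ht : 0 ≤ t) :
    ‖X t‖ ≤ 100 * (Real.exp (-t / 8) + κ * Real.exp (-(κ ^ 2 * t) / 8)) * N ∧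
    ‖Y t‖ ≤ 100 * (Real.exp (-t / 8) + κ * Real.exp (-(κ ^ 2 * t) / 8)) * N ∧
    ‖Z t‖ ≤ κ * (100 * Real.exp (-(κ ^ 2 * t) / 8) * N) := by
  obtain ⟨s, hs0, hs1, hs⟩ := exists_transverse_root (q := κ ^ 2) (by positivity)
  have hq1 : κ ^ 2 ≤ κ := by nlinarith
  -- All bounds on the root come from 3/4 ≤ 1 - s + s² ≤ 1 in the root equation: the slow rate is
  -- comparable to κ², and s ≤ 4/7 keeps the oscillating pair uniformly damped.
  have hsup : s ≤ 4 / 3 * κ ^ 2 := by nlinarith [sq_nonneg (2 * s - 1)]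
  have hs47 : s ≤ 4 / 7 := by nlinarith [sq_nonneg (2 * s - 1)]
  have hslow : κ ^ 2 / 2 ≤ s := by nlinarith
  have hE₁ : Real.exp (-(s * t)) ≤ Real.exp (-(κ ^ 2 * t) / 8) :=
    Real.exp_le_exp.2 (by nlinarith)
  have hE₂ : Real.exp (-((1 - s) / 2 * t)) ≤ Real.exp (-t / 8) :=
    Real.exp_le_exp.2 (by nlinarith)
  have hE₃ : Real.exp (-t / 8) ≤ Real.exp (-(κ ^ 2 * t) / 8) :=
    Real.exp_le_exp.2 (by nlinarith)
  have hN : 0 ≤ N := (norm_nonneg _).trans hXN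
  have hκN : κ * N ≤ N := mul_le_of_le_one_left hN hκ1
  have hκN0 : 0 ≤ κ * N := mul_nonneg hκ.le hN
  have hqN : κ ^ 2 * N ≤ κ * N := mul_le_mul_of_nonneg_right hq1 hN
  have hroot : (1 + κ ^ 2) ^ (1 / 2 : ℝ) ≤ 2 := by
    rw [← Real.sqrt_eq_rpow]; exact Real.sqrt_le_iff.2 ⟨by norm_num, by nlinarith⟩
  have hroot0 : 0 ≤ (1 + κ ^ 2) ^ (1 / 2 : ℝ) := by positivity
  have lin : ∀ {a b c A B C : ℝ} {v : ℂ}, v = (a : ℂ) * X 0 + b * Y 0 + c * Z 0 → |a| ≤ A →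
      |b| ≤ B → |c| ≤ C → ‖v‖ ≤ A * N + B * N + C * (κ * N) := by
    intro a b c A B C v hv ha hb hc
    rw [hv]
    refine (norm_linear_comb_le _ _ _ _ _ _).trans ?_
    exact add_le_add (add_le_add (mul_le_mul ha hXN (norm_nonneg _) ((abs_nonneg _).trans ha))
      (mul_le_mul hb hYN (norm_nonneg _) ((abs_nonneg _).trans hb)))
      (mul_le_mul hc hZN (norm_nonneg _) ((abs_nonneg _).trans hc))
  have fin : ∀ {u A B F D : ℝ}, 0 ≤ u → (2 / 3 + κ ^ 2) * u ≤
      Real.exp (-(κ ^ 2 * t) / 8) * A + 3 * Real.exp (-t / 8) * B → A ≤ F → B ≤ D →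
      u ≤ 3 / 2 * (Real.exp (-(κ ^ 2 * t) / 8) * F + 3 * Real.exp (-t / 8) * D) := by
    intro u A B F D hu hb hA hB
    have h1 := mul_le_mul_of_nonneg_left hA (Real.exp_pos (-(κ ^ 2 * t) / 8)).le
    have h2 := mul_le_mul_of_nonneg_left hB (Real.exp_pos (-t / 8)).le
    have h3 : 0 ≤ κ ^ 2 * u := by positivity
    linarith
  have hp1 := Real.exp_pos (-(κ ^ 2 * t) / 8)
  have hp2 := Real.exp_pos (-t / 8)
  refine ⟨?_, ?_, ?_⟩
  -- Every coefficient of the slow mode is of order κ: `Z 0` by hypothesis, the others because s and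
  -- κ² are.
  · have hA : ‖-Z 0 + s * Y 0 + (κ ^ 2 + s ^ 2) * X 0‖ ≤ 6 * (κ * N) := by
      have := lin (a := κ ^ 2 + s ^ 2) (b := s) (c := -1)
        (v := -Z 0 + s * Y 0 + (κ ^ 2 + s ^ 2) * X 0) (A := 3 * κ) (B := 2 * κ) (C := 1)
        (by push_cast; ring) (by rw [abs_of_nonneg (by positivity)]; nlinarith)
        (by rw [abs_of_pos hs0]; linarith) (by simp)
      linarith
    have hB1 : ‖Y 0 - Z 0 - s * (X 0 + Y 0)‖ ≤ 3 * N := by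
      have := lin (a := -s) (b := 1 - s) (c := -1)
        (v := Y 0 - Z 0 - s * (X 0 + Y 0)) (A := 1) (B := 1) (C := 1)
        (by push_cast; ring) (by rw [abs_neg, abs_of_pos hs0]; linarith)
        (by rw [abs_of_pos (by linarith)]; linarith) (by simp)
      linarith
    have hB2 : ‖-X 0 - Y 0 + s * X 0‖ ≤ 2 * N := by
      have := lin (a := s - 1) (b := -1) (c := 0)
        (v := -X 0 - Y 0 + s * X 0) (A := 1) (B := 1) (C := 0)
        (by push_cast; ring) (by rw [abs_of_neg (by linarith)]; linarith) (by simp) (by simp)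
      linarith
    have hB := add_le_add hB1 (mul_le_mul hroot (mul_le_mul_of_nonneg_left hB2 two_pos.le)
      (by positivity) two_pos.le)
    have := fin (norm_nonneg _) (combine_bound (h.bound_X hκ hs0 hs1 hs t) hE₁ hE₂
      (norm_nonneg _) (by positivity)) hA hB
    nlinarith [mul_nonneg hp1.le hκN0, mul_nonneg hp2.le hN]
  · have hA : ‖-(s * X 0) + (s ^ 2 - s) * Y 0 + (1 - s) * Z 0‖ ≤ 6 * (κ * N) := by
      have := lin (a := -s) (b := s ^ 2 - s) (c := 1 - s)
        (v := -(s * X 0) + (s ^ 2 - s) * Y 0 + (1 - s) * Z 0) (A := 2 * κ) (B := 2 * κ) (C := 1)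
        (by push_cast; ring) (by rw [abs_neg, abs_of_pos hs0]; linarith)
        (by rw [abs_of_nonpos (by nlinarith)]; nlinarith)
        (by rw [abs_of_pos (by linarith)]; linarith)
      linarith
    have hB1 : ‖-X 0 - Y 0 - κ ^ 2 * Y 0 + s * (X 0 + Z 0)‖ ≤ 4 * N := by
      have := lin (a := s - 1) (b := -(1 + κ ^ 2)) (c := s)
        (v := -X 0 - Y 0 - κ ^ 2 * Y 0 + s * (X 0 + Z 0)) (A := 1) (B := 2) (C := 1)
        (by push_cast; ring) (by rw [abs_of_neg (by linarith)]; linarith)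
        (by rw [abs_neg, abs_of_pos (by positivity)]; linarith)
        (by rw [abs_of_pos (by linarith)]; linarith)
      linarith
    have hB2 : ‖X 0 + Z 0 + s * Y 0‖ ≤ 3 * N := by
      have := lin (a := 1) (b := s) (c := 1)
        (v := X 0 + Z 0 + s * Y 0) (A := 1) (B := 1) (C := 1)
        (by push_cast; ring) (by simp) (by rw [abs_of_pos hs0]; linarith) (by simp)
      linarith
    have hB := add_le_add hB1 (mul_le_mul hroot (mul_le_mul_of_nonneg_left hB2 two_pos.le)
      (by positivity) two_pos.le)
    have := fin (norm_nonneg _) (combine_bound (h.bound_Y hκ hs0 hs1 hs t) hE₁ hE₂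
      (norm_nonneg _) (by positivity)) hA hB
    nlinarith [mul_nonneg hp1.le hκN0, mul_nonneg hp2.le hN]
  · have hA : ‖-(κ ^ 2 * X 0) - (1 - s) * κ ^ 2 * Y 0 + (1 - s + s ^ 2) * Z 0‖ ≤
        3 * (κ * N) := by
      have := lin (a := -κ ^ 2) (b := -((1 - s) * κ ^ 2)) (c := 1 - s + s ^ 2)
        (v := -(κ ^ 2 * X 0) - (1 - s) * κ ^ 2 * Y 0 + (1 - s + s ^ 2) * Z 0)
        (A := κ) (B := κ) (C := 1)
        (by push_cast; ring) (by rw [abs_neg, abs_of_nonneg (by positivity)]; linarith)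
        (by rw [abs_neg, abs_of_nonneg (mul_nonneg (by linarith) (by positivity))]; nlinarith)
        (by rw [abs_of_pos (by nlinarith)]; nlinarith)
      linarith
    have hB1 : ‖-(κ ^ 2 * (X 0 + Z 0)) - s * κ ^ 2 * Y 0‖ ≤ 3 * (κ * N) := by
      have := lin (a := -κ ^ 2) (b := -(s * κ ^ 2)) (c := -κ ^ 2)
        (v := -(κ ^ 2 * (X 0 + Z 0)) - s * κ ^ 2 * Y 0) (A := κ) (B := κ) (C := 1)
        (by push_cast; ring) (by rw [abs_neg, abs_of_nonneg (by positivity)]; linarith)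
        (by rw [abs_neg, abs_of_nonneg (by positivity)]; nlinarith)
        (by rw [abs_neg, abs_of_nonneg (by positivity)]; linarith)
      linarith
    have hB2 : ‖-(κ ^ 2 * Y 0) + s * Z 0‖ ≤ 2 * (κ * N) := by
      have := lin (a := 0) (b := -κ ^ 2) (c := s)
        (v := -(κ ^ 2 * Y 0) + s * Z 0) (A := 0) (B := κ) (C := 1)
        (by push_cast; ring) (by simp) (by rw [abs_neg, abs_of_nonneg (by positivity)]; linarith)
        (by rw [abs_of_pos hs0]; linarith)
      linarith
    have hB := add_le_add hB1 (mul_le_mul hroot (mul_le_mul_of_nonneg_left hB2 two_pos.le)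
      (by positivity) two_pos.le)
    have := fin (norm_nonneg _) (combine_bound (h.bound_Z hκ hs0 hs1 hs t) hE₁ hE₂
      (norm_nonneg _) (by positivity)) hA hB
    nlinarith [mul_nonneg hp1.le hκN0, mul_nonneg hp2.le hκN0,
      mul_le_mul_of_nonneg_right hE₃ hκN0]

set_option maxHeartbeats 2000000 in
/-- Decay of the transverse part at high frequencies. -/
theorem high_frequency_bound (h : TransverseSystem κ X Y Z) (hκ1 : 1 ≤ κ) {N : ℝ}
    (hXN : ‖X 0‖ ≤ N) (hYN : ‖Y 0‖ ≤ N) (hZN : ‖Z 0‖ ≤ κ * N) {t : ℝ} (ht : 0 ≤ t) :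
    ‖X t‖ ≤ 100 * (Real.exp (-t / 8) + κ⁻¹ * Real.exp (-(t / κ ^ 2) / 8)) * N ∧
    ‖Y t‖ ≤ 100 * Real.exp (-(t / κ ^ 2) / 8) * N ∧
    ‖Z t‖ ≤ κ * (100 * Real.exp (-(t / κ ^ 2) / 8) * N) := by
  have hκ : 0 < κ := by linarith
  obtain ⟨s, hs0, hs1, hs⟩ := exists_transverse_root (q := κ ^ 2) (by positivity)
  have hq1 : κ ≤ κ ^ 2 := by nlinarith
  have hslow : 1 / 2 ≤ s := by nlinarith
  -- The root equation reads (1-s)κ² = s(1-s+s²), and the right side is at least 1/2 · 3/4. The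
  -- oscillating pair is thus damped at a rate no worse than a multiple of κ^{-2}, the regularity
  -- loss.
  have ha : 1 / 4 / κ ^ 2 ≤ 1 - s := by
    rw [div_le_iff₀ (by positivity)]
    nlinarith [sq_nonneg (2 * s - 1)]
  have htq : t / κ ^ 2 ≤ t := div_le_self ht (by nlinarith)
  have hE₁ : Real.exp (-(s * t)) ≤ Real.exp (-t / 8) :=
    Real.exp_le_exp.2 (by nlinarith)
  have hE₂ : Real.exp (-((1 - s) / 2 * t)) ≤ Real.exp (-(t / κ ^ 2) / 8) := by
    refine Real.exp_le_exp.2 ?_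
    have := mul_le_mul_of_nonneg_right ha ht
    have e : 1 / 4 / κ ^ 2 * t = 1 / 4 * (t / κ ^ 2) := by ring
    linarith
  have hE₃ : Real.exp (-t / 8) ≤ Real.exp (-(t / κ ^ 2) / 8) :=
    Real.exp_le_exp.2 (by linarith)
  have hN : 0 ≤ N := (norm_nonneg _).trans hXN
  have hκN : N ≤ κ * N := le_mul_of_one_le_left hN hκ1
  have hκN0 : 0 ≤ κ * N := mul_nonneg hκ.le hN
  have hqN : κ * N ≤ κ ^ 2 * N := mul_le_mul_of_nonneg_right hq1 hN
  have hqN0 : 0 ≤ κ ^ 2 * N := by positivity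
  have hroot : (1 + κ ^ 2) ^ (1 / 2 : ℝ) ≤ 2 * κ := by
    rw [← Real.sqrt_eq_rpow]; exact Real.sqrt_le_iff.2 ⟨by positivity, by nlinarith⟩
  have hroot0 : 0 ≤ (1 + κ ^ 2) ^ (1 / 2 : ℝ) := by positivity
  have lin : ∀ {a b c A B C : ℝ} {v : ℂ}, v = (a : ℂ) * X 0 + b * Y 0 + c * Z 0 → |a| ≤ A →
      |b| ≤ B → |c| ≤ C → ‖v‖ ≤ A * N + B * N + C * (κ * N) := by
    intro a b c A B C v hv ha hb hc
    rw [hv]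
    refine (norm_linear_comb_le _ _ _ _ _ _).trans ?_
    exact add_le_add (add_le_add (mul_le_mul ha hXN (norm_nonneg _) ((abs_nonneg _).trans ha))
      (mul_le_mul hb hYN (norm_nonneg _) ((abs_nonneg _).trans hb)))
      (mul_le_mul hc hZN (norm_nonneg _) ((abs_nonneg _).trans hc))
  have fin : ∀ {u A B F D : ℝ}, 0 ≤ u → (2 / 3 + κ ^ 2) * u ≤
      Real.exp (-t / 8) * A + 3 * Real.exp (-(t / κ ^ 2) / 8) * B → A ≤ κ ^ 2 * F →
      B ≤ κ ^ 2 * D → u ≤ Real.exp (-t / 8) * F + 3 * Real.exp (-(t / κ ^ 2) / 8) * D := by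
    intro u A B F D hu hb hA hB
    have h1 := mul_le_mul_of_nonneg_left hA (Real.exp_pos (-t / 8)).le
    have h2 := mul_le_mul_of_nonneg_left hB (Real.exp_pos (-(t / κ ^ 2) / 8)).le
    have h3 : κ ^ 2 * u ≤
        κ ^ 2 * (Real.exp (-t / 8) * F + 3 * Real.exp (-(t / κ ^ 2) / 8) * D) := by linarith
    exact le_of_mul_le_mul_left h3 (by positivity)
  have hp1 := Real.exp_pos (-(t / κ ^ 2) / 8)
  have hp2 := Real.exp_pos (-t / 8)
  refine ⟨?_, ?_, ?_⟩
  · have hA : ‖-Z 0 + s * Y 0 + (κ ^ 2 + s ^ 2) * X 0‖ ≤ κ ^ 2 * (4 * N) := by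
      have := lin (a := κ ^ 2 + s ^ 2) (b := s) (c := -1)
        (v := -Z 0 + s * Y 0 + (κ ^ 2 + s ^ 2) * X 0) (A := 2 * κ ^ 2) (B := 1) (C := 1)
        (by push_cast; ring) (by rw [abs_of_nonneg (by positivity)]; nlinarith)
        (by rw [abs_of_pos hs0]; linarith) (by simp)
      linarith
    have hB1 : ‖Y 0 - Z 0 - s * (X 0 + Y 0)‖ ≤ 3 * (κ * N) := by
      have := lin (a := -s) (b := 1 - s) (c := -1)
        (v := Y 0 - Z 0 - s * (X 0 + Y 0)) (A := 1) (B := 1) (C := 1)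
        (by push_cast; ring) (by rw [abs_neg, abs_of_pos hs0]; linarith)
        (by rw [abs_of_pos (by linarith)]; linarith) (by simp)
      linarith
    have hB2 : ‖-X 0 - Y 0 + s * X 0‖ ≤ 2 * N := by
      have := lin (a := s - 1) (b := -1) (c := 0)
        (v := -X 0 - Y 0 + s * X 0) (A := 1) (B := 1) (C := 0)
        (by push_cast; ring) (by rw [abs_of_neg (by linarith)]; linarith) (by simp) (by simp)
      linarith
    have hB := add_le_add hB1 (mul_le_mul hroot (mul_le_mul_of_nonneg_left hB2 two_pos.le)
      (by positivity) (by positivity))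
    -- The oscillating part of `X` has amplitude of order κN before division by κ², so velocity
    -- gains a factor 1/κ at high frequencies; the corresponding part of `Y` is of order κ²N and
    -- gains nothing.
    have e : 3 * (κ * N) + 2 * κ * (2 * (2 * N)) = κ ^ 2 * (11 * (κ⁻¹ * N)) := by
      field_simp; ring
    have := fin (norm_nonneg _) (combine_bound (h.bound_X hκ hs0 hs1 hs t) hE₁ hE₂
      (norm_nonneg _) (by positivity)) hA (hB.trans_eq e)
    have hκi : 0 ≤ κ⁻¹ * N := by positivity
    nlinarith [mul_nonneg hp1.le hκi, mul_nonneg hp2.le hN]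
  · have hA : ‖-(s * X 0) + (s ^ 2 - s) * Y 0 + (1 - s) * Z 0‖ ≤ κ ^ 2 * (3 * N) := by
      have := lin (a := -s) (b := s ^ 2 - s) (c := 1 - s)
        (v := -(s * X 0) + (s ^ 2 - s) * Y 0 + (1 - s) * Z 0) (A := 1) (B := 1) (C := 1)
        (by push_cast; ring) (by rw [abs_neg, abs_of_pos hs0]; linarith)
        (by rw [abs_of_nonpos (by nlinarith)]; nlinarith)
        (by rw [abs_of_pos (by linarith)]; linarith)
      linarith
    have hB1 : ‖-X 0 - Y 0 - κ ^ 2 * Y 0 + s * (X 0 + Z 0)‖ ≤ 4 * (κ ^ 2 * N) := by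
      have := lin (a := s - 1) (b := -(1 + κ ^ 2)) (c := s)
        (v := -X 0 - Y 0 - κ ^ 2 * Y 0 + s * (X 0 + Z 0)) (A := 1) (B := 2 * κ ^ 2) (C := 1)
        (by push_cast; ring) (by rw [abs_of_neg (by linarith)]; linarith)
        (by rw [abs_neg, abs_of_pos (by positivity)]; linarith)
        (by rw [abs_of_pos (by linarith)]; linarith)
      linarith
    have hB2 : ‖X 0 + Z 0 + s * Y 0‖ ≤ 3 * (κ * N) := by
      have := lin (a := 1) (b := s) (c := 1)
        (v := X 0 + Z 0 + s * Y 0) (A := 1) (B := 1) (C := 1)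
        (by push_cast; ring) (by simp) (by rw [abs_of_pos hs0]; linarith) (by simp)
      linarith
    have hB := add_le_add hB1 (mul_le_mul hroot (mul_le_mul_of_nonneg_left hB2 two_pos.le)
      (by positivity) (by positivity))
    have e : 4 * (κ ^ 2 * N) + 2 * κ * (2 * (3 * (κ * N))) = κ ^ 2 * (16 * N) := by ring
    have := fin (norm_nonneg _) (combine_bound (h.bound_Y hκ hs0 hs1 hs t) hE₁ hE₂
      (norm_nonneg _) (by positivity)) hA (hB.trans_eq e)
    nlinarith [mul_nonneg hp1.le hN, mul_le_mul_of_nonneg_right hE₃ hN]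
  · have hA : ‖-(κ ^ 2 * X 0) - (1 - s) * κ ^ 2 * Y 0 + (1 - s + s ^ 2) * Z 0‖ ≤
        κ ^ 2 * (3 * (κ * N)) := by
      have := lin (a := -κ ^ 2) (b := -((1 - s) * κ ^ 2)) (c := 1 - s + s ^ 2)
        (v := -(κ ^ 2 * X 0) - (1 - s) * κ ^ 2 * Y 0 + (1 - s + s ^ 2) * Z 0)
        (A := κ ^ 2) (B := κ ^ 2) (C := 1)
        (by push_cast; ring) (by rw [abs_neg, abs_of_nonneg (by positivity)])
        (by rw [abs_neg, abs_of_nonneg (mul_nonneg (by linarith) (by positivity))]; nlinarith)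
        (by rw [abs_of_pos (by nlinarith)]; nlinarith)
      have h1 := mul_le_mul_of_nonneg_left hκN (by positivity : 0 ≤ κ ^ 2)
      have h2 : κ * N ≤ κ ^ 2 * (κ * N) := le_mul_of_one_le_left hκN0 (by nlinarith)
      linarith
    have hB1 : ‖-(κ ^ 2 * (X 0 + Z 0)) - s * κ ^ 2 * Y 0‖ ≤ 3 * (κ ^ 2 * (κ * N)) := by
      have := lin (a := -κ ^ 2) (b := -(s * κ ^ 2)) (c := -κ ^ 2)
        (v := -(κ ^ 2 * (X 0 + Z 0)) - s * κ ^ 2 * Y 0) (A := κ ^ 2) (B := κ ^ 2) (C := κ ^ 2)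
        (by push_cast; ring) (by rw [abs_neg, abs_of_nonneg (by positivity)])
        (by rw [abs_neg, abs_of_nonneg (by positivity)]; nlinarith)
        (by rw [abs_neg, abs_of_nonneg (by positivity)])
      have h1 := mul_le_mul_of_nonneg_left hκN (by positivity : 0 ≤ κ ^ 2)
      linarith
    have hB2 : ‖-(κ ^ 2 * Y 0) + s * Z 0‖ ≤ 2 * (κ ^ 2 * N) := by
      have := lin (a := 0) (b := -κ ^ 2) (c := s)
        (v := -(κ ^ 2 * Y 0) + s * Z 0) (A := 0) (B := κ ^ 2) (C := 1)
        (by push_cast; ring) (by simp) (by rw [abs_neg, abs_of_nonneg (by positivity)])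
        (by rw [abs_of_pos hs0]; linarith)
      linarith
    have hB := add_le_add hB1 (mul_le_mul hroot (mul_le_mul_of_nonneg_left hB2 two_pos.le)
      (by positivity) (by positivity))
    have e : 3 * (κ ^ 2 * (κ * N)) + 2 * κ * (2 * (2 * (κ ^ 2 * N))) =
        κ ^ 2 * (11 * (κ * N)) := by ring
    have := fin (norm_nonneg _) (combine_bound (h.bound_Z hκ hs0 hs1 hs t) hE₁ hE₂
      (norm_nonneg _) (by positivity)) hA (hB.trans_eq e)
    nlinarith [mul_nonneg hp1.le hκN0, mul_le_mul_of_nonneg_right hE₃ hκN0]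

end TransverseSystem

end FrequencyODE

/-! ### Pointwise bounds of the solution at each frequency -/

section PointwiseBounds

/-- The decay profile of the Euler-Maxwell system at a frequency of modulus `κ`. -/
noncomputable def decayProfile (a b : ℕ) (t κ : ℝ) : ℝ :=
  Real.exp (-t / 8) + if κ ≤ 1 then κ ^ a * Real.exp (-(κ ^ 2 * t) / 8)
    else (κ⁻¹) ^ b * Real.exp (-(t / κ ^ 2) / 8)

theorem exp_le_decayProfile (a b : ℕ) {t κ : ℝ} (ht : 0 ≤ t) (hκ : 0 < κ) :
    Real.exp (-t / 2) ≤ decayProfile a b t κ := by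
  have h1 : Real.exp (-t / 2) ≤ Real.exp (-t / 8) := Real.exp_le_exp.2 (by linarith)
  refine h1.trans (le_add_of_nonneg_right ?_)
  split_ifs <;> positivity

/-- The low and high frequency bounds are merged into one profile. The hypothesis on `Z 0` carries a
factor κ because `Z` will be a component of the curl of the magnetic field. -/
theorem TransverseSystem.norm_le {κ : ℝ} {X Y Z : ℝ → ℂ} (h : TransverseSystem κ X Y Z)
    (hκ : 0 < κ) {N : ℝ} (hX : ‖X 0‖ ≤ N) (hY : ‖Y 0‖ ≤ N) (hZ : ‖Z 0‖ ≤ κ * N) {t : ℝ}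
    (ht : 0 ≤ t) :
    ‖X t‖ ≤ 100 * decayProfile 1 1 t κ * N ∧ ‖Y t‖ ≤ 100 * decayProfile 1 0 t κ * N ∧
      ‖Z t‖ ≤ κ * (100 * decayProfile 0 0 t κ * N) := by
  have hN : 0 ≤ N := (norm_nonneg _).trans hX
  have h8 := (Real.exp_pos (-t / 8)).le
  unfold decayProfile
  split_ifs with h1
  · obtain ⟨bX, bY, bZ⟩ := h.low_frequency_bound hκ h1 hX hY hZ ht
    refine ⟨by simpa using bX, by simpa using bY, bZ.trans ?_⟩
    gcongr
    simpa using h8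
  · obtain ⟨bX, bY, bZ⟩ := h.high_frequency_bound (not_le.1 h1).le hX hY hZ ht
    refine ⟨by simpa using bX, bY.trans ?_, bZ.trans ?_⟩ <;>
    · gcongr
      simpa using h8

/-- The density, the divergence of the velocity and the temperature at a frequency of modulus
`κ`. -/
structure LongitudinalSystem (κ : ℝ) (ρ d Θ : ℝ → ℂ) : Prop where
  hρ : ∀ t, HasDerivAt ρ (-d t) t
  hd : ∀ t, HasDerivAt d ((1 + (κ : ℂ) ^ 2) * ρ t + (κ : ℂ) ^ 2 * Θ t - d t) t
  hΘ : ∀ t, HasDerivAt Θ (-(2 / 3 * d t) - Θ t) t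

namespace LongitudinalSystem

variable {κ : ℝ} {ρ d Θ : ℝ → ℂ}

theorem norm_linear_comb_le (a b c : ℝ) (u v w : ℂ) {A B C : ℝ} {z : ℂ}
    (hz : z = a * u + b * v + c * w) (ha : |a| ≤ A) (hb : |b| ≤ B) (hc : |c| ≤ C) :
    ‖z‖ ≤ A * ‖u‖ + B * ‖v‖ + C * ‖w‖ := by
  rw [hz]
  refine (_root_.norm_linear_comb_le _ _ _ _ _ _).trans ?_
  gcongr

/-- Each longitudinal unknown solves the same third order equation, by elimination of the other two.
The weight w = (1 + κ²)^{1/2} measures derivatives in time, and the remaining work is to express the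
initial derivatives through the data. -/
theorem bound_rho {w : ℝ} (h : LongitudinalSystem κ ρ d Θ) (hw : 1 ≤ w)
    (hw2 : w ^ 2 = 1 + κ ^ 2) {t : ℝ} (ht : 0 ≤ t) :
    w ^ 2 * ‖ρ t‖ ≤
      42 * Real.exp (-t / 2) * (w ^ 2 * ‖ρ 0‖ + w * ‖d 0‖ + κ ^ 2 * ‖Θ 0‖) := by
  have := longitudinal_third_order_bound (q := κ ^ 2) (w := w) (f := ρ) (f₁ := fun t => -d t)
    (f₂ := fun t => -((1 + (κ : ℂ) ^ 2) * ρ t + (κ : ℂ) ^ 2 * Θ t - d t)) (sq_nonneg κ)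
    (by linarith) hw2 h.hρ (fun t => (h.hd t).neg)
    (fun t => ((((h.hρ t).const_mul (1 + (κ : ℂ) ^ 2)).add ((h.hΘ t).const_mul ((κ : ℂ) ^ 2))).sub
      (h.hd t)).neg.congr_deriv (by push_cast; ring)) ht
  have h2 := norm_linear_comb_le (-w ^ 2) 1 (-κ ^ 2) (ρ 0) (d 0) (Θ 0) (A := w ^ 2) (B := w)
    (C := κ ^ 2) (z := -((1 + (κ : ℂ) ^ 2) * ρ 0 + (κ : ℂ) ^ 2 * Θ 0 - d 0))
    (by rw [hw2]; push_cast; ring) (by simp) (by simpa using hw) (by simp)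
  rw [norm_neg] at this
  refine this.trans ?_
  rw [show (42 : ℝ) = 21 * 2 by norm_num, mul_right_comm 21 (2 : ℝ), mul_assoc _ (2 : ℝ)]
  have : 0 ≤ κ ^ 2 * ‖Θ 0‖ := by positivity
  gcongr
  linarith

theorem bound_d {w : ℝ} (h : LongitudinalSystem κ ρ d Θ) (hw : 1 ≤ w)
    (hw2 : w ^ 2 = 1 + κ ^ 2) {t : ℝ} (ht : 0 ≤ t) :
    w ^ 2 * ‖d t‖ ≤ 105 * Real.exp (-t / 2) *
      (w ^ 2 * ‖d 0‖ + w ^ 2 * w * ‖ρ 0‖ + w * κ ^ 2 * ‖Θ 0‖) := by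
  have := longitudinal_third_order_bound (q := κ ^ 2) (w := w) (f := d)
    (f₁ := fun t => (1 + (κ : ℂ) ^ 2) * ρ t + (κ : ℂ) ^ 2 * Θ t - d t)
    (f₂ := fun t => -((1 + (κ : ℂ) ^ 2) * d t) + (κ : ℂ) ^ 2 * (-(2 / 3 * d t) - Θ t) -
      ((1 + (κ : ℂ) ^ 2) * ρ t + (κ : ℂ) ^ 2 * Θ t - d t)) (sq_nonneg κ)
    (by linarith) hw2 h.hd
    (fun t => ((((h.hρ t).const_mul (1 + (κ : ℂ) ^ 2)).add ((h.hΘ t).const_mul ((κ : ℂ) ^ 2))).sub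
      (h.hd t)).congr_deriv (by ring))
    (fun t => (((((h.hd t).const_mul (1 + (κ : ℂ) ^ 2)).neg).add
      ((((h.hd t).const_mul (2 / 3 : ℂ)).neg.sub (h.hΘ t)).const_mul ((κ : ℂ) ^ 2))).sub
      ((((h.hρ t).const_mul (1 + (κ : ℂ) ^ 2)).add ((h.hΘ t).const_mul ((κ : ℂ) ^ 2))).sub
      (h.hd t))).congr_deriv (by push_cast; ring)) ht
  have hww : w ≤ w ^ 2 := by nlinarith
  have h1 := norm_linear_comb_le (w ^ 2) (-1) (κ ^ 2) (ρ 0) (d 0) (Θ 0) (A := w ^ 2) (B := 1)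
    (C := κ ^ 2) (z := (1 + (κ : ℂ) ^ 2) * ρ 0 + (κ : ℂ) ^ 2 * Θ 0 - d 0)
    (by rw [hw2]; push_cast; ring) (by simp) (by simp) (by simp)
  have h2 := norm_linear_comb_le (-w ^ 2) (-(5 / 3) * κ ^ 2) (-2 * κ ^ 2) (ρ 0) (d 0) (Θ 0)
    (A := w ^ 2) (B := 2 * w ^ 2) (C := 2 * κ ^ 2)
    (z := -((1 + (κ : ℂ) ^ 2) * d 0) + (κ : ℂ) ^ 2 * (-(2 / 3 * d 0) - Θ 0) -
      ((1 + (κ : ℂ) ^ 2) * ρ 0 + (κ : ℂ) ^ 2 * Θ 0 - d 0))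
    (by rw [hw2]; push_cast; ring) (by simp)
    (by rw [abs_mul, abs_of_nonneg (sq_nonneg κ), abs_neg, abs_of_pos (by norm_num)]
        nlinarith [sq_nonneg κ])
    (by rw [abs_mul, abs_of_nonneg (sq_nonneg κ), abs_neg, abs_of_pos (by norm_num)])
  refine this.trans ?_
  rw [show (105 : ℝ) = 21 * 5 by norm_num, mul_right_comm 21 (5 : ℝ), mul_assoc _ (5 : ℝ)]
  gcongr ?_ * ?_
  have e1 := mul_le_mul_of_nonneg_left h1 (by linarith : 0 ≤ w)
  have e2 := mul_le_mul_of_nonneg_right hww (norm_nonneg (d 0))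
  have e3 : w ^ 2 * ‖ρ 0‖ ≤ w ^ 2 * w * ‖ρ 0‖ := by
    gcongr; exact le_mul_of_one_le_right (sq_nonneg w) hw
  have e4 : κ ^ 2 * ‖Θ 0‖ ≤ w * κ ^ 2 * ‖Θ 0‖ := by
    gcongr; exact le_mul_of_one_le_left (sq_nonneg κ) hw
  have e5 : 0 ≤ w ^ 2 * ‖ρ 0‖ := by positivity
  have e6 : 0 ≤ κ ^ 2 * ‖Θ 0‖ := by positivity
  have e7 : 0 ≤ w ^ 2 * ‖d 0‖ := by positivity
  ring_nf at e1 e2 e3 e4 e5 e6 e7 h2 ⊢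
  linarith

theorem bound_theta {w : ℝ} (h : LongitudinalSystem κ ρ d Θ) (hw : 1 ≤ w)
    (hw2 : w ^ 2 = 1 + κ ^ 2) {t : ℝ} (ht : 0 ≤ t) :
    w ^ 2 * ‖Θ t‖ ≤
      63 * Real.exp (-t / 2) * (w ^ 2 * ‖ρ 0‖ + w * ‖d 0‖ + w ^ 2 * ‖Θ 0‖) := by
  have := longitudinal_third_order_bound (q := κ ^ 2) (w := w) (f := Θ)
    (f₁ := fun t => -(2 / 3 * d t) - Θ t)
    (f₂ := fun t => -(2 / 3 * ((1 + (κ : ℂ) ^ 2) * ρ t + (κ : ℂ) ^ 2 * Θ t - d t)) -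
      (-(2 / 3 * d t) - Θ t)) (sq_nonneg κ)
    (by linarith) hw2 h.hΘ
    (fun t => (((h.hd t).const_mul (2 / 3 : ℂ)).neg.sub (h.hΘ t)).congr_deriv (by ring))
    (fun t => ((((((h.hρ t).const_mul (1 + (κ : ℂ) ^ 2)).add
      ((h.hΘ t).const_mul ((κ : ℂ) ^ 2))).sub (h.hd t)).const_mul (2 / 3 : ℂ)).neg.sub
      (((h.hd t).const_mul (2 / 3 : ℂ)).neg.sub (h.hΘ t))).congr_deriv (by push_cast; ring)) ht
  have hww : w ≤ w ^ 2 := by nlinarith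
  have h1 := norm_linear_comb_le 0 (-(2 / 3)) (-1) (ρ 0) (d 0) (Θ 0) (A := 0) (B := 1)
    (C := 1) (z := -(2 / 3 * d 0) - Θ 0)
    (by push_cast; ring) (by simp) (by rw [abs_neg, abs_of_pos] <;> norm_num) (by simp)
  have h2 := norm_linear_comb_le (-(2 / 3) * w ^ 2) (4 / 3) (1 - 2 / 3 * κ ^ 2) (ρ 0) (d 0) (Θ 0)
    (A := w ^ 2) (B := 2 * w) (C := w ^ 2)
    (z := -(2 / 3 * ((1 + (κ : ℂ) ^ 2) * ρ 0 + (κ : ℂ) ^ 2 * Θ 0 - d 0)) -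
      (-(2 / 3 * d 0) - Θ 0))
    (by rw [hw2]; push_cast; ring)
    (by rw [abs_mul, abs_of_nonneg (sq_nonneg w), abs_neg, abs_of_pos (by norm_num)]
        nlinarith [sq_nonneg w])
    (by rw [abs_of_pos (by norm_num)]; linarith)
    (abs_le.2 ⟨by nlinarith [sq_nonneg κ], by nlinarith [sq_nonneg κ]⟩)
  refine this.trans ?_
  rw [show (63 : ℝ) = 21 * 3 by norm_num, mul_right_comm 21 (3 : ℝ), mul_assoc _ (3 : ℝ)]
  gcongr ?_ * ?_
  have e1 := mul_le_mul_of_nonneg_left h1 (by linarith : 0 ≤ w)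
  have e2 := mul_le_mul_of_nonneg_right hww (norm_nonneg (Θ 0))
  have e5 : 0 ≤ w ^ 2 * ‖ρ 0‖ := by positivity
  ring_nf at e1 e2 e5 h2 ⊢
  linarith

variable {U : ℝ}

/-- The divergence carries a factor κ ≤ w, and this absorbs the weight imbalance: no derivatives are
lost. -/
theorem norm_le (h : LongitudinalSystem κ ρ d Θ) (hκ : 0 < κ) (hU : ‖d 0‖ ≤ κ * U) {t : ℝ}
    (ht : 0 ≤ t) :
    ‖ρ t‖ ≤ 63 * Real.exp (-t / 2) * (‖ρ 0‖ + U + ‖Θ 0‖) ∧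
      ‖Θ t‖ ≤ 63 * Real.exp (-t / 2) * (‖ρ 0‖ + U + ‖Θ 0‖) := by
  obtain ⟨w, hw0, hw2⟩ : ∃ w : ℝ, 0 ≤ w ∧ w ^ 2 = 1 + κ ^ 2 :=
    ⟨√(1 + κ ^ 2), Real.sqrt_nonneg _, Real.sq_sqrt (by positivity)⟩
  have hw : 1 ≤ w := by nlinarith
  have hκw : κ ≤ w := by nlinarith
  have hU0 : 0 ≤ U := by
    by_contra hn
    have := mul_neg_of_pos_of_neg hκ (not_le.1 hn)
    linarith [norm_nonneg (d 0)]
  have hd : w * ‖d 0‖ ≤ w ^ 2 * U := by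
    have : κ * U ≤ w * U := by gcongr
    rw [pow_two, mul_assoc]
    gcongr
    linarith
  have hΘ : κ ^ 2 * ‖Θ 0‖ ≤ w ^ 2 * ‖Θ 0‖ := by gcongr
  have he := (Real.exp_pos (-t / 2)).le
  have hw20 : 0 < w ^ 2 := by positivity
  constructor
  · refine le_of_mul_le_mul_left ((h.bound_rho hw hw2 ht).trans ?_) hw20
    have : w ^ 2 * ‖ρ 0‖ + w * ‖d 0‖ + κ ^ 2 * ‖Θ 0‖ ≤ w ^ 2 * (‖ρ 0‖ + U + ‖Θ 0‖) := by linarith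
    rw [mul_left_comm (w ^ 2)]
    gcongr
    norm_num
  · refine le_of_mul_le_mul_left ((h.bound_theta hw hw2 ht).trans ?_) hw20
    have : w ^ 2 * ‖ρ 0‖ + w * ‖d 0‖ + w ^ 2 * ‖Θ 0‖ ≤ w ^ 2 * (‖ρ 0‖ + U + ‖Θ 0‖) := by linarith
    rw [mul_left_comm (w ^ 2)]
    gcongr

/-- The longitudinal electric field has the size of ρ/κ, so the bound on the density must come with
a factor κ. For the initial density this is the hypothesis on `V`, supplied later by the electric
field through ∇·E = -ρ; for the temperature it is κ ≤ 1 + κ². -/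
theorem norm_rho_le (h : LongitudinalSystem κ ρ d Θ) (hκ : 0 < κ) (hU : ‖d 0‖ ≤ κ * U) {V : ℝ}
    (hV : ‖ρ 0‖ ≤ κ * V) {t : ℝ} (ht : 0 ≤ t) :
    ‖ρ t‖ ≤ κ * (42 * Real.exp (-t / 2) * (V + U + ‖Θ 0‖)) := by
  obtain ⟨w, hw0, hw2⟩ : ∃ w : ℝ, 0 ≤ w ∧ w ^ 2 = 1 + κ ^ 2 :=
    ⟨√(1 + κ ^ 2), Real.sqrt_nonneg _, Real.sq_sqrt (by positivity)⟩
  have hw : 1 ≤ w := by nlinarith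
  have hww : w ≤ w ^ 2 := by nlinarith
  have hU0 : 0 ≤ κ * U := (norm_nonneg _).trans hU
  have hd : w * ‖d 0‖ ≤ w ^ 2 * (κ * U) := by gcongr
  have hΘ : κ ^ 2 * ‖Θ 0‖ ≤ w ^ 2 * (κ * ‖Θ 0‖) := by
    rw [← mul_assoc]
    gcongr
    nlinarith [sq_nonneg (κ - 1), mul_pos hκ (sq_pos_of_pos hκ)]
  have hw20 : 0 < w ^ 2 := by positivity
  refine le_of_mul_le_mul_left ((h.bound_rho hw hw2 ht).trans ?_) hw20
  have : w ^ 2 * ‖ρ 0‖ + w * ‖d 0‖ + κ ^ 2 * ‖Θ 0‖ ≤ w ^ 2 * (κ * (V + U + ‖Θ 0‖)) := by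
    have := mul_le_mul_of_nonneg_left hV hw20.le
    linarith
  rw [mul_left_comm κ, mul_left_comm (w ^ 2)]
  gcongr

/-- The longitudinal velocity has the size of d/κ, so again a factor κ is extracted. With w ≤ 1 + κ
the term w‖ρ(0)‖ splits: the part without κ is paid for by `V`, the part with κ by the density
itself. -/
theorem norm_d_le (h : LongitudinalSystem κ ρ d Θ) (hκ : 0 < κ) (hU : ‖d 0‖ ≤ κ * U) {V : ℝ}
    (hV : ‖ρ 0‖ ≤ κ * V) {t : ℝ} (ht : 0 ≤ t) :
    ‖d t‖ ≤ κ * (210 * Real.exp (-t / 2) * (U + V + ‖ρ 0‖ + ‖Θ 0‖)) := by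
  obtain ⟨w, hw0, hw2⟩ : ∃ w : ℝ, 0 ≤ w ∧ w ^ 2 = 1 + κ ^ 2 :=
    ⟨√(1 + κ ^ 2), Real.sqrt_nonneg _, Real.sq_sqrt (by positivity)⟩
  have hw : 1 ≤ w := by nlinarith
  have hκw : κ ≤ w := by nlinarith
  have hw1 : w ≤ 1 + κ := by nlinarith
  have hw20 : 0 < w ^ 2 := by positivity
  have hU0 : 0 ≤ κ * U := (norm_nonneg _).trans hU
  have hV0 : 0 ≤ κ * V := (norm_nonneg _).trans hV
  have hρ : w ^ 2 * w * ‖ρ 0‖ ≤ w ^ 2 * (κ * (V + ‖ρ 0‖)) := by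
    rw [mul_assoc]
    refine mul_le_mul_of_nonneg_left ?_ hw20.le
    have := mul_le_mul_of_nonneg_right hw1 (norm_nonneg (ρ 0))
    linarith
  have hΘ : w * κ ^ 2 * ‖Θ 0‖ ≤ w ^ 2 * (κ * ‖Θ 0‖) := by
    have : w * κ * (κ * ‖Θ 0‖) ≤ w * w * (κ * ‖Θ 0‖) := by gcongr
    linarith
  refine le_of_mul_le_mul_left ((h.bound_d hw hw2 ht).trans ?_) hw20
  have : w ^ 2 * ‖d 0‖ + w ^ 2 * w * ‖ρ 0‖ + w * κ ^ 2 * ‖Θ 0‖ ≤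
      w ^ 2 * (κ * (U + V + ‖ρ 0‖ + ‖Θ 0‖)) := by
    have := mul_le_mul_of_nonneg_left hU hw20.le
    linarith
  rw [mul_left_comm κ, mul_left_comm (w ^ 2)]
  gcongr
  norm_num

end LongitudinalSystem

/-- The Euler-Maxwell system at the frequency `k` of modulus `κ`: density, divergence of the
velocity, temperature, and the components in a direction, in which `k` has the component `k₁`, of
the velocity, of the electric field and of the curl of the magnetic field. -/
structure ComponentSystem (κ k₁ : ℝ) (ρ d Θ u E c : ℝ → ℂ) : Prop
    extends LongitudinalSystem κ ρ d Θ where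
  hu : ∀ t, HasDerivAt u (-(Complex.I * k₁ * (ρ t + Θ t)) - E t - u t) t
  hE : ∀ t, HasDerivAt E (c t + u t) t
  hc : ∀ t, HasDerivAt c (-((κ : ℂ) ^ 2 * E t) + Complex.I * k₁ * ρ t) t

namespace ComponentSystem

variable {κ k₁ : ℝ} {ρ d Θ u E c : ℝ → ℂ}

/-- The subtracted terms are the components of the gradient parts of velocity and electric field,
recovered from their divergences d and -ρ. What remains is divergence free and decouples from
density and temperature, while a curl needs no correction. -/
theorem transverse (h : ComponentSystem κ k₁ ρ d Θ u E c) (hκ : 0 < κ) :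
    TransverseSystem κ (fun t => u t + Complex.I * k₁ / κ ^ 2 * d t)
      (fun t => E t - Complex.I * k₁ / κ ^ 2 * ρ t) c where
  hX t := ((h.hu t).add ((h.hd t).const_mul (Complex.I * k₁ / κ ^ 2))).congr_deriv (by
    have : (κ : ℂ) ≠ 0 := by exact_mod_cast hκ.ne'
    field_simp; ring)
  hY t := ((h.hE t).sub ((h.hρ t).const_mul (Complex.I * k₁ / κ ^ 2))).congr_deriv (by ring)
  hZ t := (h.hc t).congr_deriv (by
    have : (κ : ℂ) ≠ 0 := by exact_mod_cast hκ.ne'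
    field_simp; ring)

theorem norm_long_le (hκ : 0 < κ) (hk : |k₁| ≤ κ) {z : ℂ} {Z : ℝ} (hz : ‖z‖ ≤ κ * Z) :
    ‖Complex.I * k₁ / κ ^ 2 * z‖ ≤ Z := by
  have hZ : 0 ≤ κ * Z := (norm_nonneg _).trans hz
  rw [norm_mul, norm_div, norm_mul, Complex.norm_I, one_mul, norm_pow, Complex.norm_real,
    Complex.norm_real, Real.norm_eq_abs, Real.norm_of_nonneg hκ.le]
  calc |k₁| / κ ^ 2 * ‖z‖ ≤ κ / κ ^ 2 * (κ * Z) := by gcongr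
    _ = Z := by field_simp

variable {U V W : ℝ}

/-- Both fields are the sum of a transverse part with the profile and a longitudinal part decaying
like e^{-t/2}. The transverse initial values are at most 2(U + V + W), and 410 = 2·100 + 210. -/
theorem norm_le (h : ComponentSystem κ k₁ ρ d Θ u E c) (hκ : 0 < κ) (hk : |k₁| ≤ κ)
    (hd : ‖d 0‖ ≤ κ * U) (hu : ‖u 0‖ ≤ U) (hρ : ‖ρ 0‖ ≤ κ * V) (hE : ‖E 0‖ ≤ V)
    (hc : ‖c 0‖ ≤ κ * W) {t : ℝ} (ht : 0 ≤ t) :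
    ‖u t‖ ≤ 410 * (Real.exp (-t / 2) * (‖ρ 0‖ + ‖Θ 0‖) + decayProfile 1 1 t κ * (U + V + W)) ∧
      ‖E t‖ ≤ 410 * (decayProfile 1 0 t κ * (U + ‖Θ 0‖ + V + W)) := by
  have hU : 0 ≤ U := (norm_nonneg _).trans hu
  have hV : 0 ≤ V := (norm_nonneg _).trans hE
  have hW : 0 ≤ W := nonneg_of_mul_nonneg_right ((norm_nonneg _).trans hc) hκ
  obtain ⟨bX, bY, -⟩ := (h.transverse hκ).norm_le (N := 2 * (U + V + W)) hκ
    ((norm_add_le _ _).trans (by linarith [norm_long_le hκ hk hd]))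
    ((norm_sub_le _ _).trans (by linarith [norm_long_le hκ hk hρ]))
    (hc.trans (by gcongr; linarith)) ht
  have n1 := norm_long_le hκ hk (h.norm_d_le hκ hd hρ ht)
  have n2 := norm_long_le hκ hk (h.norm_rho_le hκ hd hρ ht)
  have p1 := exp_le_decayProfile 1 1 ht hκ
  have p2 := exp_le_decayProfile 1 0 ht hκ
  have he := (Real.exp_pos (-t / 2)).le
  have hΘ := norm_nonneg (Θ 0)
  have hρ0 := norm_nonneg (ρ 0)
  constructor
  · have e : u t = (u t + Complex.I * k₁ / κ ^ 2 * d t) - Complex.I * k₁ / κ ^ 2 * d t := by ring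
    rw [e]
    refine (norm_sub_le _ _).trans ?_
    have := mul_le_mul_of_nonneg_right p1 (by positivity : 0 ≤ U + V)
    have := mul_nonneg (he.trans p1) hW
    have := mul_nonneg he (add_nonneg hρ0 hΘ)
    linarith
  · have e : E t = (E t - Complex.I * k₁ / κ ^ 2 * ρ t) + Complex.I * k₁ / κ ^ 2 * ρ t := by ring
    rw [e]
    refine (norm_add_le _ _).trans ?_
    have := mul_le_mul_of_nonneg_right p2 (by positivity : 0 ≤ V + U + ‖Θ 0‖)
    have := mul_nonneg (he.trans p2) hW
    have := mul_nonneg (he.trans p2) hU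
    have := mul_nonneg (he.trans p2) hV
    have := mul_nonneg (he.trans p2) hΘ
    linarith

end ComponentSystem

/-- Component of the curl of the velocity, of the curl of the electric field, and of the magnetic
field. -/
structure MagneticSystem (κ : ℝ) (ω η B : ℝ → ℂ) : Prop where
  hω : ∀ t, HasDerivAt ω (-ω t - η t) t
  hη : ∀ t, HasDerivAt η (ω t + (κ : ℂ) ^ 2 * B t) t
  hB : ∀ t, HasDerivAt B (-η t) t

/-- The triple (ω, η, κ²B) solves the transverse system with initial size κN, so a factor κ² cancels
in the bound for `B`. Taking curls removes the longitudinal unknowns, which is why neither density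
nor temperature enters. -/
theorem MagneticSystem.norm_le {κ : ℝ} {ω η B : ℝ → ℂ} (h : MagneticSystem κ ω η B) (hκ : 0 < κ)
    {N : ℝ} (hω : ‖ω 0‖ ≤ κ * N) (hη : ‖η 0‖ ≤ κ * N) (hB : ‖B 0‖ ≤ N) {t : ℝ} (ht : 0 ≤ t) :
    ‖B t‖ ≤ 100 * decayProfile 0 0 t κ * N := by
  have hT : TransverseSystem κ ω η (fun t => (κ : ℂ) ^ 2 * B t) :=
    ⟨h.hω, h.hη, fun t => ((h.hB t).const_mul ((κ : ℂ) ^ 2)).congr_deriv (by ring)⟩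
  have e : ∀ s, ‖(κ : ℂ) ^ 2 * B s‖ = κ * (κ * ‖B s‖) := fun s => by
    rw [norm_mul, norm_pow, Complex.norm_real, Real.norm_of_nonneg hκ.le]; ring
  have := (hT.norm_le hκ hω hη (by rw [e]; gcongr) ht).2.2
  rw [e] at this
  have := le_of_mul_le_mul_left this hκ
  refine le_of_mul_le_mul_left (this.trans_eq ?_) hκ
  ring

end PointwiseBounds

/-! ### Lebesgue norms of the low and high frequency multipliers -/

section FrequencyNorms

theorem exists_exp_neg_mul_le_rpow (A : ℝ) {c : ℝ} (hc : 0 < c) :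
    ∃ C : ℝ, 0 < C ∧ ∀ x : ℝ, 0 ≤ x → Real.exp (-(c * x)) ≤ C * (1 + x) ^ (-A) := by
  obtain ⟨n, hn⟩ := exists_nat_ge A
  refine ⟨n.factorial / c ^ n * Real.exp c, by positivity, fun x hx => ?_⟩
  have hx1 : 0 < 1 + x := by linarith
  have h1 := Real.pow_div_factorial_le_exp (x := c * (1 + x)) (by positivity) n
  have h2 : (1 + x) ^ A ≤ (1 + x) ^ n := by
    rw [← Real.rpow_natCast]
    exact Real.rpow_le_rpow_of_exponent_le (by linarith) hn
  rw [Real.rpow_neg hx1.le, ← div_eq_mul_inv, le_div_iff₀ (by positivity), Real.exp_neg,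
    inv_mul_le_iff₀ (Real.exp_pos _)]
  refine h2.trans ?_
  rw [mul_pow, mul_add, mul_one, Real.exp_add, div_le_iff₀ (by positivity)] at h1
  rw [mul_comm (Real.exp (c * x)), div_mul_eq_mul_div, div_mul_eq_mul_div,
    le_div_iff₀ (by positivity)]
  linarith

theorem exists_pow_mul_exp_neg_sq_le (n : ℕ) :
    ∃ C : ℝ, 0 < C ∧ ∀ y : ℝ, 0 ≤ y → y ^ n * Real.exp (-y ^ 2 / 8) ≤ C * (1 + y) ^ (-4 : ℝ) := by
  obtain ⟨C, hC, h⟩ := exists_exp_neg_mul_le_rpow ((n : ℝ) + 4) (c := 1 / 4) (by norm_num)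
  refine ⟨Real.exp (1 / 8) * C, by positivity, fun y hy => ?_⟩
  have hy1 : 0 < 1 + y := by linarith
  have h1 : Real.exp (-y ^ 2 / 8) ≤ Real.exp (1 / 8) * Real.exp (-(1 / 4 * y)) := by
    rw [← Real.exp_add]
    exact Real.exp_le_exp.2 (by nlinarith [sq_nonneg (y - 1)])
  calc y ^ n * Real.exp (-y ^ 2 / 8)
      ≤ (1 + y) ^ (n : ℝ) * (Real.exp (1 / 8) * (C * (1 + y) ^ (-((n : ℝ) + 4)))) := by
        rw [Real.rpow_natCast]
        gcongr
        · linarith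
        · exact h1.trans (by gcongr; exact h y hy)
    _ = Real.exp (1 / 8) * C * ((1 + y) ^ (n : ℝ) * (1 + y) ^ (-((n : ℝ) + 4))) := by ring
    _ = _ := by rw [← Real.rpow_add hy1]; congr 2; ring

variable {V : Type*} [NormedAddCommGroup V] [InnerProductSpace ℝ V] [FiniteDimensional ℝ V]
  [MeasurableSpace V] [BorelSpace V]

theorem continuous_one_add_norm_rpow {V : Type*} [NormedAddCommGroup V] (δ : ℝ) :
    Continuous fun x : V => (1 + ‖x‖) ^ (-δ) :=
  (continuous_const.add continuous_norm).rpow_const fun x =>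
    Or.inl (add_pos_of_pos_of_nonneg one_pos (norm_nonneg x)).ne'

theorem memLp_one_add_norm_rpow {s : ℝ≥0∞} {δ : ℝ} (hs : s ≠ 0) (hδ : 0 ≤ δ)
    (h : s = ⊤ ∨ (Module.finrank ℝ V : ℝ) * s⁻¹.toReal < δ) :
    MemLp (fun x : V => (1 + ‖x‖) ^ (-δ)) s volume := by
  have hm := (continuous_one_add_norm_rpow (V := V) δ).aestronglyMeasurable (μ := volume)
  rcases eq_or_ne s ⊤ with rfl | hst
  · refine memLp_top_of_bound hm 1 (ae_of_all _ fun x => ?_)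
    rw [Real.norm_of_nonneg (by positivity)]
    exact Real.rpow_le_one_of_one_le_of_nonpos (by linarith [norm_nonneg x]) (by linarith)
  · have hpos : 0 < s.toReal := ENNReal.toReal_pos hs hst
    have h' := h.resolve_left hst
    rw [ENNReal.toReal_inv, ← div_eq_mul_inv, div_lt_iff₀ hpos] at h'
    rw [← integrable_norm_rpow_iff hm hs hst]
    refine (integrable_one_add_norm (μ := volume) h').congr (ae_of_all _ fun x => ?_)
    have : (0 : ℝ) ≤ 1 + ‖x‖ := by positivity
    simp only
    rw [Real.norm_of_nonneg (by positivity), ← Real.rpow_mul this, neg_mul]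

theorem eLpNorm_comp_smul {F : Type*} [NormedAddCommGroup F] (f : V → F) {s : ℝ≥0∞}
    (hf : AEStronglyMeasurable f volume) {R : ℝ} (hR : 0 < R) :
    eLpNorm (fun x => f (R • x)) s volume =
      ENNReal.ofReal (R ^ (-(Module.finrank ℝ V : ℝ) * s⁻¹.toReal)) * eLpNorm f s volume := by
  have hmap := Measure.map_addHaar_smul (volume : Measure V) hR.ne'
  have hc : ENNReal.ofReal |(R ^ Module.finrank ℝ V)⁻¹| ≠ 0 := by
    simp only [ne_eq, ENNReal.ofReal_eq_zero, not_le]; positivity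
  have hf' : AEStronglyMeasurable f (Measure.map (R • ·) (volume : Measure V)) := by
    rw [hmap]; exact hf.smul_measure _
  have h1 := eLpNorm_map_measure (p := s) hf' (measurable_const_smul R).aemeasurable
  rw [hmap, eLpNorm_smul_measure_of_ne_zero hc] at h1
  change eLpNorm (f ∘ (R • ·)) s volume = _
  rw [← h1, smul_eq_mul, abs_of_pos (by positivity), one_div, ENNReal.ofReal_rpow_of_pos
    (by positivity), ← Real.rpow_natCast, ← Real.rpow_neg hR.le, ← Real.rpow_mul hR.le]

/-- The multiplier carrying the low frequencies. -/
theorem exists_eLpNorm_lowFrequency_le {s : ℝ≥0∞} (hs : 1 ≤ s)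
    (hV : Module.finrank ℝ V = 3) (n : ℕ) :
    ∃ C : ℝ, 0 < C ∧ ∀ t : ℝ, 0 ≤ t →
      eLpNorm (fun ξ : V => if 2 * Real.pi * ‖ξ‖ ≤ 1 then
        (2 * Real.pi * ‖ξ‖) ^ n * Real.exp (-((2 * Real.pi * ‖ξ‖) ^ 2 * t) / 8) else 0) s volume ≤
      ENNReal.ofReal (C * (1 + t) ^ (-(3 / 2) * s⁻¹.toReal - (n : ℝ) / 2)) := by
  obtain ⟨C, hC, h⟩ := exists_pow_mul_exp_neg_sq_le n
  have hs1 : s⁻¹.toReal ≤ 1 := by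
    have := ENNReal.toReal_mono ENNReal.one_ne_top (ENNReal.inv_le_one.2 hs)
    simpa using this
  have hJ : MemLp (fun x : V => (1 + ‖x‖) ^ (-4 : ℝ)) s volume :=
    memLp_one_add_norm_rpow (zero_lt_one.trans_le hs).ne' (by norm_num)
      (Or.inr (by rw [hV]; push_cast; linarith))
  set J := (eLpNorm (fun x : V => (1 + ‖x‖) ^ (-4 : ℝ)) s volume) with hJdef
  have hJt : J ≠ ⊤ := hJ.2.ne
  refine ⟨Real.exp (1 / 8) * C * (J.toReal + 1), by positivity, fun t ht => ?_⟩
  have hτ : 0 < 1 + t := by linarith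
  -- Scaling by R = (1 + t)^{1/2} rather than t^{1/2} keeps the bound uniform down to t = 0; on κ ≤
  -- 1 this costs only the factor e^{1/8}. The exponent -4 of the majorant exceeds the dimension, so
  -- it lies in every L^s with s ≥ 1.
  obtain ⟨R, hR, hR2⟩ : ∃ R : ℝ, 0 < R ∧ R ^ 2 = 1 + t :=
    ⟨√(1 + t), Real.sqrt_pos.2 hτ, Real.sq_sqrt hτ.le⟩
  have hpt : ∀ ξ : V, ‖(if 2 * Real.pi * ‖ξ‖ ≤ 1 then
        (2 * Real.pi * ‖ξ‖) ^ n * Real.exp (-((2 * Real.pi * ‖ξ‖) ^ 2 * t) / 8) else 0 : ℝ)‖ ≤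
      (Real.exp (1 / 8) * C * R ^ (-(n : ℝ))) * ‖(1 + ‖R • ξ‖) ^ (-4 : ℝ)‖ := by
    intro ξ
    split_ifs with h1
    · rw [Real.norm_of_nonneg (by positivity), Real.norm_of_nonneg (by positivity)]
      have hκ0 : 0 ≤ 2 * Real.pi * ‖ξ‖ := by positivity
      have hκξ : ‖ξ‖ ≤ 2 * Real.pi * ‖ξ‖ :=
        le_mul_of_one_le_left (norm_nonneg _) (by linarith [Real.pi_gt_three])
      generalize 2 * Real.pi * ‖ξ‖ = κ at h1 hκ0 hκξ
      have h2 := h (R * κ) (by positivity)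
      have h3 : Real.exp (-(κ ^ 2 * t) / 8) ≤
          Real.exp (1 / 8) * Real.exp (-(R * κ) ^ 2 / 8) := by
        rw [← Real.exp_add, mul_pow, hR2]
        exact Real.exp_le_exp.2 (by nlinarith)
      have h4 : (1 + R * κ) ^ (-4 : ℝ) ≤ (1 + ‖R • ξ‖) ^ (-4 : ℝ) := by
        refine Real.rpow_le_rpow_of_nonpos (by positivity) ?_ (by norm_num)
        rw [norm_smul, Real.norm_of_nonneg hR.le]
        gcongr
      calc κ ^ n * Real.exp (-(κ ^ 2 * t) / 8)
          ≤ κ ^ n * (Real.exp (1 / 8) * Real.exp (-(R * κ) ^ 2 / 8)) := by gcongr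
        _ = Real.exp (1 / 8) * R ^ (-(n : ℝ)) *
            ((R * κ) ^ n * Real.exp (-(R * κ) ^ 2 / 8)) := by
            rw [Real.rpow_neg hR.le, Real.rpow_natCast]; field_simp; ring
        _ ≤ Real.exp (1 / 8) * R ^ (-(n : ℝ)) * (C * (1 + ‖R • ξ‖) ^ (-4 : ℝ)) := by
            exact mul_le_mul_of_nonneg_left (h2.trans (by gcongr)) (by positivity)
        _ = _ := by ring
    · rw [norm_zero]; positivity
  refine (eLpNorm_le_mul_eLpNorm_of_ae_le_mul (ae_of_all _ hpt) s).trans ?_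
  rw [eLpNorm_comp_smul (fun x : V => (1 + ‖x‖) ^ (-4 : ℝ)) hJ.1 hR, ← hJdef, hV,
    ← ENNReal.ofReal_toReal hJt, ← ENNReal.ofReal_mul (by positivity),
    ← ENNReal.ofReal_mul (by positivity)]
  refine ENNReal.ofReal_le_ofReal ?_
  have e : (1 + t) ^ (-(3 / 2) * s⁻¹.toReal - (n : ℝ) / 2) =
      R ^ (-(n : ℝ)) * R ^ (-((3 : ℕ) : ℝ) * s⁻¹.toReal) := by
    rw [← hR2, ← Real.rpow_natCast, ← Real.rpow_mul hR.le, ← Real.rpow_add hR]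
    congr 1; push_cast; ring
  rw [e, ENNReal.toReal_ofReal ENNReal.toReal_nonneg]
  have : 0 ≤ Real.exp (1 / 8) * C * (R ^ (-(n : ℝ)) * R ^ (-((3 : ℕ) : ℝ) * s⁻¹.toReal)) := by
    positivity
  linarith

/-- The multiplier carrying the high frequencies. -/
theorem exists_eLpNorm_highFrequency_le {s : ℝ≥0∞} (hs : s ≠ 0) {N m b : ℕ} {l : ℝ}
    (hl : 0 ≤ l) (hN : (m : ℝ) + l ≤ N)
    (h : s = ⊤ ∨ (Module.finrank ℝ V : ℝ) * s⁻¹.toReal < N - (m + l)) :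
    ∃ C : ℝ, 0 < C ∧ ∀ t : ℝ, 0 ≤ t →
      eLpNorm (fun ξ : V => if 2 * Real.pi * ‖ξ‖ ≤ 1 then 0 else
        (2 * Real.pi * ‖ξ‖) ^ m * ((2 * Real.pi * ‖ξ‖) ^ N)⁻¹ *
          decayProfile 0 b t (2 * Real.pi * ‖ξ‖)) s volume ≤
      ENNReal.ofReal (C * (1 + t) ^ (-(l + b) / 2)) := by
  obtain ⟨C, hC, h8⟩ := exists_exp_neg_mul_le_rpow ((l + b) / 2) (c := 1 / 8) (by norm_num)
  set δ : ℝ := N - (m + l) with hδ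
  have hJ : MemLp (fun x : V => (1 + ‖x‖) ^ (-δ)) s volume :=
    memLp_one_add_norm_rpow hs (by linarith) h
  set J := (eLpNorm (fun x : V => (1 + ‖x‖) ^ (-δ)) s volume) with hJdef
  have hJt : J ≠ ⊤ := hJ.2.ne
  refine ⟨2 * C * 2 ^ δ * (J.toReal + 1), by positivity, fun t ht => ?_⟩
  have hτ : 0 < 1 + t := by linarith
  have hpt : ∀ ξ : V, ‖(if 2 * Real.pi * ‖ξ‖ ≤ 1 then 0 else
        (2 * Real.pi * ‖ξ‖) ^ m * ((2 * Real.pi * ‖ξ‖) ^ N)⁻¹ *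
          decayProfile 0 b t (2 * Real.pi * ‖ξ‖) : ℝ)‖ ≤
      (2 * C * 2 ^ δ * (1 + t) ^ (-(l + b) / 2)) * ‖(1 + ‖ξ‖) ^ (-δ)‖ := by
    intro ξ
    split_ifs with h1
    · rw [norm_zero]; positivity
    · have hκ0 : 0 ≤ 2 * Real.pi * ‖ξ‖ := by positivity
      have hκξ : ‖ξ‖ ≤ 2 * Real.pi * ‖ξ‖ :=
        le_mul_of_one_le_left (norm_nonneg _) (by linarith [Real.pi_gt_three])
      generalize 2 * Real.pi * ‖ξ‖ = κ at h1 hκ0 hκξ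
      have h1' : 1 ≤ κ := (not_le.1 h1).le
      have hκ : 0 < κ := by linarith
      rw [decayProfile, if_neg h1, Real.norm_of_nonneg (by positivity),
        Real.norm_of_nonneg (by positivity)]
      have e1 : Real.exp (-t / 8) ≤ C * (1 + t) ^ (-(l + b) / 2) * κ ^ l := by
        have := h8 t ht
        rw [show -(1 / 8 * t) = -t / 8 by ring, show -((l + b) / 2) = -(l + b) / 2 by ring] at this
        refine this.trans (le_mul_of_one_le_right (by positivity) (Real.one_le_rpow h1' hl))
      -- Time decay is exchanged for powers of κ: the exponential is at most a constant times
      -- ((1+t)/κ²)^{-(l+b)/2}, and the gain κ^{-b} leaves only κ^l to be paid by derivatives.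
      have e2 : κ⁻¹ ^ b * Real.exp (-(t / κ ^ 2) / 8) ≤
          C * (1 + t) ^ (-(l + b) / 2) * κ ^ l := by
        have := h8 (t / κ ^ 2) (by positivity)
        rw [show -(1 / 8 * (t / κ ^ 2)) = -(t / κ ^ 2) / 8 by ring,
          show -((l + b) / 2) = -(l + b) / 2 by ring] at this
        have e3 : (1 + t / κ ^ 2) ^ (-(l + b) / 2) ≤ ((1 + t) / κ ^ 2) ^ (-(l + b) / 2) := by
          refine Real.rpow_le_rpow_of_nonpos (by positivity) ?_ ?_
          · rw [add_div]
            gcongr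
            exact (div_le_one (by positivity)).2 (one_le_pow₀ h1')
          · have : 0 ≤ l + b := by positivity
            linarith
        have e4 : ((1 + t) / κ ^ 2) ^ (-(l + b) / 2) =
            (1 + t) ^ (-(l + b) / 2) * (κ ^ b * κ ^ l) := by
          rw [Real.div_rpow hτ.le (by positivity), ← Real.rpow_natCast κ 2, ← Real.rpow_mul hκ0,
            div_eq_mul_inv, ← Real.rpow_neg hκ0, ← Real.rpow_natCast κ b, ← Real.rpow_add hκ]
          congr 2; push_cast; ring
        calc κ⁻¹ ^ b * Real.exp (-(t / κ ^ 2) / 8)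
            ≤ κ⁻¹ ^ b * (C * ((1 + t) ^ (-(l + b) / 2) * (κ ^ b * κ ^ l))) := by
              rw [← e4]
              exact mul_le_mul_of_nonneg_left (this.trans (by gcongr)) (by positivity)
          _ = _ := by
              rw [inv_pow]; field_simp
      have e5 : κ ^ m * (κ ^ N)⁻¹ * κ ^ l ≤ 2 ^ δ * (1 + ‖ξ‖) ^ (-δ) := by
        have : κ ^ m * (κ ^ N)⁻¹ * κ ^ l = κ ^ (-δ) := by
          rw [← Real.rpow_natCast κ m, ← Real.rpow_natCast κ N, ← Real.rpow_neg hκ0,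
            ← Real.rpow_add hκ, ← Real.rpow_add hκ]
          congr 1; rw [hδ]; ring
        rw [this]
        have h2 : ((1 + ‖ξ‖) / 2) ^ (-δ) = 2 ^ δ * (1 + ‖ξ‖) ^ (-δ) := by
          rw [Real.div_rpow (by positivity) (by norm_num), Real.rpow_neg (by norm_num : (0:ℝ) ≤ 2),
            div_inv_eq_mul, mul_comm]
        rw [← h2]
        exact Real.rpow_le_rpow_of_nonpos (by positivity) (by linarith) (by linarith)
      calc κ ^ m * (κ ^ N)⁻¹ * (Real.exp (-t / 8) + κ⁻¹ ^ b * Real.exp (-(t / κ ^ 2) / 8))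
          ≤ κ ^ m * (κ ^ N)⁻¹ * (C * (1 + t) ^ (-(l + b) / 2) * κ ^ l +
              C * (1 + t) ^ (-(l + b) / 2) * κ ^ l) := by gcongr
        _ = 2 * C * (1 + t) ^ (-(l + b) / 2) * (κ ^ m * (κ ^ N)⁻¹ * κ ^ l) := by ring
        _ ≤ 2 * C * (1 + t) ^ (-(l + b) / 2) * (2 ^ δ * (1 + ‖ξ‖) ^ (-δ)) := by gcongr
        _ = _ := by ring
  refine (eLpNorm_le_mul_eLpNorm_of_ae_le_mul (ae_of_all _ hpt) s).trans ?_
  rw [← hJdef, ← ENNReal.ofReal_toReal hJt, ← ENNReal.ofReal_mul (by positivity)]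
  refine ENNReal.ofReal_le_ofReal ?_
  rw [ENNReal.toReal_ofReal ENNReal.toReal_nonneg]
  have : 0 ≤ 2 * C * 2 ^ δ * (1 + t) ^ (-(l + b) / 2) := by positivity
  linarith

end FrequencyNorms

/-! ### Exponents, and the Hölder splitting of the decay profile -/

namespace EulerMaxwell

theorem gap_eq_toReal_sub {a b : ℝ≥0∞} (ha : 1 ≤ a) (hab : a ≤ b) :
    gap a b = (a⁻¹ - b⁻¹).toReal := by
  rw [gap, ENNReal.toReal_sub_of_le (ENNReal.inv_le_inv.2 hab)]
  exact ENNReal.inv_ne_top.2 (zero_lt_one.trans_le ha).ne'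

/-- Since 1/a - 1/b = 1/b' - 1/a', a multiplier in L^s with 1/s = 1/a - 1/b maps L^{a'} into L^{b'}.
-/
theorem holderTriple_inv_sub_inv {a b a' b' : ℝ≥0∞} (hab : a ≤ b) (hb : 1 ≤ b)
    [h : ENNReal.HolderConjugate a a'] [h' : ENNReal.HolderConjugate b b'] :
    ENNReal.HolderTriple (a⁻¹ - b⁻¹)⁻¹ a' b' := by
  constructor
  rw [inv_inv]
  have h1 := h.inv_add_inv_eq_inv
  have h2 := h'.inv_add_inv_eq_inv
  have hbt : b⁻¹ ≠ ⊤ := ENNReal.inv_ne_top.2 (zero_lt_one.trans_le hb).ne'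
  refine (ENNReal.add_right_inj hbt).1 ?_
  rw [h2, ← h1, ← add_assoc, add_tsub_cancel_of_le (ENNReal.inv_le_inv.2 hab)]

/-- The alternative is the condition for κ^{-(N-l)} to lie in L^s at high frequencies: in the
exceptional case s = ∞ boundedness suffices and N = l is allowed, otherwise N must strictly exceed l
+ 3/s. -/
theorem le_bracketPlus {l : ℝ} (hl : 0 ≤ l) (r q : ℝ≥0∞) (hr : 1 ≤ r) (hrq : r ≤ q) :
    l ≤ bracketPlus l r q ∧
      ((r⁻¹ - q⁻¹)⁻¹ = ⊤ ∨ (3 : ℝ) * (((r⁻¹ - q⁻¹)⁻¹)⁻¹).toReal < bracketPlus l r q - l) := by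
  have hg : 0 ≤ gap r q := by rw [gap_eq_toReal_sub hr hrq]; exact ENNReal.toReal_nonneg
  unfold bracketPlus
  split_ifs with h
  · obtain ⟨rfl, rfl, n, rfl⟩ := h
    refine ⟨?_, Or.inl (by simp)⟩
    obtain ⟨k, rfl⟩ := Int.eq_ofNat_of_zero_le (by exact_mod_cast hl)
    simp
  · have := Nat.lt_floor_add_one (l + 3 * gap r q)
    push_cast
    refine ⟨by linarith, Or.inr ?_⟩
    rw [inv_inv, ← gap_eq_toReal_sub hr hrq]
    linarith

/-- Decay of a function whose frequency profile is that of the Euler-Maxwell system. -/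
theorem exists_eLpNorm_decayProfile_le {p q r p' q' r' : ℝ≥0∞} (hp₁ : 1 ≤ p) (hp₂ : p ≤ 2)
    (hr₁ : 1 ≤ r) (hr₂ : r ≤ 2) (hq : 2 ≤ q) [ENNReal.HolderConjugate p p']
    [ENNReal.HolderConjugate q q'] [ENNReal.HolderConjugate r r'] {l : ℝ} (hl : 0 ≤ l)
    (m a b : ℕ) :
    ∃ C : ℝ, 0 < C ∧ ∀ t : ℝ, 0 ≤ t → ∀ G : R3 → ℝ, AEStronglyMeasurable G volume →
      eLpNorm (fun ξ => (2 * Real.pi * ‖ξ‖) ^ m * decayProfile a b t (2 * Real.pi * ‖ξ‖) * G ξ)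
        q' volume ≤
      ENNReal.ofReal (C * (1 + t) ^ (-(3 / 2) * gap p q - ((m : ℝ) + a) / 2)) *
          eLpNorm G p' volume +
        ENNReal.ofReal (C * (1 + t) ^ (-(l + b) / 2)) *
          eLpNorm (fun ξ => (2 * Real.pi * ‖ξ‖) ^ (m + bracketPlus l r q) * G ξ) r' volume := by
  have hq1 : 1 ≤ q := one_le_two.trans hq
  have hpq := hp₂.trans hq
  have hrq := hr₂.trans hq
  have hinv : ∀ {a : ℝ≥0∞}, 1 ≤ a → 1 ≤ (a⁻¹ - q⁻¹)⁻¹ := fun {a} ha =>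
    ENNReal.one_le_inv.2 (tsub_le_self.trans (ENNReal.inv_le_one.2 ha))
  have := holderTriple_inv_sub_inv (a' := p') (b' := q') hpq hq1
  have := holderTriple_inv_sub_inv (a' := r') (b' := q') hrq hq1
  have hfr : Module.finrank ℝ R3 = 3 := by simp
  have h1q' : 1 ≤ q' := ENNReal.HolderConjugate.one_le q' q
  set s := (p⁻¹ - q⁻¹)⁻¹ with hs
  set s₂ := (r⁻¹ - q⁻¹)⁻¹ with hs₂
  have hgap : s⁻¹.toReal = gap p q := by rw [hs, inv_inv, gap_eq_toReal_sub hp₁ hpq]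
  obtain ⟨C₁, hC₁, h₁⟩ := exists_eLpNorm_lowFrequency_le (V := R3) (hinv hp₁) hfr (m + a)
  -- This second low frequency bound is used at time 0 for the summand e^{-t/8} of the profile,
  -- whose time decay beats the required power through `h₃`.
  obtain ⟨C₂, hC₂, h₂⟩ := exists_eLpNorm_lowFrequency_le (V := R3) (hinv hp₁) hfr m
  obtain ⟨C₃, hC₃, h₃⟩ := exists_exp_neg_mul_le_rpow (3 / 2 * gap p q + ((m : ℝ) + a) / 2)
    (c := 1 / 8) (by norm_num)
  obtain ⟨hb1, hb2⟩ := le_bracketPlus hl r q hr₁ hrq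
  obtain ⟨C₄, hC₄, h₄⟩ := exists_eLpNorm_highFrequency_le (V := R3) (s := s₂)
    (zero_lt_one.trans_le (hinv hr₁)).ne' (N := m + bracketPlus l r q) (m := m) (b := b) hl
    (by push_cast; linarith) (hb2.imp id (fun h => by rw [hfr]; push_cast; linarith))
  refine ⟨C₁ + C₂ * C₃ + C₄, by positivity, fun t ht G hG => ?_⟩
  have hτ : 0 < 1 + t := by linarith
  set L₁ : R3 → ℝ := fun ξ => if 2 * Real.pi * ‖ξ‖ ≤ 1 then
        (2 * Real.pi * ‖ξ‖) ^ (m + a) * Real.exp (-((2 * Real.pi * ‖ξ‖) ^ 2 * t) / 8) else 0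
    with hL₁
  set L₂ : R3 → ℝ := fun ξ => if 2 * Real.pi * ‖ξ‖ ≤ 1 then
        (2 * Real.pi * ‖ξ‖) ^ m * Real.exp (-((2 * Real.pi * ‖ξ‖) ^ 2 * 0) / 8) else 0
    with hL₂
  set H : R3 → ℝ := fun ξ => if 2 * Real.pi * ‖ξ‖ ≤ 1 then 0 else
        (2 * Real.pi * ‖ξ‖) ^ m * ((2 * Real.pi * ‖ξ‖) ^ (m + bracketPlus l r q))⁻¹ *
          decayProfile 0 b t (2 * Real.pi * ‖ξ‖) with hH
  have hset : MeasurableSet {ξ : R3 | 2 * Real.pi * ‖ξ‖ ≤ 1} :=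
    measurableSet_le (by fun_prop) measurable_const
  have mL₁ : Measurable L₁ := Measurable.ite hset (by fun_prop) measurable_const
  have mL₂ : Measurable L₂ := Measurable.ite hset (by fun_prop) measurable_const
  have mH : Measurable H := by
    refine Measurable.ite hset measurable_const (Measurable.mul (by fun_prop) ?_)
    unfold decayProfile
    exact Measurable.add (by fun_prop) (Measurable.ite hset (by fun_prop) (by fun_prop))
  set G₂ : R3 → ℝ := fun ξ => (2 * Real.pi * ‖ξ‖) ^ (m + bracketPlus l r q) * G ξ with hG₂
  have mG₂ : AEStronglyMeasurable G₂ volume :=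
    AEStronglyMeasurable.mul (Continuous.aestronglyMeasurable (by fun_prop)) hG
  have hsplit : (fun ξ => (2 * Real.pi * ‖ξ‖) ^ m * decayProfile a b t (2 * Real.pi * ‖ξ‖) * G ξ) =
      ((L₁ + Real.exp (-t / 8) • L₂) • G) + H • G₂ := by
    funext ξ
    change _ = (L₁ ξ + Real.exp (-t / 8) * L₂ ξ) * G ξ + H ξ * G₂ ξ
    simp only [hL₁, hL₂, hH, hG₂, decayProfile]
    generalize 2 * Real.pi * ‖ξ‖ = κ
    split_ifs with h
    · simp only [mul_zero, neg_zero, zero_div, Real.exp_zero, pow_add]; ring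
    · have : 0 < κ := zero_lt_one.trans (not_le.1 h)
      field_simp
      ring
  have mL := mL₁.aestronglyMeasurable (μ := volume).add
    (mL₂.aestronglyMeasurable (μ := volume).const_smul (Real.exp (-t / 8)))
  rw [hsplit]
  refine (eLpNorm_add_le (mL.smul hG) (mH.aestronglyMeasurable.smul mG₂) h1q').trans ?_
  refine add_le_add ((eLpNorm_smul_le_mul_eLpNorm (p := s) (q := p') hG mL).trans ?_)
    ((eLpNorm_smul_le_mul_eLpNorm (p := s₂) (q := r') mG₂ mH.aestronglyMeasurable).trans ?_)
  · gcongr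
    refine (eLpNorm_add_le mL₁.aestronglyMeasurable
      (mL₂.aestronglyMeasurable.const_smul _) (hinv hp₁)).trans ?_
    rw [eLpNorm_const_smul]
    refine (add_le_add (h₁ t ht) (mul_le_mul_right (h₂ 0 le_rfl) _)).trans ?_
    rw [hgap, add_zero, Real.one_rpow, mul_one, ← ofReal_norm, Real.norm_of_nonneg (by positivity),
      ← ENNReal.ofReal_mul (by positivity), ← ENNReal.ofReal_add (by positivity) (by positivity)]
    refine ENNReal.ofReal_le_ofReal ?_
    have h3 := h₃ t ht
    rw [show -(1 / 8 * t) = -t / 8 by ring,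
      show -(3 / 2 * gap p q + ((m : ℝ) + a) / 2) = -(3 / 2) * gap p q - ((m : ℝ) + a) / 2 by
        ring] at h3
    have h3' := mul_le_mul_of_nonneg_right h3 hC₂.le
    have h5 : 0 ≤ C₄ * (1 + t) ^ (-(3 / 2) * gap p q - ((m : ℝ) + a) / 2) := by positivity
    push_cast
    linarith
  · gcongr
    refine (h₄ t ht).trans (ENNReal.ofReal_le_ofReal ?_)
    gcongr
    have : 0 ≤ C₁ + C₂ * C₃ := by positivity
    linarith

/-! ### Tempered distributions on the Fourier side -/

section FourierSide

open scoped FourierTransform NNReal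

/-- The Fourier symbol of `∂_j`. -/
noncomputable def freq (j : Fin 3) (ξ : R3) : ℂ := 2 * Real.pi * Complex.I * (ξ j : ℂ)

theorem hasTemperateGrowth_freq (j : Fin 3) : (freq j).HasTemperateGrowth := by
  have : (fun ξ : R3 => ((EuclideanSpace.proj j : R3 →L[ℝ] ℝ) ξ)).HasTemperateGrowth :=
    ContinuousLinearMap.hasTemperateGrowth _
  have h2 : (fun ξ : R3 => (Complex.ofRealCLM ∘L (EuclideanSpace.proj j : R3 →L[ℝ] ℝ))
      ξ).HasTemperateGrowth := ContinuousLinearMap.hasTemperateGrowth _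
  exact (Function.HasTemperateGrowth.const (2 * Real.pi * Complex.I)).mul h2

theorem continuous_freq (j : Fin 3) : Continuous (freq j) :=
  (hasTemperateGrowth_freq j).1.continuous

theorem norm_freq (j : Fin 3) (ξ : R3) : ‖freq j ξ‖ = 2 * Real.pi * |ξ j| := by
  simp [freq, abs_of_pos Real.pi_pos]

theorem norm_freq_le (j : Fin 3) (ξ : R3) : ‖freq j ξ‖ ≤ 2 * Real.pi * ‖ξ‖ := by
  rw [norm_freq]
  gcongr
  exact PiLp.norm_apply_le ξ j

/-- Multiplication of a Schwartz function by the symbol of `∂_j`. -/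
noncomputable def mulFreq (j : Fin 3) : 𝓢(R3, ℂ) →L[ℂ] 𝓢(R3, ℂ) :=
  SchwartzMap.smulLeftCLM ℂ (freq j)

theorem mulFreq_apply (j : Fin 3) (φ : 𝓢(R3, ℂ)) (ξ : R3) :
    mulFreq j φ ξ = freq j ξ * φ ξ := by
  rw [mulFreq, SchwartzMap.smulLeftCLM_apply_apply (hasTemperateGrowth_freq j), smul_eq_mul]

theorem HasCompactSupport.mulFreq {φ : 𝓢(R3, ℂ)} (hφ : HasCompactSupport φ) (j : Fin 3) :
    HasCompactSupport (mulFreq j φ) := by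
  have : (EulerMaxwell.mulFreq j φ : R3 → ℂ) = fun ξ => freq j ξ * φ ξ :=
    funext (mulFreq_apply j φ)
  rw [this]
  exact HasCompactSupport.mul_left hφ

/-- The Fourier transform of a tempered distribution, as a functional on Schwartz functions. -/
noncomputable def fhat (T : Dist) : 𝓢(R3, ℂ) →L[ℂ] ℂ where
  toFun φ := T (𝓕 φ)
  map_add' φ ψ := by rw [FourierTransform.fourier_add, map_add]
  map_smul' c φ := by rw [FourierTransform.fourier_smul, map_smul]; rfl
  cont := T.cont.comp (FourierTransform.fourierCLM ℂ 𝓢(R3, ℂ)).cont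

theorem fhat_apply (T : Dist) (φ : 𝓢(R3, ℂ)) : fhat T φ = T (𝓕 φ) := rfl

theorem fhat_add (S T : Dist) (φ : 𝓢(R3, ℂ)) : fhat (S + T) φ = fhat S φ + fhat T φ := rfl

theorem fhat_sub (S T : Dist) (φ : 𝓢(R3, ℂ)) : fhat (S - T) φ = fhat S φ - fhat T φ := rfl

theorem fhat_neg (T : Dist) (φ : 𝓢(R3, ℂ)) : fhat (-T) φ = -fhat T φ := rfl

theorem fhat_smul (c : ℂ) (T : Dist) (φ : 𝓢(R3, ℂ)) : fhat (c • T) φ = c * fhat T φ := rfl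

theorem fhat_zero (φ : 𝓢(R3, ℂ)) : fhat 0 φ = 0 := rfl

theorem fhat_partialD (j : Fin 3) (T : Dist) (φ : 𝓢(R3, ℂ)) :
    fhat (partialD j T) φ = fhat T (mulFreq j φ) := by
  have h := congrArg (fun S : Dist => S φ)
    (TemperedDistribution.fourier_lineDerivOp_eq T (EuclideanSpace.single j (1 : ℝ) : R3))
  have hg : (fun ξ : R3 => inner ℝ ξ (EuclideanSpace.single j (1 : ℝ))).HasTemperateGrowth := by
    fun_prop
  have hg' : (fun ξ : R3 =>
      ((inner ℝ ξ (EuclideanSpace.single j (1 : ℝ)) : ℝ) : ℂ)).HasTemperateGrowth := by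
    fun_prop
  refine h.trans ?_
  change (2 * Real.pi * Complex.I : ℂ) • fhat T (SchwartzMap.smulLeftCLM ℂ _ φ) = _
  rw [← map_smul]
  congr 1
  ext ξ
  rw [mulFreq_apply, smul_apply, SchwartzMap.smulLeftCLM_apply_apply hg']
  have hin : inner ℝ ξ (EuclideanSpace.single j (1 : ℝ)) = ξ j := by
    rw [EuclideanSpace.inner_single_right]; simp
  rw [hin, smul_eq_mul, smul_eq_mul, freq]
  ring

theorem fhat_divD (v : Fin 3 → Dist) (φ : 𝓢(R3, ℂ)) :
    fhat (divD v) φ =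
      fhat (v 0) (mulFreq 0 φ) + fhat (v 1) (mulFreq 1 φ) + fhat (v 2) (mulFreq 2 φ) := by
  rw [divD, Fin.sum_univ_three, fhat_add, fhat_add, fhat_partialD, fhat_partialD, fhat_partialD]

/-- The symbol of an iterated partial derivative. -/
noncomputable def freqProd {m : ℕ} (α : Fin m → Fin 3) (ξ : R3) : ℂ := ∏ i, freq (α i) ξ

theorem continuous_freqProd {m : ℕ} (α : Fin m → Fin 3) : Continuous (freqProd α) :=
  continuous_finsetProd _ fun i _ => continuous_freq (α i)

theorem norm_freqProd_le {m : ℕ} (α : Fin m → Fin 3) (ξ : R3) :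
    ‖freqProd α ξ‖ ≤ (2 * Real.pi * ‖ξ‖) ^ m := by
  rw [freqProd, norm_prod]
  refine (Finset.prod_le_prod (fun i _ => norm_nonneg _) fun i _ => norm_freq_le (α i) ξ).trans ?_
  simp

theorem pow_le_sum_norm_freqProd (m : ℕ) (ξ : R3) :
    (2 * Real.pi * ‖ξ‖) ^ m ≤ ∑ α : Fin m → Fin 3, ‖freqProd α ξ‖ := by
  have h1 : ‖ξ‖ ≤ ∑ j, |ξ j| := by
    rw [EuclideanSpace.norm_eq]
    refine Real.sqrt_le_iff.2 ⟨by positivity, ?_⟩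
    simp only [Fin.sum_univ_three, Real.norm_eq_abs]
    nlinarith [abs_nonneg (ξ 0), abs_nonneg (ξ 1), abs_nonneg (ξ 2),
      mul_nonneg (abs_nonneg (ξ 0)) (abs_nonneg (ξ 1)),
      mul_nonneg (abs_nonneg (ξ 0)) (abs_nonneg (ξ 2)),
      mul_nonneg (abs_nonneg (ξ 1)) (abs_nonneg (ξ 2))]
  have h2 : 2 * Real.pi * ‖ξ‖ ≤ ∑ j, ‖freq j ξ‖ := by
    simp only [norm_freq, ← Finset.mul_sum]
    gcongr
  refine (pow_le_pow_left₀ (by positivity) h2 m).trans_eq ?_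
  rw [Finset.sum_pow', Fintype.piFinset_univ]
  simp [freqProd]

/-- Multiplication by the symbol preserves compact support, so a Fourier transform known only on
compactly supported test functions can still be differentiated. -/
theorem exists_mulFreq_iterate {m : ℕ} (α : Fin m → Fin 3) (T : Dist) (φ : 𝓢(R3, ℂ)) :
    ∃ ψ : 𝓢(R3, ℂ), fhat (iterD α T) φ = fhat T ψ ∧ (∀ ξ, ψ ξ = freqProd α ξ * φ ξ) ∧
      (HasCompactSupport φ → HasCompactSupport ψ) := by
  induction m generalizing φ with
  | zero => exact ⟨φ, rfl, fun ξ => by simp [freqProd], id⟩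
  | succ m ih =>
    obtain ⟨ψ, h1, h2, h3⟩ := ih (fun i => α i.succ) (mulFreq (α 0) φ)
    refine ⟨ψ, ?_, fun ξ => ?_, fun h => h3 (HasCompactSupport.mulFreq h _)⟩
    · rw [← h1, ← fhat_partialD]; rfl
    · rw [h2, mulFreq_apply, freqProd, freqProd, Fin.prod_univ_succ]; ring

/-- The Fourier transform of `T` is the function `g`. -/
structure HasFourier (T : Dist) (g : R3 → ℂ) : Prop where
  locallyIntegrable : LocallyIntegrable g volume
  integrable : ∀ φ : 𝓢(R3, ℂ), Integrable (fun ξ => φ ξ * g ξ) volume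
  eq : ∀ φ : 𝓢(R3, ℂ), fhat T φ = ∫ ξ, φ ξ * g ξ

namespace HasFourier

variable {S T : Dist} {f g : R3 → ℂ}

theorem ae_eq (hf : HasFourier T f) (hg : HasFourier T g) : f =ᵐ[volume] g :=
  ae_eq_of_integral_schwartz hf.locallyIntegrable hg.locallyIntegrable fun φ => by
    rw [← hf.eq, ← hg.eq]

theorem add (hf : HasFourier S f) (hg : HasFourier T g) : HasFourier (S + T) (f + g) where
  locallyIntegrable := hf.locallyIntegrable.add hg.locallyIntegrable
  integrable φ := ((hf.integrable φ).add (hg.integrable φ)).congr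
    (ae_of_all _ fun ξ => (mul_add _ _ _).symm)
  eq φ := by
    rw [fhat_add, hf.eq, hg.eq, ← integral_add (hf.integrable φ) (hg.integrable φ)]
    simp only [Pi.add_apply, mul_add]

theorem neg (hf : HasFourier T f) : HasFourier (-T) (-f) where
  locallyIntegrable := hf.locallyIntegrable.neg
  integrable φ := (hf.integrable φ).neg.congr (ae_of_all _ fun ξ => by simp)
  eq φ := by
    rw [fhat_neg, hf.eq, ← integral_neg]
    simp

theorem sub (hf : HasFourier S f) (hg : HasFourier T g) : HasFourier (S - T) (f - g) := by
  rw [sub_eq_add_neg, sub_eq_add_neg]; exact hf.add hg.neg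

theorem partialD (hf : HasFourier T f) (j : Fin 3) :
    HasFourier (partialD j T) (fun ξ => freq j ξ * f ξ) where
  locallyIntegrable := by
    have := hf.locallyIntegrable.smul_continuous (continuous_freq j)
    simpa [smul_eq_mul, mul_comm] using this
  integrable φ := (hf.integrable (mulFreq j φ)).congr
    (ae_of_all _ fun ξ => by simp only [mulFreq_apply]; ring)
  eq φ := by
    rw [fhat_partialD, hf.eq]
    refine integral_congr_ae (ae_of_all _ fun ξ => ?_)
    simp only [mulFreq_apply]; ring

theorem iterD {m : ℕ} (hf : HasFourier T f) (α : Fin m → Fin 3) :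
    HasFourier (iterD α T) (fun ξ => freqProd α ξ * f ξ) := by
  induction m with
  | zero => simpa [freqProd, EulerMaxwell.iterD] using hf
  | succ m ih =>
    have := (ih fun i => α i.succ).partialD (α 0)
    simp only [← mul_assoc] at this
    simp only [freqProd, Fin.prod_univ_succ]
    exact this

theorem divD {v : Fin 3 → Dist} {g : Fin 3 → R3 → ℂ} (h : ∀ j, HasFourier (v j) (g j)) :
    HasFourier (divD v)
      (fun ξ => freq 0 ξ * g 0 ξ + freq 1 ξ * g 1 ξ + freq 2 ξ * g 2 ξ) := by
  rw [EulerMaxwell.divD, Fin.sum_univ_three]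
  exact (((h 0).partialD 0).add ((h 1).partialD 1)).add ((h 2).partialD 2)

theorem of_memLp {p : ℝ≥0∞} (hp : 1 ≤ p) (hg : MemLp g p volume)
    (h : ∀ φ : 𝓢(R3, ℂ), fhat T φ = ∫ ξ, φ ξ * g ξ) : HasFourier T g :=
  ⟨hg.locallyIntegrable hp, SchwartzMap.integrable_mul_of_memLp hp hg, h⟩

end HasFourier

theorem lpNorm_eq_of_represents {p : ℝ≥0∞} (hp : 1 ≤ p) {T : Dist} {f : R3 → ℂ}
    (hf : MemLp f p volume) (h : Represents f T) : lpNorm p T = eLpNorm f p volume := by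
  refine le_antisymm (iInf₂_le f ⟨hf, h⟩) (le_iInf₂ fun f' hf' => ?_)
  refine (eLpNorm_congr_ae ?_).le
  exact ae_eq_of_integral_schwartz (hf.locallyIntegrable hp) (hf'.1.locallyIntegrable hp)
    fun φ => by rw [← h, ← hf'.2]

theorem exists_represents_of_lpNorm_lt_top {p : ℝ≥0∞} {T : Dist} (h : lpNorm p T < ⊤) :
    ∃ f : R3 → ℂ, MemLp f p volume ∧ Represents f T := by
  by_contra! hn
  have : lpNorm p T = ⊤ := by
    simp only [lpNorm, iInf_eq_top]
    exact fun f hf => absurd hf.2 (hn f hf.1)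
  exact h.ne this

/-- The Hausdorff-Young inequality for tempered distributions. -/
theorem exists_hasFourier_of_lpNorm_lt_top {p p' : ℝ≥0∞} (hp : p ≤ 2)
    [hpp : ENNReal.HolderConjugate p p'] :
    ∃ C : ℝ≥0, 0 < C ∧ ∀ T : Dist, lpNorm p T < ⊤ → ∃ g : R3 → ℂ, MemLp g p' volume ∧
      HasFourier T g ∧ eLpNorm g p' volume ≤ C * lpNorm p T := by
  obtain ⟨C, hC⟩ := hausdorff_young (V := R3) (p := p) (p' := p') hp
  have hp1 : 1 ≤ p := ENNReal.HolderConjugate.one_le p p'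
  have hp1' : 1 ≤ p' := ENNReal.HolderConjugate.one_le p' p
  refine ⟨C + 1, by positivity, fun T hT => ?_⟩
  obtain ⟨f, hf, hfT⟩ := exists_represents_of_lpNorm_lt_top hT
  obtain ⟨g, hg, hgC, hgf⟩ := hC f hf
  refine ⟨g, hg, HasFourier.of_memLp hp1' hg fun φ => ?_, hgC.trans ?_⟩
  · rw [fhat_apply, hfT, hgf]
  · rw [lpNorm_eq_of_represents hp1 hf hfT]
    gcongr
    exact_mod_cast le_self_add

theorem gradNorm_zero (p : ℝ≥0∞) (T : Dist) : gradNorm 0 p T = lpNorm p T := by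
  simp [gradNorm, iterD]

/-- The weight κ^N is dominated by the sum of the moduli of the symbols of all derivatives of order
N, and Hausdorff-Young applies to each derivative. An infinite right side is trivial because the
constant is positive. -/
theorem exists_eLpNorm_pow_mul_le {r r' : ℝ≥0∞} (hr : r ≤ 2)
    [hrr : ENNReal.HolderConjugate r r'] (N : ℕ) :
    ∃ C : ℝ≥0, 0 < C ∧ ∀ (T : Dist) (g : R3 → ℂ), HasFourier T g →
      eLpNorm (fun ξ => (2 * Real.pi * ‖ξ‖) ^ N * ‖g ξ‖) r' volume ≤ C * gradNorm N r T := by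
  obtain ⟨C, hC0, hC⟩ := exists_hasFourier_of_lpNorm_lt_top (p := r) (p' := r') hr
  have hr1' : 1 ≤ r' := ENNReal.HolderConjugate.one_le r' r
  refine ⟨C, hC0, fun T g hg => ?_⟩
  rcases eq_or_ne (gradNorm N r T) ⊤ with ht | ht
  · rw [ht, ENNReal.mul_top (by exact_mod_cast hC0.ne')]; exact le_top
  have hfin : ∀ α : Fin N → Fin 3, lpNorm r (iterD α T) < ⊤ := fun α =>
    (ENNReal.sum_ne_top.1 ht α (Finset.mem_univ α)).lt_top
  choose G hG hGT hGC using fun α => hC (iterD α T) (hfin α)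
  have hGg : ∀ α, G α =ᵐ[volume] fun ξ => freqProd α ξ * g ξ := fun α =>
    (hGT α).ae_eq (hg.iterD α)
  have hle : ∀ᵐ ξ, ‖(2 * Real.pi * ‖ξ‖) ^ N * ‖g ξ‖‖ ≤ ‖∑ α, ‖G α ξ‖‖ := by
    filter_upwards [ae_all_iff.2 hGg] with ξ hξ
    rw [Real.norm_of_nonneg (by positivity), Real.norm_of_nonneg (by positivity)]
    simp only [hξ, norm_mul, ← Finset.sum_mul]
    gcongr
    exact pow_le_sum_norm_freqProd N ξ
  refine (eLpNorm_mono_ae hle).trans ?_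
  have hs := eLpNorm_sum_le (s := Finset.univ) (f := fun α ξ => ‖G α ξ‖) (μ := volume)
    (fun α _ => (hG α).1.norm) hr1'
  have e : (fun ξ => ∑ α, ‖G α ξ‖) = ∑ α, fun ξ => ‖G α ξ‖ := by
    funext ξ; simp
  rw [e]
  refine hs.trans ?_
  rw [gradNorm, Finset.mul_sum]
  exact Finset.sum_le_sum fun α _ => (eLpNorm_norm _).trans_le (hGC α)

/-- Bounds in `L^q` from bounds of the Fourier transform. -/
theorem exists_gradNorm_le {q q' : ℝ≥0∞} (hq : 2 ≤ q) [hqq : ENNReal.HolderConjugate q q']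
    (m : ℕ) :
    ∃ C : ℝ≥0, 0 < C ∧ ∀ (T : Dist) (v : R3 → ℂ) (G : R3 → ℝ), AEStronglyMeasurable v volume →
      (∀ φ : 𝓢(R3, ℂ), HasCompactSupport φ → fhat T φ = ∫ ξ, φ ξ * v ξ) →
      (∀ᵐ ξ, (2 * Real.pi * ‖ξ‖) ^ m * ‖v ξ‖ ≤ G ξ) →
      gradNorm m q T ≤ C * eLpNorm G q' volume := by
  have hq1' : 1 ≤ q' := ENNReal.HolderConjugate.one_le q' q
  have hq' : q' ≤ 2 := by
    have h1 := hqq.inv_add_inv_eq_inv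
    have h2 : (2 : ℝ≥0∞)⁻¹ ≤ q'⁻¹ := by
      have h3 : q⁻¹ ≤ (2 : ℝ≥0∞)⁻¹ := ENNReal.inv_le_inv.2 hq
      have h4 : (2 : ℝ≥0∞)⁻¹ + 2⁻¹ ≤ 2⁻¹ + q'⁻¹ := by
        rw [ENNReal.inv_two_add_inv_two, ← inv_one, ← h1]
        gcongr
      exact (ENNReal.add_le_add_iff_left (by norm_num)).1 h4
    exact ENNReal.inv_le_inv.1 h2
  obtain ⟨C, hC⟩ := hausdorff_young (V := R3) (p := q') (p' := q) hq'
  refine ⟨3 ^ m * C + 1, by positivity, fun T v G hv hT hvG => ?_⟩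
  rcases eq_or_ne (eLpNorm G q' volume) ⊤ with ht | ht
  · rw [ht, ENNReal.mul_top (by simp)]; exact le_top
  have key : ∀ α : Fin m → Fin 3, lpNorm q (iterD α T) ≤ C * eLpNorm G q' volume := by
    intro α
    set w : R3 → ℂ := fun ξ => freqProd α ξ * v ξ with hw
    have hwm : AEStronglyMeasurable w volume := (continuous_freqProd α).aestronglyMeasurable.mul hv
    have hwG : eLpNorm w q' volume ≤ eLpNorm G q' volume := by
      refine eLpNorm_mono_ae ?_
      filter_upwards [hvG] with ξ hξ
      rw [hw, norm_mul]
      refine le_trans (mul_le_mul_of_nonneg_right (norm_freqProd_le α ξ) (norm_nonneg _)) ?_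
      exact hξ.trans (le_abs_self _)
    have hwL : MemLp w q' volume := ⟨hwm, hwG.trans_lt (lt_top_iff_ne_top.2 ht)⟩
    obtain ⟨g, hg, hgC, hgw⟩ := hC w hwL
    -- Both sides are continuous in the test function, the right one because `w` lies in L^{q'}, and
    -- they agree on the dense set of compactly supported ones.
    have hall : ∀ φ : 𝓢(R3, ℂ), fhat (iterD α T) φ = ∫ ξ, φ ξ * w ξ := by
      intro φ
      have : Fact (1 ≤ q') := ⟨hq1'⟩
      have hcont : Continuous fun ψ : 𝓢(R3, ℂ) => ∫ ξ, ψ ξ * w ξ := by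
        have h1 := (Lp.toTemperedDistribution (hwL.toLp w)).cont
        refine h1.congr fun ψ => ?_
        refine (Lp.toTemperedDistribution_apply _ ψ).trans (integral_congr_ae ?_)
        filter_upwards [hwL.coeFn_toLp] with ξ hξ
        rw [hξ, smul_eq_mul]
      obtain ⟨ψ, hψc, hψ⟩ := SchwartzMap.exists_tendsto_hasCompactSupport φ
      have l1 := ((fhat (iterD α T)).cont.tendsto φ).comp hψ
      have l2 := (hcont.tendsto φ).comp hψ
      refine tendsto_nhds_unique l1 (l2.congr fun n => ?_)
      obtain ⟨χ, hχ1, hχ2, hχ3⟩ := exists_mulFreq_iterate α T (ψ n)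
      change ∫ ξ, ψ n ξ * w ξ = fhat (iterD α T) (ψ n)
      rw [hχ1, hT χ (hχ3 (hψc n))]
      refine integral_congr_ae (ae_of_all _ fun ξ => ?_)
      simp only [hχ2, hw]; ring
    have hneg : MeasurePreserving (fun x : R3 => -x) volume volume :=
      Measure.measurePreserving_neg volume
    have hgn : MemLp (fun x => g (-x)) q volume := hg.comp_measurePreserving hneg
    -- Hausdorff-Young transforms `w` forward once more, so the function obtained is the reflection
    -- of the derivative sought.
    have hrep : Represents (fun x => g (-x)) (iterD α T) := by
      intro φ
      set ψ : 𝓢(R3, ℂ) := SchwartzMap.compCLMOfContinuousLinearEquiv ℂ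
        (ContinuousLinearEquiv.neg ℝ (M := R3)) φ with hψ
      have e1 : 𝓕 ψ = 𝓕⁻ φ := by
        ext x
        rw [SchwartzMap.fourierInv_coe, SchwartzMap.fourier_coe, Real.fourierInv_eq_fourier_comp_neg]
        congr 1
      have e2 : iterD α T φ = fhat (iterD α T) (𝓕⁻ φ) := by
        rw [fhat_apply, FourierTransform.fourier_fourierInv_eq]
      rw [e2, hall, ← e1, hgw ψ, ← integral_neg_eq_self]
      refine integral_congr_ae (ae_of_all _ fun x => ?_)
      simp [hψ]
    refine (iInf₂_le _ ⟨hgn, hrep⟩).trans ?_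
    have e3 : eLpNorm (fun x => g (-x)) q volume = eLpNorm g q volume :=
      eLpNorm_comp_measurePreserving hg.1 hneg
    rw [e3]
    exact hgC.trans (by gcongr)
  rw [gradNorm]
  refine (Finset.sum_le_sum fun α _ => key α).trans ?_
  rw [Finset.sum_const, Finset.card_univ, Fintype.card_fun, Fintype.card_fin, Fintype.card_fin,
    nsmul_eq_mul, ← mul_assoc]
  gcongr
  push_cast
  exact le_self_add

end FourierSide

/-! ### The three closed systems on the Fourier side -/

section FourierSystems

open scoped FourierTransform

theorem HasTimeDerivAt.fhat {T : ℝ → Dist} {T' : Dist} {t : ℝ} (h : HasTimeDerivAt T T' t)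
    (φ : 𝓢(R3, ℂ)) : HasDerivAt (fun s => fhat (T s) φ) (EulerMaxwell.fhat T' φ) t :=
  h (𝓕 φ)

theorem HasTimeDerivAt.partialD {T : ℝ → Dist} {T' : Dist} {t : ℝ} (h : HasTimeDerivAt T T' t)
    (j : Fin 3) : HasTimeDerivAt (fun s => partialD j (T s)) (partialD j T') t :=
  fun _ => h _

theorem HasTimeDerivAt.add {S T : ℝ → Dist} {S' T' : Dist} {t : ℝ} (hS : HasTimeDerivAt S S' t)
    (hT : HasTimeDerivAt T T' t) : HasTimeDerivAt (fun s => S s + T s) (S' + T') t :=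
  fun φ => (hS φ).add (hT φ)

theorem HasTimeDerivAt.sub {S T : ℝ → Dist} {S' T' : Dist} {t : ℝ} (hS : HasTimeDerivAt S S' t)
    (hT : HasTimeDerivAt T T' t) : HasTimeDerivAt (fun s => S s - T s) (S' - T') t :=
  fun φ => (hS φ).sub (hT φ)

theorem divD_eq (v : Fin 3 → Dist) :
    divD v = partialD 0 (v 0) + partialD 1 (v 1) + partialD 2 (v 2) := Fin.sum_univ_three _

theorem HasTimeDerivAt.divD {v : ℝ → Fin 3 → Dist} {v' : Fin 3 → Dist} {t : ℝ}
    (h : ∀ j, HasTimeDerivAt (fun s => v s j) (v' j) t) :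
    HasTimeDerivAt (fun s => divD (v s)) (divD v') t := by
  simp only [divD_eq]
  exact (((h 0).partialD 0).add ((h 1).partialD 1)).add ((h 2).partialD 2)

theorem HasTimeDerivAt.curlD {v : ℝ → Fin 3 → Dist} {v' : Fin 3 → Dist} {t : ℝ}
    (h : ∀ j, HasTimeDerivAt (fun s => v s j) (v' j) t) (j : Fin 3) :
    HasTimeDerivAt (fun s => curlD (v s) j) (curlD v' j) t := by
  fin_cases j
  · exact ((h 2).partialD 1).sub ((h 1).partialD 2)
  · exact ((h 0).partialD 2).sub ((h 2).partialD 0)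
  · exact ((h 1).partialD 0).sub ((h 0).partialD 1)

namespace ContinuousAtZero

variable {S T : ℝ → Dist}

theorem fhat (h : ContinuousAtZero T) (φ : 𝓢(R3, ℂ)) :
    Tendsto (fun s => fhat (T s) φ) (𝓝[>] 0) (𝓝 (fhat (T 0) φ)) :=
  h (𝓕 φ)

theorem partialD (h : ContinuousAtZero T) (j : Fin 3) :
    ContinuousAtZero (fun s => partialD j (T s)) :=
  fun _ => h _

theorem add (hS : ContinuousAtZero S) (hT : ContinuousAtZero T) :
    ContinuousAtZero (fun s => S s + T s) :=
  fun φ => (hS φ).add (hT φ)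

theorem sub (hS : ContinuousAtZero S) (hT : ContinuousAtZero T) :
    ContinuousAtZero (fun s => S s - T s) :=
  fun φ => (hS φ).sub (hT φ)

theorem divD {v : ℝ → Fin 3 → Dist} (h : ∀ j, ContinuousAtZero (fun s => v s j)) :
    ContinuousAtZero (fun s => divD (v s)) := by
  simp only [divD_eq]
  exact (((h 0).partialD 0).add ((h 1).partialD 1)).add ((h 2).partialD 2)

theorem curlD {v : ℝ → Fin 3 → Dist} (h : ∀ j, ContinuousAtZero (fun s => v s j)) (j : Fin 3) :
    ContinuousAtZero (fun s => curlD (v s) j) := by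
  fin_cases j
  · exact ((h 2).partialD 1).sub ((h 1).partialD 2)
  · exact ((h 0).partialD 2).sub ((h 2).partialD 0)
  · exact ((h 1).partialD 0).sub ((h 0).partialD 1)

end ContinuousAtZero

namespace HasFourier

variable {v : Fin 3 → Dist} {g : Fin 3 → R3 → ℂ}

theorem exists_divD (h : ∀ j, HasFourier (v j) (g j)) :
    ∃ f, HasFourier (EulerMaxwell.divD v) f ∧
      ∀ ξ, ‖f ξ‖ ≤ 2 * Real.pi * ‖ξ‖ * ∑ j, ‖g j ξ‖ := by
  refine ⟨_, HasFourier.divD h, fun ξ => ?_⟩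
  rw [Fin.sum_univ_three, mul_add, mul_add]
  refine norm_add₃_le.trans (add_le_add (add_le_add ?_ ?_) ?_) <;>
  · rw [norm_mul]
    exact mul_le_mul_of_nonneg_right (norm_freq_le _ ξ) (norm_nonneg _)

theorem exists_curlD (h : ∀ j, HasFourier (v j) (g j)) (j : Fin 3) :
    ∃ f, HasFourier (curlD v j) f ∧ ∀ ξ, ‖f ξ‖ ≤ 2 * Real.pi * ‖ξ‖ * ∑ j, ‖g j ξ‖ := by
  have key : ∀ a b c d : Fin 3, b ≠ d →
      ∃ f, HasFourier (EulerMaxwell.partialD a (v b) - EulerMaxwell.partialD c (v d)) f ∧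
        ∀ ξ, ‖f ξ‖ ≤ 2 * Real.pi * ‖ξ‖ * ∑ j, ‖g j ξ‖ := by
    intro a b c d hbd
    refine ⟨_, ((h b).partialD a).sub ((h d).partialD c), fun ξ => ?_⟩
    refine (norm_sub_le _ _).trans ?_
    have h1 : ‖g b ξ‖ + ‖g d ξ‖ ≤ ∑ j, ‖g j ξ‖ := by
      rw [← Finset.sum_pair hbd (f := fun j => ‖g j ξ‖)]
      exact Finset.sum_le_univ_sum_of_nonneg fun _ => norm_nonneg _
    rw [norm_mul, norm_mul]
    refine le_trans (add_le_add (mul_le_mul_of_nonneg_right (norm_freq_le a ξ) (norm_nonneg _))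
      (mul_le_mul_of_nonneg_right (norm_freq_le c ξ) (norm_nonneg _))) ?_
    rw [← mul_add]
    gcongr
  fin_cases j
  · exact key 1 2 2 1 (by decide)
  · exact key 2 0 0 2 (by decide)
  · exact key 0 1 1 0 (by decide)

end HasFourier

/-- `T` has the Fourier transform `v` when tested against functions of compact support. -/
structure HasFourierOnCompact (T : Dist) (v : R3 → ℂ) : Prop where
  aestronglyMeasurable : AEStronglyMeasurable v volume
  eq : ∀ φ : 𝓢(R3, ℂ), HasCompactSupport φ → fhat T φ = ∫ ξ, φ ξ * v ξ

theorem _root_.IsSymbolSolution.hasFourierOnCompact {n : ℕ}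
    {A : R3 → Matrix (Fin n) (Fin n) ℂ} {T : ℝ → Fin n → Dist}
    (h : IsSymbolSolution A (fun s i => fhat (T s i))) {f : Fin n → R3 → ℂ}
    (hf : ∀ i, HasFourier (T 0 i) (f i)) {t : ℝ} (ht : 0 ≤ t) (i : Fin n) :
    HasFourierOnCompact (T t i)
      (fun ξ => (NormedSpace.exp (t • A ξ)).mulVec (fun j => f j ξ) i) where
  aestronglyMeasurable := by
    simp only [Matrix.mulVec, dotProduct]
    refine Finset.aestronglyMeasurable_fun_sum _ fun j _ => ?_
    exact ((IsSymbolSolution.continuous_exp_smul h.growth t).matrix_elem i j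
      |>.aestronglyMeasurable).mul (hf j).locallyIntegrable.aestronglyMeasurable
  eq φ hφ := h.eq_integral_exp f (fun j => (hf j).locallyIntegrable) (fun j => (hf j).eq) ht i φ hφ

/-- The symbol of `-Δ`. -/
noncomputable def lap (ξ : R3) : ℂ := ((2 * Real.pi * ‖ξ‖ : ℝ) : ℂ) ^ 2

theorem lap_eq (ξ : R3) :
    lap ξ = -(freq 0 ξ * freq 0 ξ + freq 1 ξ * freq 1 ξ + freq 2 ξ * freq 2 ξ) := by
  have h : (‖ξ‖ : ℂ) ^ 2 = (ξ 0 : ℂ) ^ 2 + (ξ 1 : ℂ) ^ 2 + (ξ 2 : ℂ) ^ 2 := by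
    have := EuclideanSpace.real_norm_sq_eq ξ
    rw [Fin.sum_univ_three] at this
    exact_mod_cast this
  simp only [lap, freq]
  push_cast
  linear_combination (4 * (Real.pi : ℂ) ^ 2) * h + 4 * (Real.pi : ℂ) ^ 2 *
    ((ξ 0 : ℂ) ^ 2 + (ξ 1 : ℂ) ^ 2 + (ξ 2 : ℂ) ^ 2) * Complex.I_sq

theorem hasTemperateGrowth_lap : lap.HasTemperateGrowth := by
  have h := fun j => (hasTemperateGrowth_freq j).mul (hasTemperateGrowth_freq j)
  have e : lap = -(freq 0 * freq 0 + freq 1 * freq 1 + freq 2 * freq 2) := funext lap_eq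
  rw [e]
  exact (((h 0).add (h 1)).add (h 2)).neg

/-- Multiplication of a Schwartz function by the symbol of `-Δ`. -/
noncomputable def mulLap (φ : 𝓢(R3, ℂ)) : 𝓢(R3, ℂ) :=
  -(mulFreq 0 (mulFreq 0 φ) + mulFreq 1 (mulFreq 1 φ) + mulFreq 2 (mulFreq 2 φ))

theorem smulLeft_lap (φ : 𝓢(R3, ℂ)) :
    SchwartzMap.smulLeftCLM ℂ (fun ξ => lap ξ) φ = mulLap φ := by
  ext ξ
  rw [SchwartzMap.smulLeftCLM_apply_apply hasTemperateGrowth_lap, smul_eq_mul, lap_eq, mulLap]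
  simp only [neg_apply, add_apply, mulFreq_apply]
  ring

theorem smulLeft_neg_lap (φ : 𝓢(R3, ℂ)) :
    SchwartzMap.smulLeftCLM ℂ (fun ξ => -lap ξ) φ = -mulLap φ := by
  rw [SchwartzMap.smulLeftCLM_fun_neg hasTemperateGrowth_lap, ← smulLeft_lap]; rfl

theorem smulLeft_one_add_lap (φ : 𝓢(R3, ℂ)) :
    SchwartzMap.smulLeftCLM ℂ (fun ξ => 1 + lap ξ) φ = φ + mulLap φ := by
  have h : (fun ξ => 1 + lap ξ).HasTemperateGrowth :=
    (Function.HasTemperateGrowth.const 1).add hasTemperateGrowth_lap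
  ext ξ
  rw [← smulLeft_lap, SchwartzMap.smulLeftCLM_apply_apply h, add_apply,
    SchwartzMap.smulLeftCLM_apply_apply hasTemperateGrowth_lap, add_smul, one_smul]

theorem smulLeft_freq (j : Fin 3) (φ : 𝓢(R3, ℂ)) :
    SchwartzMap.smulLeftCLM ℂ (fun ξ => freq j ξ) φ = mulFreq j φ := rfl

theorem smulLeft_neg_freq (j : Fin 3) (φ : 𝓢(R3, ℂ)) :
    SchwartzMap.smulLeftCLM ℂ (fun ξ => -freq j ξ) φ = -mulFreq j φ := by
  rw [SchwartzMap.smulLeftCLM_fun_neg (hasTemperateGrowth_freq j)]; rfl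

theorem mulFreq_comm (j k : Fin 3) (φ : 𝓢(R3, ℂ)) :
    mulFreq j (mulFreq k φ) = mulFreq k (mulFreq j φ) := by
  ext ξ
  simp only [mulFreq_apply]
  ring

theorem fhat_curlD_zero (v : Fin 3 → Dist) (φ : 𝓢(R3, ℂ)) :
    fhat (curlD v 0) φ = fhat (v 2) (mulFreq 1 φ) - fhat (v 1) (mulFreq 2 φ) := by
  rw [← fhat_partialD, ← fhat_partialD]; rfl

theorem fhat_curlD_one (v : Fin 3 → Dist) (φ : 𝓢(R3, ℂ)) :
    fhat (curlD v 1) φ = fhat (v 0) (mulFreq 2 φ) - fhat (v 2) (mulFreq 0 φ) := by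
  rw [← fhat_partialD, ← fhat_partialD]; rfl

theorem fhat_curlD_two (v : Fin 3 → Dist) (φ : 𝓢(R3, ℂ)) :
    fhat (curlD v 2) φ = fhat (v 1) (mulFreq 0 φ) - fhat (v 0) (mulFreq 1 φ) := by
  rw [← fhat_partialD, ← fhat_partialD]; rfl

/-- This is curl curl = ∇ div - Δ, through which both divergence constraints enter. -/
theorem fhat_curlD_curlD (v : Fin 3 → Dist) (j : Fin 3) (φ : 𝓢(R3, ℂ)) :
    fhat (curlD (curlD v) j) φ = fhat (divD v) (mulFreq j φ) + fhat (v j) (mulLap φ) := by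
  fin_cases j <;>
  · simp only [Fin.zero_eta, Fin.mk_one, Fin.reduceFinMk, fhat_curlD_zero, fhat_curlD_one,
      fhat_curlD_two, fhat_divD, mulLap, map_neg, map_add]
    simp only [mulFreq_comm 1 0, mulFreq_comm 2 0, mulFreq_comm 2 1]
    ring

theorem fhat_curlD_velocity (ρ Θ : Dist) (E u : Fin 3 → Dist) (j : Fin 3) (φ : 𝓢(R3, ℂ)) :
    fhat (curlD (fun j => -partialD j ρ - partialD j Θ - E j - u j) j) φ =
      -fhat (curlD E j) φ - fhat (curlD u j) φ := by
  fin_cases j <;>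
  · simp only [Fin.zero_eta, Fin.mk_one, Fin.reduceFinMk, fhat_curlD_zero, fhat_curlD_one,
      fhat_curlD_two, fhat_sub, fhat_neg, fhat_partialD]
    simp only [mulFreq_comm 1 0, mulFreq_comm 2 0, mulFreq_comm 2 1]
    ring

theorem fhat_curlD_add (v w : Fin 3 → Dist) (j : Fin 3) (φ : 𝓢(R3, ℂ)) :
    fhat (curlD (fun j => v j + w j) j) φ = fhat (curlD v j) φ + fhat (curlD w j) φ := by
  fin_cases j <;>
  · simp only [Fin.zero_eta, Fin.mk_one, Fin.reduceFinMk, fhat_curlD_zero, fhat_curlD_one,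
      fhat_curlD_two, fhat_add]
    ring

theorem fhat_curlD_neg (v : Fin 3 → Dist) (j : Fin 3) (φ : 𝓢(R3, ℂ)) :
    fhat (curlD (fun j => -v j) j) φ = -fhat (curlD v j) φ := by
  fin_cases j <;>
  · simp only [Fin.zero_eta, Fin.mk_one, Fin.reduceFinMk, fhat_curlD_zero, fhat_curlD_one,
      fhat_curlD_two, fhat_neg]
    ring

/-- The constraint turns the term -∇·E into ρ, which is the 1 in the entry 1 + κ² of the
longitudinal block and keeps it damped at low frequencies. -/
theorem fhat_divD_velocity (ρ Θ : Dist) (E u : Fin 3 → Dist) (hE : divD E = -ρ)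
    (φ : 𝓢(R3, ℂ)) :
    fhat (divD (fun j => -partialD j ρ - partialD j Θ - E j - u j)) φ =
      fhat ρ (φ + mulLap φ) + fhat Θ (mulLap φ) - fhat (divD u) φ := by
  have h : fhat (divD E) φ = -fhat ρ φ := by rw [hE, fhat_neg]
  rw [fhat_divD] at h
  simp only [fhat_divD, fhat_sub, fhat_neg, fhat_partialD, mulLap, map_neg, map_add]
  linear_combination -h

variable {U₀ : State} {U : ℝ → State}

/-- The symbol of the system for the density, the divergence of the velocity and the
temperature. -/
noncomputable def longitudinalSymbol (ξ : R3) : Matrix (Fin 3) (Fin 3) ℂ :=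
  !![0, -1, 0; 1 + lap ξ, -1, lap ξ; 0, -(2 / 3), -1]

theorem IsSolution.longitudinalSymbol (h : IsSolution U₀ U) :
    IsSymbolSolution longitudinalSymbol
      (fun s i => fhat (![(U s).ρ, divD (U s).u, (U s).Θ] i)) where
  growth i j := by
    have hc : ∀ c : ℂ, (fun _ : R3 => c).HasTemperateGrowth := Function.HasTemperateGrowth.const
    fin_cases i <;> fin_cases j <;>
    first
    | exact hc _
    | exact hasTemperateGrowth_lap
    | exact (hc 1).add hasTemperateGrowth_lap
  deriv t ht i φ := by
    fin_cases i
    · refine ((h.eq_ρ t ht).fhat φ).congr_deriv ?_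
      simp [Fin.sum_univ_three, EulerMaxwell.longitudinalSymbol, fhat_neg]
    · refine ((HasTimeDerivAt.divD (h.eq_u t ht)).fhat φ).congr_deriv ?_
      rw [fhat_divD_velocity _ _ _ _ (h.constraint t ht).1]
      simp [Fin.sum_univ_three, EulerMaxwell.longitudinalSymbol, smulLeft_lap,
        smulLeft_one_add_lap]
      ring
    · refine ((h.eq_Θ t ht).fhat φ).congr_deriv ?_
      simp [Fin.sum_univ_three, EulerMaxwell.longitudinalSymbol, fhat_neg,
        fhat_sub, fhat_smul]
      ring
  tendsto i φ := by
    fin_cases i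
    · exact h.cont_ρ.fhat φ
    · exact (ContinuousAtZero.divD h.cont_u).fhat φ
    · exact h.cont_Θ.fhat φ

/-- The symbol of the system for a component of the curl of the velocity, of the curl of the
electric field and of the magnetic field. -/
noncomputable def magneticSymbol (ξ : R3) : Matrix (Fin 3) (Fin 3) ℂ :=
  !![-1, -1, 0; 1, 0, lap ξ; 0, -1, 0]

/-- The curl removes the gradients of density and temperature, and ∇·B = 0 reduces curl curl B to
-ΔB, so the system closes. -/
theorem IsSolution.magneticSymbol (h : IsSolution U₀ U) (j : Fin 3) :
    IsSymbolSolution magneticSymbol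
      (fun s i => fhat (![curlD (U s).u j, curlD (U s).E j, (U s).B j] i)) where
  growth i j := by
    have hc : ∀ c : ℂ, (fun _ : R3 => c).HasTemperateGrowth := Function.HasTemperateGrowth.const
    fin_cases i <;> fin_cases j <;>
    first
    | exact hc _
    | exact hasTemperateGrowth_lap
  deriv t ht i φ := by
    fin_cases i
    · refine ((HasTimeDerivAt.curlD (h.eq_u t ht) j).fhat φ).congr_deriv ?_
      rw [fhat_curlD_velocity]
      simp [Fin.sum_univ_three, EulerMaxwell.magneticSymbol]
      ring
    · refine ((HasTimeDerivAt.curlD (h.eq_E t ht) j).fhat φ).congr_deriv ?_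
      rw [fhat_curlD_add, fhat_curlD_curlD, (h.constraint t ht).2, fhat_zero]
      simp [Fin.sum_univ_three, EulerMaxwell.magneticSymbol, smulLeft_lap]
      ring
    · refine ((h.eq_B t ht j).fhat φ).congr_deriv ?_
      simp [Fin.sum_univ_three, EulerMaxwell.magneticSymbol, fhat_neg]
  tendsto i φ := by
    fin_cases i
    · exact (ContinuousAtZero.curlD h.cont_u j).fhat φ
    · exact (ContinuousAtZero.curlD h.cont_E j).fhat φ
    · exact (h.cont_B j).fhat φ

/-- The symbol of the system for the density, the divergence of the velocity, the temperature, and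
the components in the direction `j` of the velocity, of the electric field and of the curl of the
magnetic field. -/
noncomputable def componentSymbol (j : Fin 3) (ξ : R3) : Matrix (Fin 6) (Fin 6) ℂ :=
  !![0, -1, 0, 0, 0, 0;
     1 + lap ξ, -1, lap ξ, 0, 0, 0;
     0, -(2 / 3), -1, 0, 0, 0;
     -freq j ξ, 0, -freq j ξ, -1, -1, 0;
     0, 0, 0, 1, 0, 1;
     freq j ξ, 0, 0, 0, -lap ξ, 0]

/-- Keeping one Cartesian component beside the longitudinal unknowns gives a closed system with
smooth symbol. A Helmholtz projection at this stage would introduce multipliers singular at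
frequency 0; the splitting is made only pointwise, after the representation formula. -/
theorem IsSolution.componentSymbol (h : IsSolution U₀ U) (j : Fin 3) :
    IsSymbolSolution (componentSymbol j)
      (fun s i => fhat (![(U s).ρ, divD (U s).u, (U s).Θ, (U s).u j, (U s).E j,
        curlD (U s).B j] i)) where
  growth i k := by
    have hc : ∀ c : ℂ, (fun _ : R3 => c).HasTemperateGrowth := Function.HasTemperateGrowth.const
    fin_cases i <;> fin_cases k <;>
    first
    | exact hc _
    | exact hasTemperateGrowth_lap
    | exact hasTemperateGrowth_lap.neg
    | exact hasTemperateGrowth_freq j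
    | exact (hasTemperateGrowth_freq j).neg
    | exact (hc 1).add hasTemperateGrowth_lap
  deriv t ht i φ := by
    fin_cases i
    · refine ((h.eq_ρ t ht).fhat φ).congr_deriv ?_
      simp [Fin.sum_univ_six, EulerMaxwell.componentSymbol, fhat_neg]
    · refine ((HasTimeDerivAt.divD (h.eq_u t ht)).fhat φ).congr_deriv ?_
      rw [fhat_divD_velocity _ _ _ _ (h.constraint t ht).1]
      simp [Fin.sum_univ_six, EulerMaxwell.componentSymbol, smulLeft_lap,
        smulLeft_one_add_lap]
      ring
    · refine ((h.eq_Θ t ht).fhat φ).congr_deriv ?_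
      simp [Fin.sum_univ_six, EulerMaxwell.componentSymbol, fhat_neg,
        fhat_sub, fhat_smul]
      ring
    · refine ((h.eq_u t ht j).fhat φ).congr_deriv ?_
      simp [Fin.sum_univ_six, EulerMaxwell.componentSymbol, fhat_neg,
        fhat_sub, fhat_partialD, smulLeft_neg_freq]
      ring
    · refine ((h.eq_E t ht j).fhat φ).congr_deriv ?_
      simp [Fin.sum_univ_six, EulerMaxwell.componentSymbol, fhat_add]
      ring
    · refine ((HasTimeDerivAt.curlD (h.eq_B t ht) j).fhat φ).congr_deriv ?_
      rw [fhat_curlD_neg, fhat_curlD_curlD, (h.constraint t ht).1, fhat_neg]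
      simp [Fin.sum_univ_six, EulerMaxwell.componentSymbol, smulLeft_neg_lap,
        smulLeft_freq]
      ring
  tendsto i φ := by
    fin_cases i
    · exact h.cont_ρ.fhat φ
    · exact (ContinuousAtZero.divD h.cont_u).fhat φ
    · exact h.cont_Θ.fhat φ
    · exact (h.cont_u j).fhat φ
    · exact (h.cont_E j).fhat φ
    · exact (ContinuousAtZero.curlD h.cont_B j).fhat φ

end FourierSystems

/-! ### Pointwise bounds for the Fourier transforms of solutions -/

section FrequencySolutions

open scoped NNReal

variable {U₀ : State} {U : ℝ → State} {gρ gΘ : R3 → ℂ} {gu gE gB : Fin 3 → R3 → ℂ}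

theorem longitudinalSystem_exp (ξ : R3) (f : Fin 3 → ℂ) :
    LongitudinalSystem (2 * Real.pi * ‖ξ‖)
      (fun s => (NormedSpace.exp (s • longitudinalSymbol ξ)).mulVec f 0)
      (fun s => (NormedSpace.exp (s • longitudinalSymbol ξ)).mulVec f 1)
      (fun s => (NormedSpace.exp (s • longitudinalSymbol ξ)).mulVec f 2) where
  hρ s := by
    refine (hasDerivAt_exp_smul_mulVec (longitudinalSymbol ξ) f s 0).congr_deriv ?_
    generalize (NormedSpace.exp (s • longitudinalSymbol ξ)).mulVec f = w
    simp [longitudinalSymbol, Matrix.mulVec, dotProduct, Fin.sum_univ_three]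
  hd s := by
    refine (hasDerivAt_exp_smul_mulVec (longitudinalSymbol ξ) f s 1).congr_deriv ?_
    generalize (NormedSpace.exp (s • longitudinalSymbol ξ)).mulVec f = w
    change _ = (1 + lap ξ) * w 0 + lap ξ * w 2 - w 1
    simp [longitudinalSymbol, Matrix.mulVec, dotProduct, Fin.sum_univ_three]
    ring
  hΘ s := by
    refine (hasDerivAt_exp_smul_mulVec (longitudinalSymbol ξ) f s 2).congr_deriv ?_
    generalize (NormedSpace.exp (s • longitudinalSymbol ξ)).mulVec f = w
    simp [longitudinalSymbol, Matrix.mulVec, dotProduct, Fin.sum_univ_three]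
    ring

theorem magneticSystem_exp (ξ : R3) (f : Fin 3 → ℂ) :
    MagneticSystem (2 * Real.pi * ‖ξ‖)
      (fun s => (NormedSpace.exp (s • magneticSymbol ξ)).mulVec f 0)
      (fun s => (NormedSpace.exp (s • magneticSymbol ξ)).mulVec f 1)
      (fun s => (NormedSpace.exp (s • magneticSymbol ξ)).mulVec f 2) where
  hω s := by
    refine (hasDerivAt_exp_smul_mulVec (magneticSymbol ξ) f s 0).congr_deriv ?_
    generalize (NormedSpace.exp (s • magneticSymbol ξ)).mulVec f = w
    simp [magneticSymbol, Matrix.mulVec, dotProduct, Fin.sum_univ_three]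
    ring
  hη s := by
    refine (hasDerivAt_exp_smul_mulVec (magneticSymbol ξ) f s 1).congr_deriv ?_
    generalize (NormedSpace.exp (s • magneticSymbol ξ)).mulVec f = w
    change _ = w 0 + lap ξ * w 2
    simp [magneticSymbol, Matrix.mulVec, dotProduct, Fin.sum_univ_three]
  hB s := by
    refine (hasDerivAt_exp_smul_mulVec (magneticSymbol ξ) f s 2).congr_deriv ?_
    generalize (NormedSpace.exp (s • magneticSymbol ξ)).mulVec f = w
    simp [magneticSymbol, Matrix.mulVec, dotProduct, Fin.sum_univ_three]

theorem componentSystem_exp (j : Fin 3) (ξ : R3) (f : Fin 6 → ℂ) :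
    ComponentSystem (2 * Real.pi * ‖ξ‖) (2 * Real.pi * ξ j)
      (fun s => (NormedSpace.exp (s • componentSymbol j ξ)).mulVec f 0)
      (fun s => (NormedSpace.exp (s • componentSymbol j ξ)).mulVec f 1)
      (fun s => (NormedSpace.exp (s • componentSymbol j ξ)).mulVec f 2)
      (fun s => (NormedSpace.exp (s • componentSymbol j ξ)).mulVec f 3)
      (fun s => (NormedSpace.exp (s • componentSymbol j ξ)).mulVec f 4)
      (fun s => (NormedSpace.exp (s • componentSymbol j ξ)).mulVec f 5) := by
  have hfreq : Complex.I * ((2 * Real.pi * ξ j : ℝ) : ℂ) = freq j ξ := by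
    rw [freq]; push_cast; ring
  have key := hasDerivAt_exp_smul_mulVec (componentSymbol j ξ) f
  refine ⟨⟨fun s => ?_, fun s => ?_, fun s => ?_⟩, fun s => ?_, fun s => ?_, fun s => ?_⟩
  · refine (key s 0).congr_deriv ?_
    generalize (NormedSpace.exp (s • componentSymbol j ξ)).mulVec f = w
    simp [componentSymbol, Matrix.mulVec, dotProduct, Fin.sum_univ_six]
  · refine (key s 1).congr_deriv ?_
    generalize (NormedSpace.exp (s • componentSymbol j ξ)).mulVec f = w
    change _ = (1 + lap ξ) * w 0 + lap ξ * w 2 - w 1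
    simp [componentSymbol, Matrix.mulVec, dotProduct, Fin.sum_univ_six]
    ring
  · refine (key s 2).congr_deriv ?_
    generalize (NormedSpace.exp (s • componentSymbol j ξ)).mulVec f = w
    simp [componentSymbol, Matrix.mulVec, dotProduct, Fin.sum_univ_six]
    ring
  · refine (key s 3).congr_deriv ?_
    generalize (NormedSpace.exp (s • componentSymbol j ξ)).mulVec f = w
    rw [hfreq]
    simp [componentSymbol, Matrix.mulVec, dotProduct, Fin.sum_univ_six]
    ring
  · refine (key s 4).congr_deriv ?_
    generalize (NormedSpace.exp (s • componentSymbol j ξ)).mulVec f = w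
    simp [componentSymbol, Matrix.mulVec, dotProduct, Fin.sum_univ_six]
    ring
  · refine (key s 5).congr_deriv ?_
    generalize (NormedSpace.exp (s • componentSymbol j ξ)).mulVec f = w
    rw [hfreq]
    change _ = -(lap ξ * w 4) + freq j ξ * w 0
    simp [componentSymbol, Matrix.mulVec, dotProduct, Fin.sum_univ_six]
    ring

theorem exp_zero_smul_mulVec {n : ℕ} (A : Matrix (Fin n) (Fin n) ℂ) (f : Fin n → ℂ) :
    (NormedSpace.exp ((0 : ℝ) • A)).mulVec f = f := by
  rw [zero_smul, NormedSpace.exp_zero, Matrix.one_mulVec]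

theorem ae_norm_pos : ∀ᵐ ξ : R3, 0 < 2 * Real.pi * ‖ξ‖ := by
  have : ∀ᵐ ξ : R3, ξ ≠ 0 := by
    rw [ae_iff]
    simp
  filter_upwards [this] with ξ hξ
  have := norm_pos_iff.2 hξ
  positivity

theorem IsSolution.exists_fourier_longitudinal (h : IsSolution U₀ U) (hρ : HasFourier U₀.ρ gρ)
    (hu : ∀ j, HasFourier (U₀.u j) (gu j)) (hΘ : HasFourier U₀.Θ gΘ) {t : ℝ} (ht : 0 ≤ t) :
    ∃ vρ vΘ, HasFourierOnCompact (U t).ρ vρ ∧ HasFourierOnCompact (U t).Θ vΘ ∧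
      ∀ᵐ ξ, ‖vρ ξ‖ ≤ 63 * Real.exp (-t / 2) * (‖gρ ξ‖ + ∑ j, ‖gu j ξ‖ + ‖gΘ ξ‖) ∧
        ‖vΘ ξ‖ ≤ 63 * Real.exp (-t / 2) * (‖gρ ξ‖ + ∑ j, ‖gu j ξ‖ + ‖gΘ ξ‖) := by
  obtain ⟨fd, hfd, hfdb⟩ := HasFourier.exists_divD hu
  have hf : ∀ i, HasFourier (![(U 0).ρ, divD (U 0).u, (U 0).Θ] i) (![gρ, fd, gΘ] i) := by
    rw [h.init]
    intro i
    fin_cases i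
    exacts [hρ, hfd, hΘ]
  have L := h.longitudinalSymbol.hasFourierOnCompact hf ht
  refine ⟨_, _, L 0, L 2, ?_⟩
  filter_upwards [ae_norm_pos] with ξ hξ
  have hS := longitudinalSystem_exp ξ (fun j => ![gρ, fd, gΘ] j ξ)
  have := hS.norm_le hξ (U := ∑ j, ‖gu j ξ‖)
    (by simp only [exp_zero_smul_mulVec]; exact hfdb ξ) ht
  simp only [exp_zero_smul_mulVec] at this
  exact this

theorem IsSolution.exists_fourier_magnetic (h : IsSolution U₀ U)
    (hu : ∀ j, HasFourier (U₀.u j) (gu j)) (hE : ∀ j, HasFourier (U₀.E j) (gE j))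
    (hB : ∀ j, HasFourier (U₀.B j) (gB j)) {t : ℝ} (ht : 0 ≤ t) (j : Fin 3) :
    ∃ v, HasFourierOnCompact ((U t).B j) v ∧
      ∀ᵐ ξ, ‖v ξ‖ ≤ 100 * decayProfile 0 0 t (2 * Real.pi * ‖ξ‖) *
        (∑ j, ‖gu j ξ‖ + ∑ j, ‖gE j ξ‖ + ∑ j, ‖gB j ξ‖) := by
  obtain ⟨fω, hfω, hfωb⟩ := HasFourier.exists_curlD hu j
  obtain ⟨fη, hfη, hfηb⟩ := HasFourier.exists_curlD hE j
  have hf : ∀ i, HasFourier (![curlD (U 0).u j, curlD (U 0).E j, (U 0).B j] i)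
      (![fω, fη, gB j] i) := by
    rw [h.init]
    intro i
    fin_cases i
    exacts [hfω, hfη, hB j]
  have L := (h.magneticSymbol j).hasFourierOnCompact hf ht
  refine ⟨_, L 2, ?_⟩
  filter_upwards [ae_norm_pos] with ξ hξ
  have hS := magneticSystem_exp ξ (fun i => ![fω, fη, gB j] i ξ)
  have hn : ∀ g : Fin 3 → R3 → ℂ, 0 ≤ ∑ j, ‖g j ξ‖ := fun g =>
    Finset.sum_nonneg fun _ _ => norm_nonneg _
  have hBj := Finset.single_le_sum (f := fun j => ‖gB j ξ‖) (fun _ _ => norm_nonneg _)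
    (Finset.mem_univ j)
  have := hS.norm_le hξ (N := ∑ j, ‖gu j ξ‖ + ∑ j, ‖gE j ξ‖ + ∑ j, ‖gB j ξ‖)
    (by
      simp only [exp_zero_smul_mulVec]
      refine (hfωb ξ).trans (mul_le_mul_of_nonneg_left ?_ hξ.le)
      linarith [hn gE, hn gB])
    (by
      simp only [exp_zero_smul_mulVec]
      refine (hfηb ξ).trans (mul_le_mul_of_nonneg_left ?_ hξ.le)
      linarith [hn gu, hn gB])
    (by
      simp only [exp_zero_smul_mulVec]
      refine le_trans hBj ?_
      linarith [hn gu, hn gE]) ht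
  exact this

theorem IsSolution.exists_fourier_component (h : IsSolution U₀ U) (h0 : Compatible U₀)
    (hρ : HasFourier U₀.ρ gρ) (hu : ∀ j, HasFourier (U₀.u j) (gu j)) (hΘ : HasFourier U₀.Θ gΘ)
    (hE : ∀ j, HasFourier (U₀.E j) (gE j)) (hB : ∀ j, HasFourier (U₀.B j) (gB j)) {t : ℝ}
    (ht : 0 ≤ t) (j : Fin 3) :
    ∃ vu vE, HasFourierOnCompact ((U t).u j) vu ∧ HasFourierOnCompact ((U t).E j) vE ∧
      ∀ᵐ ξ, ‖vu ξ‖ ≤ 410 * (Real.exp (-t / 2) * (‖gρ ξ‖ + ‖gΘ ξ‖) +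
          decayProfile 1 1 t (2 * Real.pi * ‖ξ‖) *
            (∑ j, ‖gu j ξ‖ + ∑ j, ‖gE j ξ‖ + ∑ j, ‖gB j ξ‖)) ∧
        ‖vE ξ‖ ≤ 410 * (decayProfile 1 0 t (2 * Real.pi * ‖ξ‖) *
            (∑ j, ‖gu j ξ‖ + ‖gΘ ξ‖ + ∑ j, ‖gE j ξ‖ + ∑ j, ‖gB j ξ‖)) := by
  obtain ⟨fd, hfd, hfdb⟩ := HasFourier.exists_divD hu
  obtain ⟨fe, hfe, hfeb⟩ := HasFourier.exists_divD hE
  obtain ⟨fc, hfc, hfcb⟩ := HasFourier.exists_curlD hB j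
  have hf : ∀ i, HasFourier (![(U 0).ρ, divD (U 0).u, (U 0).Θ, (U 0).u j, (U 0).E j,
      curlD (U 0).B j] i) (![gρ, fd, gΘ, gu j, gE j, fc] i) := by
    rw [h.init]
    intro i
    fin_cases i
    exacts [hρ, hfd, hΘ, hu j, hE j, hfc]
  have L := (h.componentSymbol j).hasFourierOnCompact hf ht
  -- Compatibility of the data gives |ρ₀| ≤ κ Σ|E₀| on the Fourier side, the factor κ needed to
  -- divide by the frequency in the longitudinal parts.
  rw [h0.1] at hfe
  refine ⟨_, _, L 3, L 4, ?_⟩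
  filter_upwards [ae_norm_pos, hρ.neg.ae_eq hfe] with ξ hξ hρe
  have hρb : ‖gρ ξ‖ ≤ 2 * Real.pi * ‖ξ‖ * ∑ j, ‖gE j ξ‖ := by
    have := hfeb ξ
    rwa [← hρe, Pi.neg_apply, norm_neg] at this
  have hle : ∀ g : Fin 3 → R3 → ℂ, ‖g j ξ‖ ≤ ∑ j, ‖g j ξ‖ := fun g =>
    Finset.single_le_sum (f := fun j => ‖g j ξ‖) (fun _ _ => norm_nonneg _) (Finset.mem_univ j)
  have hS := componentSystem_exp j ξ (fun i => ![gρ, fd, gΘ, gu j, gE j, fc] i ξ)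
  have hk : |2 * Real.pi * ξ j| ≤ 2 * Real.pi * ‖ξ‖ := by
    have := norm_freq_le j ξ
    rwa [norm_freq, ← abs_of_pos Real.two_pi_pos, ← abs_mul, abs_of_pos Real.two_pi_pos] at this
  have := hS.norm_le hξ hk (U := ∑ j, ‖gu j ξ‖) (V := ∑ j, ‖gE j ξ‖) (W := ∑ j, ‖gB j ξ‖)
    (by simp only [exp_zero_smul_mulVec]; exact hfdb ξ)
    (by simp only [exp_zero_smul_mulVec]; exact hle gu)
    (by simp only [exp_zero_smul_mulVec]; exact hρb)
    (by simp only [exp_zero_smul_mulVec]; exact hle gE)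
    (by simp only [exp_zero_smul_mulVec]; exact hfcb ξ) ht
  simp only [exp_zero_smul_mulVec] at this
  exact this

end FrequencySolutions

/-! ### Decay estimates for finite families of amplitudes -/

section DecayEstimates

open scoped NNReal

theorem measurable_decayProfile_norm (a b : ℕ) (t : ℝ) :
    Measurable fun ξ : R3 => decayProfile a b t (2 * Real.pi * ‖ξ‖) := by
  unfold decayProfile
  exact Measurable.add (by fun_prop) (Measurable.ite
    (measurableSet_le (by fun_prop) measurable_const) (by fun_prop) (by fun_prop))

theorem aestronglyMeasurable_sum_norm {ι : Type*} [Fintype ι] {T : ι → Dist} {g : ι → R3 → ℂ}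
    (hg : ∀ i, HasFourier (T i) (g i)) :
    AEStronglyMeasurable (fun ξ => ∑ i, ‖g i ξ‖) volume :=
  Finset.aestronglyMeasurable_fun_sum _ fun i _ =>
    (hg i).locallyIntegrable.aestronglyMeasurable.norm

/-- Decay of the amplitudes of a finite family of distributions. -/
theorem exists_eLpNorm_sum_le {p q r p' q' r' : ℝ≥0∞} (hp₁ : 1 ≤ p) (hp₂ : p ≤ 2)
    (hr₁ : 1 ≤ r) (hr₂ : r ≤ 2) (hq : 2 ≤ q) [ENNReal.HolderConjugate p p']
    [ENNReal.HolderConjugate q q'] [ENNReal.HolderConjugate r r'] {l : ℝ} (hl : 0 ≤ l)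
    (m a b : ℕ) :
    ∃ C : ℝ, 0 < C ∧ ∀ t : ℝ, 0 ≤ t → ∀ (ι : Type) [Fintype ι] (T : ι → Dist) (g : ι → R3 → ℂ),
      (∀ i, HasFourier (T i) (g i)) →
      eLpNorm (fun ξ => (2 * Real.pi * ‖ξ‖) ^ m * decayProfile a b t (2 * Real.pi * ‖ξ‖) *
        ∑ i, ‖g i ξ‖) q' volume ≤
      ENNReal.ofReal (C * (1 + t) ^ (-(3 / 2) * gap p q - ((m : ℝ) + a) / 2)) *
          ∑ i, gradNorm 0 p (T i) +
        ENNReal.ofReal (C * (1 + t) ^ (-(l + b) / 2)) *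
          ∑ i, gradNorm (m + bracketPlus l r q) r (T i) := by
  obtain ⟨C₁, hC₁, h₁⟩ := exists_eLpNorm_decayProfile_le (p' := p') (q' := q') (r' := r') hp₁ hp₂
    hr₁ hr₂ hq hl m a b
  obtain ⟨C₂, hC₂, h₂⟩ := exists_eLpNorm_pow_mul_le (r := p) (r' := p') hp₂ 0
  obtain ⟨C₃, hC₃, h₃⟩ := exists_eLpNorm_pow_mul_le (r := r) (r' := r') hr₂
    (m + bracketPlus l r q)
  have h1q' : 1 ≤ q' := ENNReal.HolderConjugate.one_le q' q
  refine ⟨C₁ * (C₂ + C₃), by positivity, fun t ht ι _ T g hg => ?_⟩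
  have hτ : 0 < 1 + t := by linarith
  have hcont : AEStronglyMeasurable (fun ξ : R3 => (2 * Real.pi * ‖ξ‖) ^ m *
      decayProfile a b t (2 * Real.pi * ‖ξ‖)) volume := by
    exact (Measurable.mul (by fun_prop) (measurable_decayProfile_norm a b t)).aestronglyMeasurable
  have hgm : ∀ i, AEStronglyMeasurable (fun ξ => ‖g i ξ‖) volume := fun i =>
    (hg i).locallyIntegrable.aestronglyMeasurable.norm
  have hcoef : ∀ (x : ℝ) (c d : ℝ≥0), 0 ≤ x → c ≤ d →
      ∀ N : ℝ≥0∞, ENNReal.ofReal (C₁ * x) * (c * N) ≤ ENNReal.ofReal (C₁ * d * x) * N := by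
    intro x c d hx hcd N
    rw [← mul_assoc, ← ENNReal.ofReal_coe_nnreal, ← ENNReal.ofReal_mul (by positivity)]
    gcongr ENNReal.ofReal ?_ * _
    rw [mul_right_comm]
    gcongr
  have hone : ∀ i, eLpNorm (fun ξ => (2 * Real.pi * ‖ξ‖) ^ m *
      decayProfile a b t (2 * Real.pi * ‖ξ‖) * ‖g i ξ‖) q' volume ≤
      ENNReal.ofReal (C₁ * (C₂ + C₃) * (1 + t) ^ (-(3 / 2) * gap p q - ((m : ℝ) + a) / 2)) *
          gradNorm 0 p (T i) +
        ENNReal.ofReal (C₁ * (C₂ + C₃) * (1 + t) ^ (-(l + b) / 2)) *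
          gradNorm (m + bracketPlus l r q) r (T i) := by
    intro i
    refine (h₁ t ht _ (hgm i)).trans (add_le_add ?_ ?_)
    · have := h₂ (T i) (g i) (hg i)
      simp only [pow_zero, one_mul] at this
      refine (mul_le_mul_right this _).trans ?_
      exact_mod_cast hcoef _ C₂ (C₂ + C₃) (by positivity) le_self_add _
    · refine (mul_le_mul_right (h₃ (T i) (g i) (hg i)) _).trans ?_
      exact_mod_cast hcoef _ C₃ (C₂ + C₃) (by positivity) le_add_self _
  have e : (fun ξ => (2 * Real.pi * ‖ξ‖) ^ m * decayProfile a b t (2 * Real.pi * ‖ξ‖) *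
      ∑ i, ‖g i ξ‖) = ∑ i, fun ξ => (2 * Real.pi * ‖ξ‖) ^ m *
        decayProfile a b t (2 * Real.pi * ‖ξ‖) * ‖g i ξ‖ := by
    funext ξ
    rw [Finset.mul_sum, Finset.sum_apply]
  rw [e]
  refine (eLpNorm_sum_le (fun i _ => hcont.mul (hgm i)) h1q').trans ?_
  refine (Finset.sum_le_sum fun i _ => hone i).trans_eq ?_
  rw [Finset.sum_add_distrib, Finset.mul_sum, Finset.mul_sum]

/-- Finiteness of the L^p norms is what makes the transforms of the data locally integrable
functions, the starting point of the representation formula. -/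
theorem exists_hasFourier_family {p : ℝ≥0∞} (hp₁ : 1 ≤ p) (hp₂ : p ≤ 2) {ι : Type*} [Fintype ι]
    {T : ι → Dist} (h : ∑ i, gradNorm 0 p (T i) ≠ ⊤) :
    ∃ g : ι → R3 → ℂ, ∀ i, HasFourier (T i) (g i) := by
  have := ENNReal.HolderConjugate.conjExponent hp₁
  obtain ⟨C, -, hC⟩ := exists_hasFourier_of_lpNorm_lt_top (p' := ENNReal.conjExponent p) hp₂
  have : ∀ i, ∃ g : R3 → ℂ, HasFourier (T i) g := fun i => by
    have := ENNReal.sum_ne_top.1 h i (Finset.mem_univ i)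
    rw [gradNorm_zero] at this
    obtain ⟨g, -, hg, -⟩ := hC (T i) this.lt_top
    exact ⟨g, hg⟩
  exact ⟨fun i => (this i).choose, fun i => (this i).choose_spec⟩

theorem decayProfile_zero (κ : ℝ) : decayProfile 0 0 0 κ = 2 := by
  norm_num [decayProfile]

/-- The undamped version of `exists_eLpNorm_sum_le`. -/
theorem exists_eLpNorm_pow_mul_sum_le {p q r p' q' r' : ℝ≥0∞} (hp₁ : 1 ≤ p) (hp₂ : p ≤ 2)
    (hr₁ : 1 ≤ r) (hr₂ : r ≤ 2) (hq : 2 ≤ q) [ENNReal.HolderConjugate p p']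
    [ENNReal.HolderConjugate q q'] [ENNReal.HolderConjugate r r'] (m : ℕ) :
    ∃ C : ℝ, 0 < C ∧ ∀ c : ℝ, 0 ≤ c → ∀ (ι : Type) [Fintype ι] (T : ι → Dist) (g : ι → R3 → ℂ),
      (∀ i, HasFourier (T i) (g i)) →
      eLpNorm (fun ξ => c * ((2 * Real.pi * ‖ξ‖) ^ m * ∑ i, ‖g i ξ‖)) q' volume ≤
      ENNReal.ofReal (C * c) *
        (∑ i, gradNorm 0 p (T i) + ∑ i, gradNorm (m + bracketPlus 0 r q) r (T i)) := by
  obtain ⟨C, hC, h⟩ := exists_eLpNorm_sum_le (p' := p') (q' := q') (r' := r') hp₁ hp₂ hr₁ hr₂ hq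
    (le_refl (0 : ℝ)) m 0 0
  refine ⟨C, hC, fun c hc ι _ T g hg => ?_⟩
  -- At time 0 with a = b = 0 the profile is the constant 2, which explains the factor c/2 below;
  -- taking l = 0 asks only for the number of derivatives that makes the transform integrable to the
  -- power q'.
  have h0 := h 0 le_rfl ι T g hg
  rw [add_zero, Real.one_rpow, Real.one_rpow, mul_one, ← mul_add] at h0
  have e : (fun ξ => c * ((2 * Real.pi * ‖ξ‖) ^ m * ∑ i, ‖g i ξ‖)) =
      (c / 2) • fun ξ => (2 * Real.pi * ‖ξ‖) ^ m * decayProfile 0 0 0 (2 * Real.pi * ‖ξ‖) *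
        ∑ i, ‖g i ξ‖ := by
    funext ξ
    simp only [decayProfile_zero, Pi.smul_apply, smul_eq_mul]
    ring
  rw [e, eLpNorm_const_smul, ← ofReal_norm, Real.norm_of_nonneg (by positivity)]
  refine (mul_le_mul_right h0 _).trans ?_
  rw [← mul_assoc, ← ENNReal.ofReal_mul (by positivity)]
  gcongr ENNReal.ofReal ?_ * _
  nlinarith

end DecayEstimates

/-! ### Estimates of the five unknowns -/

section MainEstimates

open scoped NNReal

variable {p q r : ℝ≥0∞}

theorem coe_mul_ofReal_mul_le {C : ℝ≥0} {c d x : ℝ} {N : ℝ≥0∞} (hx : 0 ≤ x) (h : C * c ≤ d) :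
    (C : ℝ≥0∞) * (ENNReal.ofReal (c * x) * N) ≤ ENNReal.ofReal (d * x) * N := by
  rw [← mul_assoc, ← ENNReal.ofReal_coe_nnreal, ← ENNReal.ofReal_mul C.coe_nonneg, ← mul_assoc]
  gcongr ENNReal.ofReal ?_ * _
  exact mul_le_mul_of_nonneg_right h hx

theorem exists_longitudinal_estimate (hp₁ : 1 ≤ p) (hp₂ : p ≤ 2) (hr₁ : 1 ≤ r) (hr₂ : r ≤ 2)
    (hq : 2 ≤ q) (m : ℕ) :
    ∃ C : ℝ, 0 < C ∧ ∀ (U₀ : State) (U : ℝ → State), IsSolution U₀ U → ∀ t : ℝ, 0 ≤ t →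
      gradNorm m q (U t).ρ ≤ ENNReal.ofReal (C * Real.exp (-t / 2)) *
        (U₀.normρuΘ 0 p + U₀.normρuΘ (m + bracketPlus 0 r q) r) ∧
      gradNorm m q (U t).Θ ≤ ENNReal.ofReal (C * Real.exp (-t / 2)) *
        (U₀.normρuΘ 0 p + U₀.normρuΘ (m + bracketPlus 0 r q) r) := by
  have := ENNReal.HolderConjugate.conjExponent hp₁
  have := ENNReal.HolderConjugate.conjExponent hr₁
  have := ENNReal.HolderConjugate.conjExponent (one_le_two.trans hq)
  obtain ⟨C₁, hC₁, h₁⟩ := exists_gradNorm_le (q' := ENNReal.conjExponent q) hq m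
  obtain ⟨C₂, hC₂, h₂⟩ := exists_eLpNorm_pow_mul_sum_le (p' := ENNReal.conjExponent p)
    (q' := ENNReal.conjExponent q) (r' := ENNReal.conjExponent r) hp₁ hp₂ hr₁ hr₂ hq m
  refine ⟨C₁ * (C₂ * 63), by positivity, fun U₀ U h t ht => ?_⟩
  -- With an infinite L^p norm the right side is infinite, its coefficient being positive. Otherwise
  -- all the data involved have functions as transforms. The L^r norm may still be infinite, which
  -- the later lemmas allow.
  rcases eq_or_ne (U₀.normρuΘ 0 p) ⊤ with hinf | hfin
  · rw [hinf, top_add, ENNReal.mul_top (by simp; positivity)]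
    exact ⟨le_top, le_top⟩
  set T : (Unit ⊕ Fin 3) ⊕ Unit → Dist := Sum.elim (Sum.elim (fun _ => U₀.ρ) U₀.u) fun _ => U₀.Θ
    with hT
  have hsum : ∀ (N : ℕ) (s : ℝ≥0∞), ∑ i, gradNorm N s (T i) = U₀.normρuΘ N s := by
    intro N s
    simp [hT, Fintype.sum_sum_type, State.normρuΘ, gradNormVec]
  obtain ⟨g, hg⟩ := exists_hasFourier_family hp₁ hp₂ (T := T) (by rwa [hsum])
  obtain ⟨vρ, vΘ, hvρ, hvΘ, hv⟩ := h.exists_fourier_longitudinal (hg (.inl (.inl ())))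
    (fun j => hg (.inl (.inr j))) (hg (.inr ())) ht
  have key := h₂ (63 * Real.exp (-t / 2)) (by positivity) _ T g hg
  rw [hsum, hsum, ← mul_assoc] at key
  have hG : ∀ ξ : R3, ‖g (.inl (.inl ())) ξ‖ + ∑ j, ‖g (.inl (.inr j)) ξ‖ + ‖g (.inr ()) ξ‖ =
      ∑ i, ‖g i ξ‖ := fun ξ => by simp [Fintype.sum_sum_type]
  have fin : ∀ (S : Dist) (v : R3 → ℂ), HasFourierOnCompact S v →
      (∀ᵐ ξ, ‖v ξ‖ ≤ 63 * Real.exp (-t / 2) * ∑ i, ‖g i ξ‖) →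
      gradNorm m q S ≤ ENNReal.ofReal (C₁ * (C₂ * 63) * Real.exp (-t / 2)) *
        (U₀.normρuΘ 0 p + U₀.normρuΘ (m + bracketPlus 0 r q) r) := by
    intro S v hS hSv
    refine (h₁ S v _ hS.1 hS.2 ?_).trans
      ((mul_le_mul_right key _).trans (coe_mul_ofReal_mul_le (Real.exp_pos _).le le_rfl))
    filter_upwards [hSv] with ξ hξ
    rw [mul_left_comm]
    gcongr
  simp only [hG] at hv
  exact ⟨fin _ _ hvρ (hv.mono fun ξ hξ => hξ.1), fin _ _ hvΘ (hv.mono fun ξ hξ => hξ.2)⟩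

theorem exists_velocity_estimate (hp₁ : 1 ≤ p) (hp₂ : p ≤ 2) (hr₁ : 1 ≤ r) (hr₂ : r ≤ 2)
    (hq : 2 ≤ q) {l : ℝ} (hl : 0 ≤ l) (m : ℕ) :
    ∃ C : ℝ, 0 < C ∧ ∀ (U₀ : State) (U : ℝ → State), Compatible U₀ → IsSolution U₀ U →
      ∀ t : ℝ, 0 ≤ t →
        gradNormVec m q (U t).u ≤
          ENNReal.ofReal (C * Real.exp (-t / 2)) *
            (U₀.normρΘ 0 p + U₀.normρΘ (m + bracketPlus 0 r q) r) +
          ENNReal.ofReal (C * (1 + t) ^ (-(3 / 2) * gap p q - ((m : ℝ) + 1) / 2)) *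
            U₀.normuEB 0 p +
          ENNReal.ofReal (C * (1 + t) ^ (-(l + 1) / 2)) *
            U₀.normuEB (m + bracketPlus l r q) r := by
  have := ENNReal.HolderConjugate.conjExponent hp₁
  have := ENNReal.HolderConjugate.conjExponent hr₁
  have hqq := ENNReal.HolderConjugate.conjExponent (one_le_two.trans hq)
  obtain ⟨C₁, hC₁, h₁⟩ := exists_gradNorm_le (q' := ENNReal.conjExponent q) hq m
  obtain ⟨C₂, hC₂, h₂⟩ := exists_eLpNorm_pow_mul_sum_le (p' := ENNReal.conjExponent p)
    (q' := ENNReal.conjExponent q) (r' := ENNReal.conjExponent r) hp₁ hp₂ hr₁ hr₂ hq m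
  obtain ⟨C₃, hC₃, h₃⟩ := exists_eLpNorm_sum_le (p' := ENNReal.conjExponent p)
    (q' := ENNReal.conjExponent q) (r' := ENNReal.conjExponent r) hp₁ hp₂ hr₁ hr₂ hq hl m 1 1
  refine ⟨(3 * C₁ * 410 : ℝ≥0) * (C₂ + C₃), by positivity, fun U₀ U h0 h t ht => ?_⟩
  have hτ : 0 < 1 + t := by linarith
  rcases eq_or_ne (U₀.normρΘ 0 p) ⊤ with hinf | hfin
  · rw [hinf, top_add, ENNReal.mul_top (by simp; positivity), top_add, top_add]
    exact le_top
  rcases eq_or_ne (U₀.normuEB 0 p) ⊤ with hinf | hfin'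
  · rw [hinf, ENNReal.mul_top (by simp; positivity), add_top, top_add]
    exact le_top
  -- Two families are kept apart because density and temperature reach the velocity only through the
  -- longitudinal block, with rate e^{-t/2} and no extra derivatives for decay, while the others
  -- carry the profile with a = b = 1.
  set T : Unit ⊕ Unit → Dist := Sum.elim (fun _ => U₀.ρ) fun _ => U₀.Θ with hT
  set T' : (Fin 3 ⊕ Fin 3) ⊕ Fin 3 → Dist := Sum.elim (Sum.elim U₀.u U₀.E) U₀.B with hT'
  have hsum : ∀ (N : ℕ) (s : ℝ≥0∞), ∑ i, gradNorm N s (T i) = U₀.normρΘ N s := by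
    intro N s
    simp [hT, Fintype.sum_sum_type, State.normρΘ]
  have hsum' : ∀ (N : ℕ) (s : ℝ≥0∞), ∑ i, gradNorm N s (T' i) = U₀.normuEB N s := by
    intro N s
    simp [hT', Fintype.sum_sum_type, State.normuEB, gradNormVec]
  obtain ⟨g, hg⟩ := exists_hasFourier_family hp₁ hp₂ (T := T) (by rwa [hsum])
  obtain ⟨g', hg'⟩ := exists_hasFourier_family hp₁ hp₂ (T := T') (by rwa [hsum'])
  have key := h₂ (Real.exp (-t / 2)) (by positivity) _ T g hg
  have key' := h₃ t ht _ T' g' hg'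
  rw [hsum, hsum] at key
  rw [hsum', hsum'] at key'
  have hgm : AEStronglyMeasurable (fun ξ => Real.exp (-t / 2) *
      ((2 * Real.pi * ‖ξ‖) ^ m * ∑ i, ‖g i ξ‖)) (volume : Measure R3) :=
    (AEStronglyMeasurable.mul (Continuous.aestronglyMeasurable (by fun_prop))
      (aestronglyMeasurable_sum_norm hg)).const_mul _
  have hgm' : AEStronglyMeasurable (fun ξ => (2 * Real.pi * ‖ξ‖) ^ m *
      decayProfile 1 1 t (2 * Real.pi * ‖ξ‖) * ∑ i, ‖g' i ξ‖) (volume : Measure R3) :=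
    (AEStronglyMeasurable.mul (Continuous.aestronglyMeasurable (by fun_prop))
      (measurable_decayProfile_norm 1 1 t).aestronglyMeasurable).mul
      (aestronglyMeasurable_sum_norm hg')
  have hone : ∀ j, gradNorm m q ((U t).u j) ≤ C₁ * ((410 : ℝ≥0) *
      (ENNReal.ofReal (C₂ * Real.exp (-t / 2)) *
        (U₀.normρΘ 0 p + U₀.normρΘ (m + bracketPlus 0 r q) r) +
      (ENNReal.ofReal (C₃ * (1 + t) ^ (-(3 / 2) * gap p q - ((m : ℝ) + (1 : ℕ)) / 2)) *
        U₀.normuEB 0 p +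
      ENNReal.ofReal (C₃ * (1 + t) ^ (-(l + (1 : ℕ)) / 2)) *
        U₀.normuEB (m + bracketPlus l r q) r))) := by
    intro j
    obtain ⟨v, _, hv, _, hvb⟩ := h.exists_fourier_component h0 (hg (.inl ()))
      (fun j => hg' (.inl (.inl j))) (hg (.inr ())) (fun j => hg' (.inl (.inr j)))
      (fun j => hg' (.inr j)) ht j
    refine (h₁ _ v ((410 : ℝ) • ((fun ξ => Real.exp (-t / 2) *
      ((2 * Real.pi * ‖ξ‖) ^ m * ∑ i, ‖g i ξ‖)) + fun ξ => (2 * Real.pi * ‖ξ‖) ^ m *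
      decayProfile 1 1 t (2 * Real.pi * ‖ξ‖) * ∑ i, ‖g' i ξ‖)) hv.1 hv.2 ?_).trans ?_
    · filter_upwards [hvb] with ξ hξ
      refine (mul_le_mul_of_nonneg_left hξ.1 (by positivity)).trans_eq ?_
      simp only [Pi.smul_apply, Pi.add_apply, smul_eq_mul, Fintype.sum_sum_type,
        Finset.univ_unique, Finset.sum_singleton]
      ring
    · rw [eLpNorm_const_smul]
      have e : ‖(410 : ℝ)‖ₑ = ((410 : ℝ≥0) : ℝ≥0∞) := by
        rw [← ofReal_norm, Real.norm_of_nonneg (by norm_num)]; simp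
      rw [e]
      gcongr
      exact (eLpNorm_add_le hgm hgm' (ENNReal.HolderConjugate.one_le _ q)).trans
        (add_le_add key key')
  rw [gradNormVec]
  refine (Finset.sum_le_sum fun j _ => hone j).trans ?_
  rw [Finset.sum_const, Finset.card_univ, Fintype.card_fin, nsmul_eq_mul, ← mul_assoc, ← mul_assoc]
  have e : ((3 : ℕ) : ℝ≥0∞) * C₁ * (410 : ℝ≥0) = ((3 * C₁ * 410 : ℝ≥0) : ℝ≥0∞) := by
    push_cast; rfl
  have hC₂' : ((3 * C₁ * 410 : ℝ≥0) : ℝ) * C₂ ≤ (3 * C₁ * 410 : ℝ≥0) * (C₂ + C₃) := by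
    gcongr; linarith
  have hC₃' : ((3 * C₁ * 410 : ℝ≥0) : ℝ) * C₃ ≤ (3 * C₁ * 410 : ℝ≥0) * (C₂ + C₃) := by
    gcongr; linarith
  have hsplit : ∀ K X Y Z : ℝ≥0∞, K * (X + (Y + Z)) = K * X + K * Y + K * Z :=
    fun _ _ _ _ => by ring
  rw [e, hsplit]
  have hone' : ((1 : ℕ) : ℝ) = 1 := Nat.cast_one
  rw [hone']
  exact add_le_add (add_le_add (coe_mul_ofReal_mul_le (Real.exp_pos _).le hC₂')
    (coe_mul_ofReal_mul_le (by positivity) hC₃')) (coe_mul_ofReal_mul_le (by positivity) hC₃')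

/-- Estimate of vector fields from the decay of their Fourier transforms. -/
theorem exists_gradNormVec_le (hp₁ : 1 ≤ p) (hp₂ : p ≤ 2) (hr₁ : 1 ≤ r) (hr₂ : r ≤ 2)
    (hq : 2 ≤ q) {l : ℝ} (hl : 0 ≤ l) (m a b : ℕ) :
    ∃ C : ℝ, 0 < C ∧ ∀ t : ℝ, 0 ≤ t → ∀ (ι : Type) [Fintype ι] (T : ι → Dist) (g : ι → R3 → ℂ)
      (S : Fin 3 → Dist), (∀ i, HasFourier (T i) (g i)) →
      (∀ j, ∃ v, HasFourierOnCompact (S j) v ∧ ∀ᵐ ξ, ‖v ξ‖ ≤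
        410 * (decayProfile a b t (2 * Real.pi * ‖ξ‖) * ∑ i, ‖g i ξ‖)) →
      gradNormVec m q S ≤
        ENNReal.ofReal (C * (1 + t) ^ (-(3 / 2) * gap p q - ((m : ℝ) + a) / 2)) *
          ∑ i, gradNorm 0 p (T i) +
        ENNReal.ofReal (C * (1 + t) ^ (-(l + b) / 2)) *
          ∑ i, gradNorm (m + bracketPlus l r q) r (T i) := by
  have := ENNReal.HolderConjugate.conjExponent hp₁
  have := ENNReal.HolderConjugate.conjExponent hr₁
  have hqq := ENNReal.HolderConjugate.conjExponent (one_le_two.trans hq)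
  obtain ⟨C₁, hC₁, h₁⟩ := exists_gradNorm_le (q' := ENNReal.conjExponent q) hq m
  obtain ⟨C₃, hC₃, h₃⟩ := exists_eLpNorm_sum_le (p' := ENNReal.conjExponent p)
    (q' := ENNReal.conjExponent q) (r' := ENNReal.conjExponent r) hp₁ hp₂ hr₁ hr₂ hq hl m a b
  refine ⟨(3 * C₁ * 410 : ℝ≥0) * C₃, by positivity, fun t ht ι _ T g S hg hS => ?_⟩
  have hτ : 0 < 1 + t := by linarith
  have key := h₃ t ht ι T g hg
  have hone : ∀ j, gradNorm m q (S j) ≤ C₁ * ((410 : ℝ≥0) *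
      (ENNReal.ofReal (C₃ * (1 + t) ^ (-(3 / 2) * gap p q - ((m : ℝ) + a) / 2)) *
        ∑ i, gradNorm 0 p (T i) +
      ENNReal.ofReal (C₃ * (1 + t) ^ (-(l + b) / 2)) *
        ∑ i, gradNorm (m + bracketPlus l r q) r (T i))) := by
    intro j
    obtain ⟨v, hv, hvb⟩ := hS j
    refine (h₁ _ v ((410 : ℝ) • fun ξ => (2 * Real.pi * ‖ξ‖) ^ m *
      decayProfile a b t (2 * Real.pi * ‖ξ‖) * ∑ i, ‖g i ξ‖) hv.1 hv.2 ?_).trans ?_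
    · filter_upwards [hvb] with ξ hξ
      refine (mul_le_mul_of_nonneg_left hξ (by positivity)).trans_eq ?_
      simp only [Pi.smul_apply, smul_eq_mul]
      ring
    · rw [eLpNorm_const_smul]
      have e : ‖(410 : ℝ)‖ₑ = ((410 : ℝ≥0) : ℝ≥0∞) := by
        rw [← ofReal_norm, Real.norm_of_nonneg (by norm_num)]; simp
      rw [e]
      gcongr
  rw [gradNormVec]
  refine (Finset.sum_le_sum fun j _ => hone j).trans ?_
  rw [Finset.sum_const, Finset.card_univ, Fintype.card_fin, nsmul_eq_mul, ← mul_assoc, ← mul_assoc]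
  have e : ((3 : ℕ) : ℝ≥0∞) * C₁ * (410 : ℝ≥0) = ((3 * C₁ * 410 : ℝ≥0) : ℝ≥0∞) := by
    push_cast; rfl
  rw [e, mul_add]
  exact add_le_add (coe_mul_ofReal_mul_le (by positivity) le_rfl)
    (coe_mul_ofReal_mul_le (by positivity) le_rfl)

theorem exists_electric_estimate (hp₁ : 1 ≤ p) (hp₂ : p ≤ 2) (hr₁ : 1 ≤ r) (hr₂ : r ≤ 2)
    (hq : 2 ≤ q) {l : ℝ} (hl : 0 ≤ l) (m : ℕ) :
    ∃ C : ℝ, 0 < C ∧ ∀ (U₀ : State) (U : ℝ → State), Compatible U₀ → IsSolution U₀ U →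
      ∀ t : ℝ, 0 ≤ t →
        gradNormVec m q (U t).E ≤
          ENNReal.ofReal (C * (1 + t) ^ (-(3 / 2) * gap p q - ((m : ℝ) + 1) / 2)) *
            U₀.normuΘEB 0 p +
          ENNReal.ofReal (C * (1 + t) ^ (-l / 2)) * U₀.normuΘEB (m + bracketPlus l r q) r := by
  obtain ⟨C, hC, hmain⟩ := exists_gradNormVec_le hp₁ hp₂ hr₁ hr₂ hq hl m 1 0
  refine ⟨C, hC, fun U₀ U h0 h t ht => ?_⟩
  have hτ : 0 < 1 + t := by linarith
  rcases eq_or_ne (U₀.normuΘEB 0 p) ⊤ with hinf | hfin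
  · rw [hinf, ENNReal.mul_top (by simp; positivity), top_add]
    exact le_top
  set T : ((Fin 3 ⊕ Unit) ⊕ Fin 3) ⊕ Fin 3 → Dist :=
    Sum.elim (Sum.elim (Sum.elim U₀.u fun _ => U₀.Θ) U₀.E) U₀.B with hT
  have hsum : ∀ (N : ℕ) (s : ℝ≥0∞), ∑ i, gradNorm N s (T i) = U₀.normuΘEB N s := by
    intro N s
    simp [hT, Fintype.sum_sum_type, State.normuΘEB, gradNormVec]
  obtain ⟨g, hg⟩ := exists_hasFourier_family hp₁ hp₂ (T := T) (by rwa [hsum])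
  have hE : ∀ j, HasFourier (U₀.E j) (g (.inl (.inr j))) := fun j => hg (.inl (.inr j))
  obtain ⟨f, hf, -⟩ := HasFourier.exists_divD hE
  -- The right side does not control ρ₀, but compatibility makes its transform a function, namely
  -- that of -∇·E₀.
  have hρ : HasFourier U₀.ρ (-f) := by
    have := hf.neg
    rwa [h0.1, neg_neg] at this
  have key := hmain t ht _ T g (U t).E hg fun j => by
    obtain ⟨_, v, _, hv, hvb⟩ := h.exists_fourier_component h0 hρ
      (fun j => hg (.inl (.inl (.inl j)))) (hg (.inl (.inl (.inr ())))) hE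
      (fun j => hg (.inr j)) ht j
    refine ⟨v, hv, hvb.mono fun ξ hξ => hξ.2.trans_eq ?_⟩
    simp only [Fintype.sum_sum_type, Finset.univ_unique, Finset.sum_singleton]
  rw [hsum, hsum] at key
  simpa using key

theorem exists_magnetic_estimate (hp₁ : 1 ≤ p) (hp₂ : p ≤ 2) (hr₁ : 1 ≤ r) (hr₂ : r ≤ 2)
    (hq : 2 ≤ q) {l : ℝ} (hl : 0 ≤ l) (m : ℕ) :
    ∃ C : ℝ, 0 < C ∧ ∀ (U₀ : State) (U : ℝ → State), IsSolution U₀ U → ∀ t : ℝ, 0 ≤ t →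
      gradNormVec m q (U t).B ≤
        ENNReal.ofReal (C * (1 + t) ^ (-(3 / 2) * gap p q - (m : ℝ) / 2)) * U₀.normuEB 0 p +
        ENNReal.ofReal (C * (1 + t) ^ (-l / 2)) * U₀.normuEB (m + bracketPlus l r q) r := by
  obtain ⟨C, hC, hmain⟩ := exists_gradNormVec_le hp₁ hp₂ hr₁ hr₂ hq hl m 0 0
  refine ⟨C, hC, fun U₀ U h t ht => ?_⟩
  have hτ : 0 < 1 + t := by linarith
  rcases eq_or_ne (U₀.normuEB 0 p) ⊤ with hinf | hfin
  · rw [hinf, ENNReal.mul_top (by simp; positivity), top_add]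
    exact le_top
  set T : (Fin 3 ⊕ Fin 3) ⊕ Fin 3 → Dist := Sum.elim (Sum.elim U₀.u U₀.E) U₀.B with hT
  have hsum : ∀ (N : ℕ) (s : ℝ≥0∞), ∑ i, gradNorm N s (T i) = U₀.normuEB N s := by
    intro N s
    simp [hT, Fintype.sum_sum_type, State.normuEB, gradNormVec]
  obtain ⟨g, hg⟩ := exists_hasFourier_family hp₁ hp₂ (T := T) (by rwa [hsum])
  have key := hmain t ht _ T g (U t).B hg fun j => by
    obtain ⟨v, hv, hvb⟩ := h.exists_fourier_magnetic (fun j => hg (.inl (.inl j)))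
      (fun j => hg (.inl (.inr j))) (fun j => hg (.inr j)) ht j
    refine ⟨v, hv, ?_⟩
    filter_upwards [hvb, ae_norm_pos] with ξ hξ hpos
    refine hξ.trans ?_
    simp only [Fintype.sum_sum_type]
    have hW : 0 ≤ decayProfile 0 0 t (2 * Real.pi * ‖ξ‖) :=
      (Real.exp_pos _).le.trans (exp_le_decayProfile 0 0 ht hpos)
    rw [mul_assoc]
    gcongr
    norm_num
  rw [hsum, hsum] at key
  simpa using key

end MainEstimates

end EulerMaxwell

open EulerMaxwell in
theorem theorem4p4 (p q r : ℝ≥0∞) (hp₁ : 1 ≤ p) (hp₂ : p ≤ 2) (hr₁ : 1 ≤ r) (hr₂ : r ≤ 2)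
    (hq : 2 ≤ q) (l : ℝ) (hl : 0 ≤ l) (m : ℕ) :
    ∃ C : ℝ, 0 < C ∧ ∀ (U₀ : State) (U : ℝ → State), Compatible U₀ → IsSolution U₀ U →
      ∀ t : ℝ, 0 ≤ t →
        gradNorm m q (U t).ρ ≤
            ENNReal.ofReal (C * Real.exp (-t / 2)) *
              (U₀.normρuΘ 0 p + U₀.normρuΘ (m + bracketPlus 0 r q) r) ∧
        gradNormVec m q (U t).u ≤
            ENNReal.ofReal (C * Real.exp (-t / 2)) *
              (U₀.normρΘ 0 p + U₀.normρΘ (m + bracketPlus 0 r q) r) +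
            ENNReal.ofReal (C * (1 + t) ^ (-(3 / 2) * gap p q - ((m : ℝ) + 1) / 2)) *
              U₀.normuEB 0 p +
            ENNReal.ofReal (C * (1 + t) ^ (-(l + 1) / 2)) *
              U₀.normuEB (m + bracketPlus l r q) r ∧
        gradNorm m q (U t).Θ ≤
            ENNReal.ofReal (C * Real.exp (-t / 2)) *
              (U₀.normρuΘ 0 p + U₀.normρuΘ (m + bracketPlus 0 r q) r) ∧
        gradNormVec m q (U t).E ≤
            ENNReal.ofReal (C * (1 + t) ^ (-(3 / 2) * gap p q - ((m : ℝ) + 1) / 2)) *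
              U₀.normuΘEB 0 p +
            ENNReal.ofReal (C * (1 + t) ^ (-l / 2)) *
              U₀.normuΘEB (m + bracketPlus l r q) r ∧
        gradNormVec m q (U t).B ≤
            ENNReal.ofReal (C * (1 + t) ^ (-(3 / 2) * gap p q - (m : ℝ) / 2)) *
              U₀.normuEB 0 p +
            ENNReal.ofReal (C * (1 + t) ^ (-l / 2)) *
              U₀.normuEB (m + bracketPlus l r q) r := by
  obtain ⟨C₁, hC₁, h₁⟩ := exists_longitudinal_estimate hp₁ hp₂ hr₁ hr₂ hq m
  obtain ⟨C₂, hC₂, h₂⟩ := exists_velocity_estimate hp₁ hp₂ hr₁ hr₂ hq hl m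
  obtain ⟨C₃, hC₃, h₃⟩ := exists_electric_estimate hp₁ hp₂ hr₁ hr₂ hq hl m
  obtain ⟨C₄, hC₄, h₄⟩ := exists_magnetic_estimate hp₁ hp₂ hr₁ hr₂ hq hl m
  refine ⟨C₁ + C₂ + C₃ + C₄, by positivity, fun U₀ U h0 h t ht => ?_⟩
  have hτ : 0 < 1 + t := by linarith
  have c₁ : C₁ ≤ C₁ + C₂ + C₃ + C₄ := by linarith
  have c₂ : C₂ ≤ C₁ + C₂ + C₃ + C₄ := by linarith
  have c₃ : C₃ ≤ C₁ + C₂ + C₃ + C₄ := by linarith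
  have c₄ : C₄ ≤ C₁ + C₂ + C₃ + C₄ := by linarith
  refine ⟨(h₁ U₀ U h t ht).1.trans ?_, (h₂ U₀ U h0 h t ht).trans ?_,
    (h₁ U₀ U h t ht).2.trans ?_, (h₃ U₀ U h0 h t ht).trans ?_, (h₄ U₀ U h t ht).trans ?_⟩ <;>
  gcongr
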